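/- Theorem (separated nonlinear Schrödinger equation). Let $\kappa\in[0,1]$. For real $x,\beta$ and real $t\neq 0$ put $$\vartheta(\lambda)=\frac1{1+e^{\lambda^2-\beta}},\qquad G(t,x)=\int_{-\infty}^{\infty}e^{-2it\mu^2-2ix\mu}\,d\mu,$$ $$E(\lambda)=\mathrm{P.V.}\!\int_{-\infty}^{\infty}\frac{e^{-2it\mu^2-2ix\mu}}{\mu-\lambda}\,d\mu+\pi\tan(\pi\kappa/2)\,e^{-2it\lambda^2-2ix\lambda},$$ $$e_-(\lambda)=\frac{\cos(\pi\kappa/2)}{\pi}\sqrt{\vartheta(\lambda)}\,e^{it\lambda^2+ix\lambda},\qquad e_+(\lambda)=e_-(\lambda)E(\lambda),$$ where the (conditionally convergent) integrals over the line are limits of integrals over $|\mu|<R$ as $R\to\infty$, and where in $e_+$ the product $\cos(\pi\kappa/2)\tan(\pi\kappa/2)$ is read as $\sin(\pi\kappa/2)$ (this matters only for $\kappa=1$). Let $\hat V_T$ be the integral operator on $L^2(\mathbb R)$ with kernel $$V_T(\lambda,\mu)=\frac{e_+(\lambda)e_-(\mu)-e_-(\lambda)e_+(\mu)}{\lambda-\mu},$$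 and let $U=U_\kappa$ be the set of $(x,t,\beta)\in\mathbb R^3$ with $t\ne0$ for which $1+\hat V_T$ is invertible on $L^2(\mathbb R)$. On $U$ let $f_\pm\in L^2(\mathbb R)$ be the solutions of $(1+\hat V_T)f_\pm=e_\pm$, and define $$B_{--}=\int_{-\infty}^\infty e_-f_-\,d\lambda,\qquad B_{++}=\int_{-\infty}^\infty e_+f_+\,d\lambda,\qquad b_{++}=B_{++}-G,$$ $$g_-=e^{-2it\beta}B_{--},\quad g_+=e^{2it\beta}b_{++},\quad n=g_-g_+,\quad p=g_-\partial_xg_+-g_+\partial_xg_-.$$ Then $U$ is open, the functions $g_\pm$ and $\partial_xg_\pm$ of $(x,t,\beta)$ are differentiable on $U$, and on $U$ $$-i\partial_tg_+=2\beta g_++\tfrac12\partial_x^2g_++4g_+^2g_-,\qquad i\partial_tg_-=2\beta g_-+\tfrac12\partial_x^2g_-+4g_-^2g_+,$$ $$-2i\,\partial_tn=\partial_xp.$$ Moreover there is a differentiable function $\varphi$ on $U$ such that on $U$ $$\partial_\beta\partial_xg_+=\varphi\,g_+,\qquad \partial_\beta\partial_xg_-=\varphi\,g_-$$ (so $\varphi=\partial_\beta\partial_xg_+/g_+=\partial_\beta\partial_xg_-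 /g_-$ wherever the denominators do not vanish), and $$-i\partial_t\varphi+4\partial_\beta p=0,\qquad \partial_x\varphi+8\partial_\beta n+2=0.$$ -/

import Mathlib

open MeasureTheory Filter Topology

noncomputable section

namespace AnyonNLS

/-- The exponential `e^{-2itμ² - 2ixμ}`. -/
def phase (x t μ : ℝ) : ℂ :=
  Complex.exp (-2 * Complex.I * t * (μ : ℂ) ^ 2 - 2 * Complex.I * x * μ)

/-- `G(t,x) = ∫ e^{-2itμ² - 2ixμ} dμ`. The integral converges only conditionally, so it is the
limit of the integrals over `[-R, R]`. -/
def potG (x t : ℝ) : ℂ :=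
  limUnder atTop (fun R : ℝ => ∫ μ in (-R)..R, phase x t μ)

/-- The principal value integral `P.V. ∫ e^{-2itμ² - 2ixμ} / (μ - l) dμ`: the window
`|μ - l| ≤ ε` and the tails `|μ| ≥ R` are cut off, and `ε → 0+`, `R → ∞`. -/
def pvIntegral (x t l : ℝ) : ℂ :=
  limUnder (𝓝[>] (0 : ℝ) ×ˢ (atTop : Filter ℝ)) (fun p : ℝ × ℝ =>
    ∫ μ in {μ : ℝ | p.1 < |μ - l| ∧ |μ| < p.2}, phase x t μ / ((μ : ℂ) - (l : ℂ)))

/-- The function `E(l|t,x)`; it is used for `κ ≠ 1` only. -/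
def funE (κ x t l : ℝ) : ℂ :=
  pvIntegral x t l + (Real.pi * Real.tan (Real.pi * κ / 2) : ℝ) * phase x t l

/-- The Fermi weight `1 / (1 + e^{l² - β})`. -/
def fermi (β l : ℝ) : ℝ := 1 / (1 + Real.exp (l ^ 2 - β))

/-- `e₋`. -/
def eMinus (κ x t β l : ℝ) : ℂ :=
  (Real.cos (Real.pi * κ / 2) / Real.pi * Real.sqrt (fermi β l) : ℝ) *
    Complex.exp (Complex.I * t * (l : ℂ) ^ 2 + Complex.I * l * x)

/-- `e₊ = e₋ E`, with the factor `cos (πκ/2)` multiplied out so that the definition also makes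
sense at `κ = 1`, where `cos (πκ/2) tan (πκ/2)` is to be read as `sin (πκ/2)`; see
`ePlus_eq_eMinus_mul_funE`. -/
def ePlus (κ x t β l : ℝ) : ℂ :=
  (1 / Real.pi * Real.sqrt (fermi β l) : ℝ) *
    Complex.exp (Complex.I * t * (l : ℂ) ^ 2 + Complex.I * l * x) *
    ((Real.cos (Real.pi * κ / 2) : ℝ) * pvIntegral x t l +
      (Real.pi * Real.sin (Real.pi * κ / 2) : ℝ) * phase x t l)

theorem ePlus_eq_eMinus_mul_funE (κ x t β l : ℝ) (h : Real.cos (Real.pi * κ / 2) ≠ 0) :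
    ePlus κ x t β l = eMinus κ x t β l * funE κ x t l := by
  have h1 : Real.sin (Real.pi * κ / 2) =
      Real.cos (Real.pi * κ / 2) * Real.tan (Real.pi * κ / 2) := by
    exact (mul_comm _ _).trans (Real.tan_mul_cos h) |>.symm
  unfold ePlus eMinus funE
  rw [h1]
  push_cast
  ring

/-- The kernel `V_T(l, μ)`; its value on the diagonal (a null set) plays no role. -/
def kerV (κ x t β l μ : ℝ) : ℂ :=
  (ePlus κ x t β l * eMinus κ x t β μ - eMinus κ x t β l * ePlus κ x t β μ) /
    ((l : ℂ) - (μ : ℂ))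

/-- `f ∈ L²(ℝ)` solves the integral equation `(1 + V_T) f = h`. -/
def Solves (κ x t β : ℝ) (h f : ℝ → ℂ) : Prop :=
  MemLp f 2 volume ∧ ∀ᵐ l : ℝ, f l + ∫ μ : ℝ, kerV κ x t β l μ * f μ = h l

/-- The operator `1 + V_T` on `L²(ℝ)` is invertible: for every right-hand side in `L²(ℝ)` the
integral equation has exactly one solution in `L²(ℝ)`. -/
def OneAddVInvertible (κ x t β : ℝ) : Prop :=
  ∀ h : ℝ → ℂ, MemLp h 2 volume →
    (∃ f, Solves κ x t β h f) ∧
      ∀ f₁ f₂, Solves κ x t β h f₁ → Solves κ x t β h f₂ → f₁ =ᵐ[volume] f₂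

/-- The set of `(x, t, β)` with `t ≠ 0` at which `1 + V_T` is invertible. -/
def regularSet (κ : ℝ) : Set (ℝ × ℝ × ℝ) :=
  {q | q.2.1 ≠ 0 ∧ OneAddVInvertible κ q.1 q.2.1 q.2.2}

/-- `f₊`, the solution of `(1 + V_T) f₊ = e₊`. -/
def fPlus (κ x t β : ℝ) : ℝ → ℂ :=
  Classical.epsilon (fun f : ℝ → ℂ => Solves κ x t β (ePlus κ x t β) f)

/-- `f₋`, the solution of `(1 + V_T) f₋ = e₋`. -/
def fMinus (κ x t β : ℝ) : ℝ → ℂ :=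
  Classical.epsilon (fun f : ℝ → ℂ => Solves κ x t β (eMinus κ x t β) f)

/-- The potential `B₊₊ = ∫ e₊ f₊`. -/
def potBpp (κ x t β : ℝ) : ℂ := ∫ l : ℝ, ePlus κ x t β l * fPlus κ x t β l

/-- The potential `B₋₋ = ∫ e₋ f₋`. -/
def potBmm (κ x t β : ℝ) : ℂ := ∫ l : ℝ, eMinus κ x t β l * fMinus κ x t β l

/-- `b₊₊ = B₊₊ - G`. -/
def potbpp (κ x t β : ℝ) : ℂ := potBpp κ x t β - potG x t

/-- `g₊ = e^{2itβ} b₊₊`. -/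
def gPlus (κ x t β : ℝ) : ℂ := Complex.exp (2 * Complex.I * t * β) * potbpp κ x t β

/-- `g₋ = e^{-2itβ} B₋₋`. -/
def gMinus (κ x t β : ℝ) : ℂ := Complex.exp (-2 * Complex.I * t * β) * potBmm κ x t β

/-- The partial derivative `∂ₓ` of a function of `(x, t, β)`. -/
def dX (F : ℝ → ℝ → ℝ → ℂ) (x t β : ℝ) : ℂ := deriv (fun s => F s t β) x

/-- The partial derivative `∂ₜ`. -/
def dT (F : ℝ → ℝ → ℝ → ℂ) (x t β : ℝ) : ℂ := deriv (fun s => F x s β) t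

/-- The partial derivative `∂_β`. -/
def dB (F : ℝ → ℝ → ℝ → ℂ) (x t β : ℝ) : ℂ := deriv (fun s => F x t s) β

/-- `n = g₋ g₊`. -/
def potN (κ x t β : ℝ) : ℂ := gMinus κ x t β * gPlus κ x t β

/-- `p = g₋ ∂ₓ g₊ - g₊ ∂ₓ g₋`. -/
def potP (κ x t β : ℝ) : ℂ :=
  gMinus κ x t β * dX (gPlus κ) x t β - gPlus κ x t β * dX (gMinus κ) x t β

/-- Total differentiability, on a set of triples `(x, t, β)`, of a function of `(x, t, β)`. -/
def DiffOn (F : ℝ → ℝ → ℝ → ℂ) (U : Set (ℝ × ℝ × ℝ)) : Prop :=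
  DifferentiableOn ℝ (fun q : ℝ × ℝ × ℝ => F q.1 q.2.1 q.2.2) U

end AnyonNLS

end

/-! ### Fresnel integrals and the closed form of the principal value integral. -/

noncomputable section

namespace AnyonNLS

open Complex (I)

/-! Write `M = B₋₋`, `b = b₊₊`, `R = B₊₋ = ∫ e₊ f₋`. The principal value integral equals
`e^{-2itl²-2ixl} J` with `J = -2i ∫₀^{x+2tl} G(t,y) dy` (`pvIntegral_eq`). Hence `e±` solve a linear
system: `∂ₓe₋ = il e₋`, `∂ₓe₊ = -il e₊ - 2iG e₋`, and similarly in `t` with `l²` in place of `l`.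
Differentiating the kernel of `V` in `x` or `t` produces a factor `l - m` that cancels the
denominator, so `∂ₓV` and `∂ₜV` have finite rank (`hasFDerivAt_kerH_apply`). For the same reason
`[l, V] = e₊⊗e₋ - e₋⊗e₊` (`commutator`), which lets powers of `l` pass through the resolvent
(`res_eVec_one`, `scal_shift`).

With `V` symmetric for the bilinear pairing `∫ uv`, this gives `∂ₓR = 2iMb`, `∂ₜR = b ∂ₓM - M ∂ₓb`,
and the cubic Schrödinger equations for `M` and `b`; the factors `e^{∓2itβ}` add the terms `2βg±`.
Thus `n = -(i/2) ∂ₓR` and `p = -∂ₜR`. With `φ = -2x + 4i ∂_βR`, the conservation law and the two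
equations for `φ` all say that mixed partial derivatives of `R` commute.

Only the identities `∂_β∂ₓg± = φ g±` use the form of the Fermi weight. From `∂_βϑ = ϑ(1-ϑ)` one gets
`∂_β ∫ e_a f_b = ∫ f_a (1-ϑ) f_b`; the remaining integral `∫ l f_a (1-ϑ) f_a` is found from
translation invariance. Since `ϑ` depends on `β - l²` alone, `l(1-ϑ)` arises when the weight is
shifted, while shifting `l` in `e± / √ϑ` amounts to `x ↦ x + 2ts` up to opposite phases.
Differentiating at `s = 0` yields `pairing_lfVec_coFermi`.

For the analysis, `V = w K w`, where the weight `w = e^{l²/4} √ϑ` carries `β` and the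
Gaussian-damped operator `K` carries `(x, t)`. Both are smooth in sup norm, so everything built from
`(1+V)⁻¹` is smooth on the open set where `1 + V` is a unit. -/

theorem continuous_phase (x t : ℝ) : Continuous (phase x t) := by
  unfold phase; fun_prop

theorem norm_phase (x t l : ℝ) : ‖phase x t l‖ = 1 := by
  have h : (-2 * I * t * (l : ℂ) ^ 2 - 2 * I * x * l) = ((-2 * t * l ^ 2 - 2 * x * l : ℝ) : ℂ) * I := by
    push_cast; ring
  rw [phase, h, Complex.norm_exp_ofReal_mul_I]

theorem phase_zero_neg (t u : ℝ) : phase 0 t (-u) = phase 0 t u := by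
  simp [phase]

/-- The incomplete Fresnel integral `∫₀ᴿ e^{-2itu²} du`. -/
def fresnelInt (t R : ℝ) : ℂ := ∫ u in (0 : ℝ)..R, phase 0 t u

theorem fresnelInt_neg (t R : ℝ) : fresnelInt t (-R) = -fresnelInt t R := by
  have := intervalIntegral.integral_comp_neg (f := phase 0 t) (a := 0) (b := R)
  simp only [phase_zero_neg, neg_zero] at this
  rw [fresnelInt, fresnelInt, this, intervalIntegral.integral_symm]

theorem continuous_fresnelInt (t : ℝ) : Continuous (fresnelInt t) :=
  intervalIntegral.continuous_primitive (fun _ _ => (continuous_phase 0 t).intervalIntegrable _ _) 0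

theorem hasDerivAt_phase_zero (t u : ℝ) :
    HasDerivAt (phase 0 t) (-4 * I * t * u * phase 0 t u) u := by
  have h : HasDerivAt (fun v : ℝ => -2 * I * t * (v : ℂ) ^ 2 - 2 * I * (0 : ℝ) * v)
      (-4 * I * t * u) u := by
    have h1 : HasDerivAt (fun v : ℝ => (v : ℂ)) 1 u := Complex.ofRealCLM.hasDerivAt
    refine (((h1.pow 2).const_mul (-2 * I * t)).sub (h1.const_mul (2 * I * (0 : ℝ)))).congr_deriv ?_
    push_cast; ring
  exact h.cexp.congr_deriv (by rw [phase]; ring)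

/-- One integration by parts on `[1, R]` leaves a boundary term of order `1/R` and an integrand of
order `u⁻²`, which converges absolutely. -/
theorem exists_tendsto_fresnelInt {t : ℝ} (ht : t ≠ 0) :
    ∃ c, Tendsto (fresnelInt t) atTop (𝓝 c) := by
  have htc : (t : ℂ) ≠ 0 := by exact_mod_cast ht
  -- Chosen so that `(k / u)` times the derivative of `phase 0 t` at `u` is `phase 0 t u` itself.
  set k : ℂ := I / (4 * t) with hk
  have hparts : ∀ R : ℝ, 1 ≤ R → fresnelInt t R = fresnelInt t 1 + (k * (R : ℂ)⁻¹ * phase 0 t R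
      - k * (1 : ℂ)⁻¹ * phase 0 t 1
      - ∫ u in (1 : ℝ)..R, (-k * ((u : ℂ) ^ 2)⁻¹) * phase 0 t u) := by
    intro R hR
    have hpos : ∀ u ∈ Set.uIcc 1 R, (u : ℂ) ≠ 0 := by
      intro u hu
      rw [Set.uIcc_of_le hR] at hu
      exact_mod_cast (by linarith [hu.1] : (0 : ℝ) < u).ne'
    have hu : ∀ u ∈ Set.uIcc 1 R, HasDerivAt (fun u : ℝ => k * (u : ℂ)⁻¹)
        (-k * ((u : ℂ) ^ 2)⁻¹) u := by
      intro u hu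
      have h1 : HasDerivAt (fun v : ℝ => (v : ℂ)) 1 u := Complex.ofRealCLM.hasDerivAt
      refine ((h1.fun_inv (hpos u hu)).const_mul k).congr_deriv ?_
      field_simp
    have hcont : ContinuousOn (fun u : ℝ => -k * ((u : ℂ) ^ 2)⁻¹) (Set.uIcc 1 R) := by
      refine ContinuousOn.mul continuousOn_const (ContinuousOn.inv₀ (by fun_prop) ?_)
      intro u hu; exact pow_ne_zero 2 (hpos u hu)
    have := intervalIntegral.integral_mul_deriv_eq_deriv_mul hu
      (fun u _ => hasDerivAt_phase_zero t u) hcont.intervalIntegrable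
      (((by fun_prop : Continuous fun u : ℝ => -4 * I * t * u).mul
        (continuous_phase 0 t)).intervalIntegrable _ _)
    rw [fresnelInt, fresnelInt, ← intervalIntegral.integral_add_adjacent_intervals
      ((continuous_phase 0 t).intervalIntegrable 0 1) ((continuous_phase 0 t).intervalIntegrable 1 R)]
    congr 1
    push_cast at this
    rw [← this]
    refine intervalIntegral.integral_congr fun u hu => ?_
    have := hpos u hu
    simp only [hk]
    field_simp
    rw [Complex.I_sq]; ring
  have hint : IntegrableOn (fun u : ℝ => (-k * ((u : ℂ) ^ 2)⁻¹) * phase 0 t u) (Set.Ioi 1) := by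
    have h1 : IntegrableOn (fun u : ℝ => ‖k‖ * u ^ (-2 : ℝ)) (Set.Ioi 1) :=
      (integrableOn_Ioi_rpow_of_lt (by norm_num) one_pos).const_mul _
    refine Integrable.mono' h1 ?_ ?_
    · refine ContinuousOn.aestronglyMeasurable ?_ measurableSet_Ioi
      refine ContinuousOn.mul (ContinuousOn.mul continuousOn_const (ContinuousOn.inv₀ (by fun_prop) ?_))
        (continuous_phase 0 t).continuousOn
      intro u hu
      exact pow_ne_zero 2 (by exact_mod_cast (lt_trans one_pos hu).ne')
    · refine (ae_restrict_iff' measurableSet_Ioi).2 (Eventually.of_forall fun u hu => ?_)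
      have hu0 : 0 < u := lt_trans one_pos hu
      rw [norm_mul, norm_phase, mul_one, norm_mul, norm_neg, norm_inv, norm_pow, Complex.norm_real,
        Real.rpow_neg hu0.le]
      simp [abs_of_pos hu0]
  have hlim := intervalIntegral_tendsto_integral_Ioi (1 : ℝ) hint tendsto_id
  have hb : Tendsto (fun R : ℝ => k * (R : ℂ)⁻¹ * phase 0 t R) atTop (𝓝 0) := by
    rw [tendsto_zero_iff_norm_tendsto_zero]
    have : Tendsto (fun R : ℝ => ‖k‖ * |R|⁻¹) atTop (𝓝 (‖k‖ * 0)) :=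
      (tendsto_inv_atTop_zero.comp tendsto_abs_atTop_atTop).const_mul _
    rw [mul_zero] at this
    refine this.congr fun R => ?_
    rw [norm_mul, norm_phase, mul_one, norm_mul, norm_inv, Complex.norm_real, Real.norm_eq_abs]
  refine ⟨_, Tendsto.congr' ?_ (((hb.sub_const (k * (1 : ℂ)⁻¹ * phase 0 t 1)).sub hlim).const_add
    (fresnelInt t 1))⟩
  filter_upwards [eventually_ge_atTop 1] with R hR
  exact (hparts R hR).symm

theorem exists_norm_fresnelInt_le {t : ℝ} (ht : t ≠ 0) : ∃ M, ∀ R, ‖fresnelInt t R‖ ≤ M := by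
  obtain ⟨c, hc⟩ := exists_tendsto_fresnelInt ht
  obtain ⟨N, hN⟩ := eventually_atTop.1 (hc.norm.eventually_le_const (lt_add_one ‖c‖))
  obtain ⟨C, hC⟩ := (isCompact_Icc (a := 0) (b := N)).exists_bound_of_continuousOn
    (continuous_fresnelInt t).continuousOn
  have key : ∀ R, 0 ≤ R → ‖fresnelInt t R‖ ≤ max C (‖c‖ + 1) := by
    intro R hR
    rcases le_total R N with h | h
    · exact (hC R ⟨hR, h⟩).trans (le_max_left _ _)
    · exact (hN R h).trans (le_max_right _ _)
  refine ⟨max C (‖c‖ + 1), fun R => ?_⟩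
  rcases le_total 0 R with h | h
  · exact key R h
  · rw [← neg_neg R, fresnelInt_neg, norm_neg]
    exact key _ (by linarith)

/-- Completing the square: `x` only translates the Gaussian phase and multiplies it by a constant
phase. This reduces every `G(t,x)` to `G(t,0)`. -/
theorem phase_eq_shift {t : ℝ} (ht : t ≠ 0) (x l : ℝ) :
    phase x t l = Complex.exp (I * x ^ 2 / (2 * t)) * phase 0 t (l + x / (2 * t)) := by
  have htc : (t : ℂ) ≠ 0 := by exact_mod_cast ht
  rw [phase, phase, ← Complex.exp_add]
  congr 1
  push_cast
  field_simp
  ring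

theorem integral_phase_symm {t : ℝ} (ht : t ≠ 0) (x R : ℝ) :
    ∫ u in (-R)..R, phase x t u = Complex.exp (I * x ^ 2 / (2 * t)) *
      (fresnelInt t (R + x / (2 * t)) + fresnelInt t (R - x / (2 * t))) := by
  have h1 : ∀ u, phase x t u = Complex.exp (I * x ^ 2 / (2 * t)) * phase 0 t (u + x / (2 * t)) :=
    phase_eq_shift ht x
  simp_rw [h1]
  rw [intervalIntegral.integral_const_mul, intervalIntegral.integral_comp_add_right (phase 0 t)]
  have h2 : fresnelInt t (R - x / (2 * t)) = - fresnelInt t (-R + x / (2 * t)) := by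
    rw [← fresnelInt_neg]; congr 1; ring
  rw [h2, ← sub_eq_add_neg, fresnelInt, fresnelInt, intervalIntegral.integral_interval_sub_left]
  · exact (continuous_phase 0 t).intervalIntegrable _ _
  · exact (continuous_phase 0 t).intervalIntegrable _ _

theorem tendsto_integral_phase {t : ℝ} (ht : t ≠ 0) (x : ℝ) :
    Tendsto (fun R : ℝ => ∫ u in (-R)..R, phase x t u) atTop
      (𝓝 (Complex.exp (I * x ^ 2 / (2 * t)) * potG 0 t)) := by
  obtain ⟨c, hc⟩ := exists_tendsto_fresnelInt ht
  have key : ∀ x : ℝ, Tendsto (fun R : ℝ => ∫ u in (-R)..R, phase x t u) atTop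
      (𝓝 (Complex.exp (I * x ^ 2 / (2 * t)) * (c + c))) := by
    intro x
    simp_rw [integral_phase_symm ht x]
    refine ((hc.comp (tendsto_atTop_add_const_right _ _ tendsto_id)).add
      (hc.comp ?_)).const_mul _
    exact tendsto_atTop_add_const_right _ (-(x / (2 * t))) tendsto_id
  have h0 : potG 0 t = c + c := by
    have := (key 0).limUnder_eq
    simpa [potG] using this
  rw [h0]
  exact key x

theorem potG_eq {t : ℝ} (ht : t ≠ 0) (x : ℝ) :
    potG x t = Complex.exp (I * x ^ 2 / (2 * t)) * potG 0 t :=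
  (tendsto_integral_phase ht x).limUnder_eq

/-- Uniformity in both `x` and `R` is the domination that allows `R → ∞` under the integral over `y`
in `pvIntegral_eq`. -/
theorem exists_norm_integral_phase_le {t : ℝ} (ht : t ≠ 0) :
    ∃ M, ∀ x R : ℝ, ‖∫ u in (-R)..R, phase x t u‖ ≤ M := by
  obtain ⟨M, hM⟩ := exists_norm_fresnelInt_le ht
  refine ⟨M + M, fun x R => ?_⟩
  have h : ‖Complex.exp (I * x ^ 2 / (2 * t))‖ = 1 := by
    have : (I * x ^ 2 / (2 * t)) = ((x ^ 2 / (2 * t) : ℝ) : ℂ) * I := by push_cast; ring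
    rw [this, Complex.norm_exp_ofReal_mul_I]
  rw [integral_phase_symm ht, norm_mul, h, one_mul]
  exact (norm_add_le _ _).trans (add_le_add (hM _) (hM _))

/-- `∫₀ʳ e^{-2its²} · 2cos(2ys) ds` as a symmetric integral. -/
theorem integral_phase_mul_cos (t y r : ℝ) :
    ∫ s in (0 : ℝ)..r, phase 0 t s * (2 * Complex.cos (2 * y * s)) = ∫ s in (-r)..r, phase y t s := by
  have hi : ∀ a b, IntervalIntegrable (phase y t) volume a b := fun a b =>
    (continuous_phase y t).intervalIntegrable a b
  rw [← intervalIntegral.integral_add_adjacent_intervals (hi (-r) 0) (hi 0 r)]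
  have h1 : ∫ s in (-r)..0, phase y t s = ∫ s in (0 : ℝ)..r, phase y t (-s) := by
    rw [intervalIntegral.integral_comp_neg, neg_zero]
  have hc : Continuous fun s => phase y t (-s) := (continuous_phase y t).comp continuous_neg
  rw [h1, ← intervalIntegral.integral_add (hc.intervalIntegrable _ _) (hi 0 r)]
  refine intervalIntegral.integral_congr fun s _ => ?_
  simp only [phase, Complex.two_cos, mul_add, ← Complex.exp_add]
  congr 2 <;> push_cast <;> ring

theorem integral_two_cos (y s : ℝ) (hs : s ≠ 0) :
    ∫ v in (0 : ℝ)..y, 2 * Complex.cos (2 * v * s) = Complex.sin (2 * y * s) / s := by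
  have hsc : (s : ℂ) ≠ 0 := by exact_mod_cast hs
  have h : ∀ v ∈ Set.uIcc 0 y, HasDerivAt (fun v : ℝ => Complex.sin (2 * v * s) / s)
      (2 * Complex.cos (2 * v * s)) v := by
    intro v _
    refine HasDerivAt.comp_ofReal (e := fun v : ℂ => Complex.sin (2 * v * s) / s) ?_
    refine (((((hasDerivAt_id (v : ℂ)).const_mul 2).mul_const (s : ℂ)).csin).div_const
      (s : ℂ)).congr_deriv ?_
    simp only [id]
    field_simp
  rw [intervalIntegral.integral_eq_sub_of_hasDerivAt h
    ((by fun_prop : Continuous fun v : ℝ => 2 * Complex.cos (2 * v * s)).intervalIntegrable _ _)]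
  simp

/-- The part of the principal value integral over `ε < |μ - l| < r`. -/
theorem integral_phase_sub (x t l : ℝ) {ε r : ℝ} (hε : 0 < ε) (hr : ε ≤ r) :
    ∫ s in ε..r, (phase x t (l + s) - phase x t (l - s)) / s =
      -2 * I * phase x t l * ((∫ y in (0 : ℝ)..(x + 2 * t * l), ∫ s in (-r)..r, phase y t s)
        - ∫ y in (0 : ℝ)..(x + 2 * t * l), ∫ s in (-ε)..ε, phase y t s) := by
  have hpos : ∀ s ∈ Set.uIcc ε r, s ≠ 0 := by
    intro s hs
    rw [Set.uIcc_of_le hr] at hs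
    exact (lt_of_lt_of_le hε hs.1).ne'
  have hc : Continuous (fun p : ℝ × ℝ => phase 0 t p.1 * (2 * Complex.cos (2 * p.2 * p.1))) := by
    unfold phase; fun_prop
  -- Put `y₀ = x + 2tl`. Moving from `l` to `l ± s` multiplies the phase by `phase 0 t s ·
  -- e^{∓2iy₀s}`, so the difference is a sine, and `sin(2y₀s)/s` is a cosine integral over `[0,
  -- y₀]`. This removes the singularity at `s = 0`.
  have h1 : ∫ s in ε..r, (phase x t (l + s) - phase x t (l - s)) / s =
      ∫ s in ε..r, (-2 * I * phase x t l) *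
        ∫ y in (0 : ℝ)..(x + 2 * t * l), phase 0 t s * (2 * Complex.cos (2 * y * s)) := by
    refine intervalIntegral.integral_congr fun s hs => ?_
    have hs0 := hpos s hs
    have hsc : (s : ℂ) ≠ 0 := by exact_mod_cast hs0
    rw [intervalIntegral.integral_const_mul, integral_two_cos _ _ hs0, ← mul_assoc, ← mul_div_assoc]
    congr 1
    have e1 : phase x t (l + s) = phase x t l * phase 0 t s *
        Complex.exp (-(2 * ((x + 2 * t * l : ℝ) : ℂ) * s) * I) := by
      simp only [phase, ← Complex.exp_add]; congr 1; push_cast; ring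
    have e2 : phase x t (l - s) = phase x t l * phase 0 t s *
        Complex.exp (2 * ((x + 2 * t * l : ℝ) : ℂ) * s * I) := by
      simp only [phase, ← Complex.exp_add]; congr 1; push_cast; ring
    rw [Complex.sin, e1, e2]
    linear_combination (phase x t l * phase 0 t s * (Complex.exp (-(2 * ((x + 2 * t * l : ℝ) : ℂ) * s) * I) -
      Complex.exp (2 * ((x + 2 * t * l : ℝ) : ℂ) * s * I))) * Complex.I_sq
  rw [h1, intervalIntegral.integral_const_mul]
  congr 1
  rw [intervalIntegral_intervalIntegral_swap
    (F := fun s y => phase 0 t s * (2 * Complex.cos (2 * y * s)))]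
  · have hq : ∀ ρ, Continuous (fun y : ℝ => ∫ s in (-ρ)..ρ, phase y t s) := by
      intro ρ
      exact intervalIntegral.continuous_parametric_intervalIntegral_of_continuous'
        (by unfold phase; fun_prop) _ _
    rw [← intervalIntegral.integral_sub ((hq r).intervalIntegrable _ _) ((hq ε).intervalIntegrable _ _)]
    refine intervalIntegral.integral_congr fun y _ => ?_
    rw [← integral_phase_mul_cos, ← integral_phase_mul_cos, intervalIntegral.integral_interval_sub_left]
    · exact (by unfold phase; fun_prop : Continuous fun s : ℝ =>
        phase 0 t s * (2 * Complex.cos (2 * y * s))).intervalIntegrable _ _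
    · exact (by unfold phase; fun_prop : Continuous fun s : ℝ =>
        phase 0 t s * (2 * Complex.cos (2 * y * s))).intervalIntegrable _ _
  · refine (hc.continuousOn.integrableOn_compact (isCompact_uIcc.prod isCompact_uIcc)).mono_set
      (Set.prod_mono Set.uIoc_subset_uIcc Set.uIoc_subset_uIcc)

theorem setOf_cutoff_eq {ε R l : ℝ} (hR : |l| + ε < R) (hε : 0 < ε) :
    {μ : ℝ | ε < |μ - l| ∧ |μ| < R} = Set.Ioo (-R) (l - ε) ∪ Set.Ioo (l + ε) R := by
  have h1 := abs_lt.1 (by linarith : |l| < R - ε)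
  ext μ
  simp only [Set.mem_ofPred_eq, Set.mem_union, Set.mem_Ioo, lt_abs, abs_lt]
  constructor
  · rintro ⟨h | h, h2, h3⟩
    · right; constructor <;> linarith
    · left; constructor <;> linarith
  · rintro (⟨h2, h3⟩ | ⟨h2, h3⟩)
    · exact ⟨Or.inr (by linarith), by linarith, by linarith⟩
    · exact ⟨Or.inl (by linarith), by linarith, by linarith⟩

theorem intervalIntegrable_div_ofReal {f : ℝ → ℂ} (hf : Continuous f) {a b : ℝ} (ha : 0 < a)
    (hb : 0 < b) : IntervalIntegrable (fun s : ℝ => f s / s) volume a b := by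
  refine ContinuousOn.intervalIntegrable (ContinuousOn.div hf.continuousOn (by fun_prop) ?_)
  intro s hs
  have : 0 < s := lt_of_lt_of_le (lt_min ha hb) hs.1
  exact_mod_cast this.ne'

/-- The window `|μ| < R` is not centred at `l`. Recentring it leaves two tails of length `|l|` near
distance `R`, where the integrand is of order `1/R`. -/
theorem integral_cutoff_eq (x t : ℝ) {ε R l : ℝ} (hR : |l| + ε < R) (hε : 0 < ε) :
    ∫ μ in {μ : ℝ | ε < |μ - l| ∧ |μ| < R}, phase x t μ / ((μ : ℂ) - (l : ℂ)) =
      (∫ s in ε..R, (phase x t (l + s) - phase x t (l - s)) / s) +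
        ((∫ s in R..(R - l), phase x t (l + s) / s) - ∫ s in R..(R + l), phase x t (l - s) / s) := by
  have h1 := abs_lt.1 (by linarith : |l| < R - ε)
  have c1 : Continuous fun s => phase x t (l + s) := (continuous_phase x t).comp (by fun_prop)
  have c2 : Continuous fun s => phase x t (l - s) := (continuous_phase x t).comp (by fun_prop)
  have hRpos : 0 < R := by linarith [abs_nonneg l]
  set F : ℝ → ℂ := fun μ => phase x t μ / ((μ : ℂ) - (l : ℂ)) with hF
  have hFc : ∀ s : Set ℝ, (∀ μ ∈ s, μ ≠ l) → ContinuousOn F s := by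
    intro s hs
    refine ContinuousOn.div (continuous_phase x t).continuousOn (by fun_prop) fun μ hμ => ?_
    rw [sub_ne_zero]; exact_mod_cast hs μ hμ
  have hI1 : IntegrableOn F (Set.Ioo (-R) (l - ε)) :=
    ((hFc (Set.Icc (-R) (l - ε)) fun μ hμ h => by linarith [hμ.2]).integrableOn_Icc).mono_set
      Set.Ioo_subset_Icc_self
  have hI2 : IntegrableOn F (Set.Ioo (l + ε) R) :=
    ((hFc (Set.Icc (l + ε) R) fun μ hμ h => by linarith [hμ.1]).integrableOn_Icc).mono_set
      Set.Ioo_subset_Icc_self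
  rw [setOf_cutoff_eq hR hε, setIntegral_union ?_ measurableSet_Ioo hI1 hI2,
    ← integral_Ioc_eq_integral_Ioo, ← integral_Ioc_eq_integral_Ioo,
    ← intervalIntegral.integral_of_le (by linarith), ← intervalIntegral.integral_of_le (by linarith)]
  · have e1 : ∫ μ in (-R)..(l - ε), F μ = -∫ s in ε..(R + l), phase x t (l - s) / s := by
      have := intervalIntegral.integral_comp_sub_left (f := F) (a := ε) (b := R + l) l
      rw [show l - (R + l) = -R by ring] at this
      rw [← this, ← intervalIntegral.integral_neg]
      refine intervalIntegral.integral_congr fun s _ => ?_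
      simp only [hF]
      push_cast
      rw [sub_sub_cancel_left, div_neg]
    have e2 : ∫ μ in (l + ε)..R, F μ = ∫ s in ε..(R - l), phase x t (l + s) / s := by
      have := intervalIntegral.integral_comp_add_left (f := F) (a := ε) (b := R - l) l
      rw [show l + (R - l) = R by ring] at this
      rw [← this]
      refine intervalIntegral.integral_congr fun s _ => ?_
      simp only [hF]
      push_cast
      rw [add_sub_cancel_left]
    rw [e1, e2, ← intervalIntegral.integral_add_adjacent_intervals
      (intervalIntegrable_div_ofReal c2 hε hRpos) (intervalIntegrable_div_ofReal c2 hRpos (by linarith)),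
      ← intervalIntegral.integral_add_adjacent_intervals
      (intervalIntegrable_div_ofReal c1 hε hRpos) (intervalIntegrable_div_ofReal c1 hRpos (by linarith))]
    simp_rw [sub_div]
    rw [intervalIntegral.integral_sub (intervalIntegrable_div_ofReal c1 hε hRpos)
      (intervalIntegrable_div_ofReal c2 hε hRpos)]
    ring
  · rw [Set.disjoint_left]
    intro μ hμ hμ'
    linarith [hμ.2, hμ'.1]

theorem tendsto_integral_div_tail {f : ℝ → ℂ} (hf : ∀ s, ‖f s‖ ≤ 1) (l : ℝ) :
    Tendsto (fun R : ℝ => ∫ s in R..(R + l), f s / s) atTop (𝓝 0) := by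
  have hlim : Tendsto (fun R : ℝ => (R - |l|)⁻¹ * |l|) atTop (𝓝 (0 * |l|)) :=
    (tendsto_inv_atTop_zero.comp (tendsto_atTop_add_const_right _ (-|l|) tendsto_id)).mul_const _
  rw [zero_mul] at hlim
  refine squeeze_zero_norm' ?_ hlim
  filter_upwards [eventually_gt_atTop |l|] with R hR
  have := intervalIntegral.norm_integral_le_of_norm_le_const (f := fun s : ℝ => f s / s)
    (a := R) (b := R + l) (C := (R - |l|)⁻¹) ?_
  · simpa using this
  · intro s hs
    have hs' : R - |l| < s := by
      have := hs.1
      rcases le_total 0 l with h | h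
      · rw [min_eq_left (by linarith)] at this; linarith [abs_nonneg l]
      · rw [min_eq_right (by linarith)] at this; rw [abs_of_nonpos h]; linarith
    have hpos : 0 < R - |l| := by linarith
    rw [norm_div, Complex.norm_real, Real.norm_eq_abs, abs_of_pos (hpos.trans hs')]
    rw [div_eq_mul_inv]
    calc ‖f s‖ * s⁻¹ ≤ 1 * (R - |l|)⁻¹ := by
          exact mul_le_mul (hf s) (inv_anti₀ hpos hs'.le) (inv_nonneg.2 (hpos.trans hs').le) zero_le_one
      _ = _ := one_mul _

/-- `J = -2i ∫₀^{x+2tl} G(t,y) dy`, which satisfies `P.V.∫ = e^{-2itl²-2ixl} J`. -/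
def funJ (x t l : ℝ) : ℂ :=
  -2 * I * (potG 0 t * ∫ y in (0 : ℝ)..(x + 2 * t * l), Complex.exp (I * y ^ 2 / (2 * t)))

/-- The centred part is `-2i · phase` times an integral over `y` of symmetric partial integrals of
`phase y t`. These converge boundedly to `G(t,y)`, the inner window contributes `O(ε)`, and the
off-centre tails vanish. -/
theorem pvIntegral_eq {t : ℝ} (ht : t ≠ 0) (x l : ℝ) :
    pvIntegral x t l = phase x t l * funJ x t l := by
  set y₀ := x + 2 * t * l with hy₀
  set Q : ℝ → ℝ → ℂ := fun r y => ∫ s in (-r)..r, phase y t s with hQ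
  obtain ⟨M, hM⟩ := exists_norm_integral_phase_le ht
  have hq : ∀ ρ, Continuous (Q ρ) := by
    intro ρ
    exact intervalIntegral.continuous_parametric_intervalIntegral_of_continuous'
      (by unfold phase; fun_prop) _ _
  have hlimR : Tendsto (fun R : ℝ => ∫ y in (0 : ℝ)..y₀, Q R y) atTop
      (𝓝 (∫ y in (0 : ℝ)..y₀, Complex.exp (I * y ^ 2 / (2 * t)) * potG 0 t)) := by
    refine intervalIntegral.tendsto_integral_filter_of_dominated_convergence (fun _ => M)
      (Eventually.of_forall fun R => (hq R).aestronglyMeasurable)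
      (Eventually.of_forall fun R => Eventually.of_forall fun y _ => hM y R)
      intervalIntegrable_const (Eventually.of_forall fun y _ => tendsto_integral_phase ht y)
  have hlimε : Tendsto (fun ε : ℝ => ∫ y in (0 : ℝ)..y₀, Q ε y) (𝓝[>] 0) (𝓝 0) := by
    have hb : Tendsto (fun ε : ℝ => |ε + ε| * |y₀ - 0|) (𝓝[>] 0) (𝓝 0) := by
      have : Continuous fun ε : ℝ => |ε + ε| * |y₀ - 0| := by fun_prop
      have := this.tendsto 0
      simp only [add_zero, abs_zero, zero_mul] at this
      exact this.mono_left nhdsWithin_le_nhds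
    refine squeeze_zero_norm (fun ε => ?_) hb
    refine intervalIntegral.norm_integral_le_of_norm_le_const fun y _ => ?_
    have := intervalIntegral.norm_integral_le_of_norm_le_const (f := phase y t) (a := -ε) (b := ε)
      (C := 1) (fun s _ => (norm_phase y t s).le)
    simpa using this
  have htail := (tendsto_integral_div_tail (f := fun s => phase x t (l + s))
    (fun s => (norm_phase _ _ _).le) (-l)).sub (tendsto_integral_div_tail
      (f := fun s => phase x t (l - s)) (fun s => (norm_phase _ _ _).le) l)
  rw [sub_zero] at htail
  have hmain : Tendsto (fun p : ℝ × ℝ => -2 * I * phase x t l *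
      ((∫ y in (0 : ℝ)..y₀, Q p.2 y) - ∫ y in (0 : ℝ)..y₀, Q p.1 y) +
      ((∫ s in p.2..(p.2 + -l), phase x t (l + s) / s) - ∫ s in p.2..(p.2 + l), phase x t (l - s) / s))
      (𝓝[>] (0 : ℝ) ×ˢ (atTop : Filter ℝ))
      (𝓝 (-2 * I * phase x t l *
        ((∫ y in (0 : ℝ)..y₀, Complex.exp (I * y ^ 2 / (2 * t)) * potG 0 t) - 0) + 0)) :=
    (((hlimR.comp tendsto_snd).sub (hlimε.comp tendsto_fst)).const_mul _).add
      (htail.comp tendsto_snd)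
  have hfin := hmain.congr' (f₂ := fun p : ℝ × ℝ =>
    ∫ μ in {μ : ℝ | p.1 < |μ - l| ∧ |μ| < p.2}, phase x t μ / ((μ : ℂ) - (l : ℂ))) ?_
  · rw [pvIntegral, hfin.limUnder_eq, funJ, intervalIntegral.integral_mul_const]
    ring
  · have h1 : ∀ᶠ ε : ℝ in 𝓝[>] (0 : ℝ), 0 < ε ∧ ε < 1 :=
      Ioo_mem_nhdsGT one_pos
    filter_upwards [h1.prod_mk (eventually_gt_atTop (|l| + 1))] with p hp
    obtain ⟨⟨hp1, hp2⟩, hp3⟩ := hp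
    rw [integral_cutoff_eq x t (by linarith) hp1,
      integral_phase_sub x t l hp1 (by linarith [abs_nonneg l])]
    rfl

end AnyonNLS

end

/-! ### Derivatives of `G` and `J`. -/

noncomputable section

namespace AnyonNLS

open Complex (I)

/-- The real-linear map `(dx, dt) ↦ dx • A + dt • B`. -/
def dxdt {V : Type*} [NormedAddCommGroup V] [NormedSpace ℝ V] (A B : V) : ℝ × ℝ →L[ℝ] V :=
  (ContinuousLinearMap.fst ℝ ℝ ℝ).smulRight A + (ContinuousLinearMap.snd ℝ ℝ ℝ).smulRight B

@[simp] theorem dxdt_apply {V : Type*} [NormedAddCommGroup V] [NormedSpace ℝ V] (A B : V)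
    (q : ℝ × ℝ) : dxdt A B q = q.1 • A + q.2 • B := rfl

/-- The sign of `t` is locally constant, so `potG 0 (t / |t|)` counts as a constant when
differentiating. -/
theorem eventually_abs_eq {t : ℝ} (ht : t ≠ 0) : ∀ᶠ s in 𝓝 t, s ≠ 0 ∧ s / |s| = t / |t| := by
  rcases lt_or_gt_of_ne ht with h | h
  · filter_upwards [eventually_lt_nhds h] with s hs
    exact ⟨hs.ne, by rw [abs_of_neg h, abs_of_neg hs, div_neg_self hs.ne, div_neg_self h.ne]⟩
  · filter_upwards [eventually_gt_nhds h] with s hs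
    exact ⟨hs.ne', by rw [abs_of_pos h, abs_of_pos hs, div_self hs.ne', div_self h.ne']⟩

/-- Substitution `u ↦ √|t| u`. The conditionally convergent integral becomes an explicit function of
`t` on each half line, so it is never differentiated under the integral sign. -/
theorem potG_zero_eq {t : ℝ} (ht : t ≠ 0) :
    potG 0 t = ((√|t|)⁻¹ : ℝ) * potG 0 (t / |t|) := by
  have habs : 0 < |t| := abs_pos.2 ht
  have hpos : 0 < √|t| := Real.sqrt_pos.2 habs
  have h1 : t / |t| ≠ 0 := div_ne_zero ht habs.ne'
  have h2 : Tendsto (fun R : ℝ => ∫ u in (-R)..R, phase 0 t u) atTop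
      (𝓝 (((√|t|)⁻¹ : ℝ) * potG 0 (t / |t|))) := by
    have h3 := ((tendsto_integral_phase h1 0).comp
      (tendsto_id.const_mul_atTop hpos)).const_mul (((√|t|)⁻¹ : ℝ) : ℂ)
    simp only [Complex.ofReal_zero, ne_eq, OfNat.ofNat_ne_zero, not_false_eq_true, zero_pow, mul_zero,
      zero_div, Complex.exp_zero, one_mul] at h3
    refine h3.congr fun R => ?_
    have h4 := intervalIntegral.integral_comp_mul_left (f := phase 0 (t / |t|)) (a := -R) (b := R)
      hpos.ne'
    simp only [Function.comp, id]
    rw [← mul_neg, ← Complex.real_smul, ← h4]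
    refine intervalIntegral.integral_congr fun u _ => ?_
    simp only [phase]
    congr 1
    push_cast
    have h5 : ((√|t| : ℝ) : ℂ) ^ 2 = ((|t| : ℝ) : ℂ) := by
      rw [← Complex.ofReal_pow, Real.sq_sqrt habs.le]
    have h6 : ((|t| : ℝ) : ℂ) ≠ 0 := by exact_mod_cast habs.ne'
    rw [mul_pow, h5]
    field_simp
    simp
  exact tendsto_nhds_unique (tendsto_integral_phase ht 0 |>.congr fun _ => rfl) h2 |> fun h => by
    simpa using h

theorem sqrt_abs_inv_hasDerivAt {t : ℝ} (ht : t ≠ 0) :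
    HasDerivAt (fun s : ℝ => (√|s|)⁻¹) (-(√|t|)⁻¹ / (2 * t)) t := by
  have habs : 0 < |t| := abs_pos.2 ht
  have hpos : 0 < √|t| := Real.sqrt_pos.2 habs
  refine (((hasDerivAt_abs ht).sqrt habs.ne').fun_inv hpos.ne').congr_deriv ?_
  rw [Real.sq_sqrt habs.le]
  have h : (SignType.sign t : ℝ) * t = |t| := sign_mul_self t
  field_simp
  linear_combination -h

theorem potG_zero_hasDerivAt {t : ℝ} (ht : t ≠ 0) :
    HasDerivAt (potG 0) (-potG 0 t / (2 * t)) t := by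
  have h := ((sqrt_abs_inv_hasDerivAt ht).ofReal_comp).mul_const (potG 0 (t / |t|))
  refine (h.congr_of_eventuallyEq ?_).congr_deriv ?_
  · filter_upwards [eventually_abs_eq ht] with s hs
    rw [potG_zero_eq hs.1, hs.2]
  · rw [potG_zero_eq ht]
    push_cast
    ring

theorem contDiffAt_potG_zero {t : ℝ} (ht : t ≠ 0) (n : ℕ∞) : ContDiffAt ℝ n (potG 0) t := by
  have habs : 0 < |t| := abs_pos.2 ht
  have h1 : ContDiffAt ℝ n (fun s : ℝ => (√|s|)⁻¹) t :=
    ((contDiffAt_abs ht).sqrt habs.ne').fun_inv (Real.sqrt_pos.2 habs).ne'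
  have h2 : ContDiffAt ℝ n (fun s : ℝ => (((√|s|)⁻¹ : ℝ) : ℂ) * potG 0 (t / |t|)) t :=
    (Complex.ofRealCLM.contDiff.contDiffAt.comp t h1).mul contDiffAt_const
  refine h2.congr_of_eventuallyEq ?_
  filter_upwards [eventually_abs_eq ht] with s hs
  rw [potG_zero_eq hs.1, hs.2]

theorem contDiffAt_potG {q : ℝ × ℝ} (ht : q.2 ≠ 0) (n : ℕ∞) :
    ContDiffAt ℝ n (fun q : ℝ × ℝ => potG q.1 q.2) q := by
  have h1 : ContDiffAt ℝ n (fun q : ℝ × ℝ => I * (q.1 : ℂ) ^ 2 / (2 * q.2)) q := by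
    have c1 : ContDiffAt ℝ n (fun q : ℝ × ℝ => (q.1 : ℂ)) q :=
      (Complex.ofRealCLM.contDiff.comp contDiff_fst).contDiffAt
    have c2 : ContDiffAt ℝ n (fun q : ℝ × ℝ => (q.2 : ℂ)) q :=
      (Complex.ofRealCLM.contDiff.comp contDiff_snd).contDiffAt
    simp only [div_eq_mul_inv]
    refine (contDiffAt_const.mul (c1.pow 2)).mul (ContDiffAt.fun_inv (contDiffAt_const.mul c2) ?_)
    simpa using ht
  have h2 : ContDiffAt ℝ n (fun q : ℝ × ℝ => Complex.exp (I * (q.1 : ℂ) ^ 2 / (2 * q.2)) * potG 0 q.2) q :=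
    h1.cexp.mul ((contDiffAt_potG_zero ht n).comp q contDiffAt_snd)
  refine h2.congr_of_eventuallyEq ?_
  filter_upwards [continuous_snd.continuousAt.eventually_ne ht] with p hp
  exact potG_eq hp p.1

theorem hasDerivAt_potG_x {t : ℝ} (ht : t ≠ 0) (x : ℝ) :
    HasDerivAt (fun s => potG s t) (I * x / t * potG x t) x := by
  have h1 : HasDerivAt (fun v : ℝ => (v : ℂ)) 1 x := Complex.ofRealCLM.hasDerivAt
  have h2 := ((((h1.fun_pow 2).const_mul I).div_const (2 * t : ℂ)).cexp).mul_const (potG 0 t)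
  rw [funext fun s => potG_eq ht s]
  refine h2.congr_deriv ?_
  rw [potG_eq ht x]
  push_cast
  field_simp

theorem hasDerivAt_potG_t {t : ℝ} (ht : t ≠ 0) (x : ℝ) :
    HasDerivAt (fun s => potG x s) ((-I * x ^ 2 / (2 * t ^ 2) - 1 / (2 * t)) * potG x t) t := by
  have htc : (t : ℂ) ≠ 0 := by exact_mod_cast ht
  have h1 : HasDerivAt (fun v : ℝ => (v : ℂ)) 1 t := Complex.ofRealCLM.hasDerivAt
  have h3 : HasDerivAt (fun v : ℝ => I * (x : ℂ) ^ 2 / (2 * v)) (-I * x ^ 2 / (2 * t ^ 2)) t := by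
    refine ((hasDerivAt_const t (I * (x : ℂ) ^ 2)).fun_div (h1.const_mul 2) (by simpa using ht)).congr_deriv ?_
    field_simp
    ring
  have h2 := h3.cexp.mul (potG_zero_hasDerivAt ht)
  refine (h2.congr_of_eventuallyEq ?_).congr_deriv ?_
  · filter_upwards [eventually_ne_nhds ht] with s hs
    exact potG_eq hs x
  · rw [potG_eq ht x]
    ring

/-- `e^{2itl² + 2ixl}`. -/
def phaseInv (x t l : ℝ) : ℂ := Complex.exp (2 * I * t * (l : ℂ) ^ 2 + 2 * I * x * l)

/-- The same scaling moves the local dependence on `t` into the upper limit, so both parameter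
derivatives of `J` follow from the fundamental theorem of calculus. -/
theorem funJ_eq {t : ℝ} (ht : t ≠ 0) (x l : ℝ) :
    funJ x t l = -2 * I * potG 0 (t / |t|) *
      ∫ w in (0 : ℝ)..((√|t|)⁻¹ * (x + 2 * t * l)), Complex.exp (I * (t / |t| : ℝ) * w ^ 2 / 2) := by
  have habs : 0 < |t| := abs_pos.2 ht
  have hpos : 0 < √|t| := Real.sqrt_pos.2 habs
  have hc : (((√|t|)⁻¹ : ℝ) : ℂ) ≠ 0 := by exact_mod_cast (inv_pos.2 hpos).ne'
  have h4 := intervalIntegral.integral_comp_mul_left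
    (f := fun w : ℝ => Complex.exp (I * (t / |t| : ℝ) * w ^ 2 / 2)) (a := 0) (b := x + 2 * t * l)
    (inv_pos.2 hpos).ne'
  rw [mul_zero, Complex.real_smul] at h4
  rw [funJ, potG_zero_eq ht]
  have h5 : ∫ y in (0 : ℝ)..(x + 2 * t * l), Complex.exp (I * y ^ 2 / (2 * t)) =
      ∫ y in (0 : ℝ)..(x + 2 * t * l),
        Complex.exp (I * (t / |t| : ℝ) * (((√|t|)⁻¹ * y : ℝ) : ℂ) ^ 2 / 2) := by
    refine intervalIntegral.integral_congr fun y _ => ?_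
    congr 1
    have h6 : (t / |t| : ℝ) * ((√|t|)⁻¹ * y) ^ 2 = y ^ 2 / t := by
      rw [mul_pow, inv_pow, Real.sq_sqrt habs.le]
      field_simp
      rw [sq_abs]
    have h7 : (((t / |t| : ℝ) : ℂ) * (((√|t|)⁻¹ * y : ℝ) : ℂ) ^ 2) = (y : ℂ) ^ 2 / t := by
      exact_mod_cast h6
    rw [mul_assoc, h7, mul_div_assoc, mul_div_assoc, div_div, mul_comm (t : ℂ)]
  rw [h5, h4]
  have hd : ((√|t| : ℝ) : ℂ) ≠ 0 := by exact_mod_cast hpos.ne'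
  have h8 : ∀ a g k : ℂ, a ≠ 0 → -2 * I * (a⁻¹ * g * (a * k)) = -2 * I * g * k := by
    intro a g k ha
    field_simp
  rw [Complex.ofReal_inv, inv_inv]
  exact h8 _ _ _ hd

theorem hasFDerivAt_funJ {q : ℝ × ℝ} (ht : q.2 ≠ 0) (l : ℝ) :
    HasFDerivAt (fun p : ℝ × ℝ => funJ p.1 p.2 l)
      (dxdt (-2 * I * potG q.1 q.2 * phaseInv q.1 q.2 l)
        (-2 * I * potG q.1 q.2 * phaseInv q.1 q.2 l * (l - q.1 / (2 * q.2)))) q := by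
  obtain ⟨x, t⟩ := q
  simp only at ht
  have htc : (t : ℂ) ≠ 0 := by exact_mod_cast ht
  have habs : 0 < |t| := abs_pos.2 ht
  have hpos : 0 < √|t| := Real.sqrt_pos.2 habs
  set Φ : ℝ → ℂ := fun u => ∫ w in (0 : ℝ)..u, Complex.exp (I * (t / |t| : ℝ) * w ^ 2 / 2) with hΦ
  set u₀ := (√|t|)⁻¹ * (x + 2 * t * l) with hu₀
  have hcont : Continuous fun w : ℝ => Complex.exp (I * (t / |t| : ℝ) * w ^ 2 / 2) := by fun_prop
  have hΦd : HasDerivAt Φ (Complex.exp (I * (t / |t| : ℝ) * u₀ ^ 2 / 2)) u₀ :=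
    intervalIntegral.integral_hasDerivAt_right (hcont.intervalIntegrable _ _)
      (hcont.stronglyMeasurableAtFilter _ _) hcont.continuousAt
  have hu : HasFDerivAt (fun p : ℝ × ℝ => (√|p.2|)⁻¹ * (p.1 + 2 * p.2 * l))
      (dxdt ((√|t|)⁻¹) ((√|t|)⁻¹ * (l - x / (2 * t)))) (x, t) := by
    have h1 : HasFDerivAt (fun p : ℝ × ℝ => (√|p.2|)⁻¹) _ (x, t) :=
      (sqrt_abs_inv_hasDerivAt ht).comp_hasFDerivAt (f := Prod.snd) (x, t) (hasFDerivAt_snd (𝕜 := ℝ) (p := (x, t)))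
    have h2 : HasFDerivAt (fun p : ℝ × ℝ => p.1 + 2 * p.2 * l) _ (x, t) :=
      (hasFDerivAt_fst (𝕜 := ℝ)).add (((hasFDerivAt_snd (𝕜 := ℝ)).const_mul 2).mul_const l)
    refine (h1.mul h2).congr_fderiv ?_
    ext
    · simp
    · simp
      field_simp
      ring
  have hmain : HasFDerivAt (fun p : ℝ × ℝ => -2 * I * potG 0 (t / |t|) *
      Φ ((√|p.2|)⁻¹ * (p.1 + 2 * p.2 * l))) _ (x, t) :=
    (hΦd.hasFDerivAt.comp (x, t) hu).const_mul (-2 * I * potG 0 (t / |t|))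
  refine (hmain.congr_of_eventuallyEq ?_).congr_fderiv ?_
  · have h := (continuous_snd (X := ℝ).tendsto (x, t)).eventually (eventually_abs_eq ht)
    filter_upwards [h] with p hp
    rw [funJ_eq hp.1, hp.2]
  · have h1 : Complex.exp (I * (t / |t| : ℝ) * u₀ ^ 2 / 2) =
        Complex.exp (I * x ^ 2 / (2 * t)) * phaseInv x t l := by
      rw [phaseInv, ← Complex.exp_add]
      congr 1
      have h6 : (t / |t| : ℝ) * u₀ ^ 2 = (x + 2 * t * l) ^ 2 / t := by
        rw [hu₀, mul_pow, inv_pow, Real.sq_sqrt habs.le]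
        field_simp
        rw [sq_abs]
      have h7 : (((t / |t| : ℝ) : ℂ) * (u₀ : ℂ) ^ 2) = ((x : ℂ) + 2 * t * l) ^ 2 / t := by
        exact_mod_cast h6
      rw [mul_assoc, h7]
      field_simp
      ring
    rw [h1]
    simp only [potG_eq ht x, potG_zero_eq ht]
    ext
    · simp
      ring
    · simp
      ring

theorem hasDerivAt_funJ_l (x t l : ℝ) :
    HasDerivAt (funJ x t) (-4 * I * t * potG 0 t *
      Complex.exp (I * (x + 2 * t * l : ℝ) ^ 2 / (2 * t))) l := by
  have hcont : Continuous fun y : ℝ => Complex.exp (I * y ^ 2 / (2 * t)) := by fun_prop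
  have h1 : HasDerivAt (fun u : ℝ => ∫ y in (0 : ℝ)..u, Complex.exp (I * y ^ 2 / (2 * t)))
      (Complex.exp (I * (x + 2 * t * l : ℝ) ^ 2 / (2 * t))) (x + 2 * t * l) :=
    intervalIntegral.integral_hasDerivAt_right (hcont.intervalIntegrable _ _)
      (hcont.stronglyMeasurableAtFilter _ _) hcont.continuousAt
  have h2 : HasDerivAt (fun l : ℝ => x + 2 * t * l) (2 * t) l := by
    simpa using ((hasDerivAt_id l).const_mul (2 * t)).const_add x
  refine (((h1.scomp l h2).const_mul (potG 0 t)).const_mul (-2 * I)).congr_deriv ?_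
  rw [Complex.real_smul]
  push_cast
  ring

theorem continuous_funJ (x t : ℝ) : Continuous (funJ x t) :=
  continuous_iff_continuousAt.2 fun l => (hasDerivAt_funJ_l x t l).continuousAt

theorem norm_exp_I_sq_div (y t : ℝ) : ‖Complex.exp (I * (y : ℂ) ^ 2 / (2 * t))‖ = 1 := by
  have : (I * (y : ℂ) ^ 2 / (2 * t)) = ((y ^ 2 / (2 * t) : ℝ) : ℂ) * I := by push_cast; ring
  rw [this, Complex.norm_exp_ofReal_mul_I]

theorem norm_funJ_le (x t l : ℝ) : ‖funJ x t l‖ ≤ 2 * ‖potG 0 t‖ * |x + 2 * t * l| := by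
  have h := intervalIntegral.norm_integral_le_of_norm_le_const
    (f := fun y : ℝ => Complex.exp (I * y ^ 2 / (2 * t))) (a := 0) (b := x + 2 * t * l) (C := 1)
    (fun y _ => (norm_exp_I_sq_div y t).le)
  rw [funJ, norm_mul, norm_mul, norm_mul, Complex.norm_I]
  simp only [norm_neg, Complex.norm_ofNat, mul_one, one_mul, sub_zero] at h ⊢
  rw [← mul_assoc]
  gcongr

end AnyonNLS

end

/-! ### Sup-norm smoothness of families of functions; multiplication and integral operators on `L²`.
-/

noncomputable section

namespace AnyonNLS

open Complex (I)
open BoundedContinuousFunction (evalCLM)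
open scoped BoundedContinuousFunction

section SupNorm

variable {E Z : Type*} [NormedAddCommGroup E] [NormedSpace ℝ E] [TopologicalSpace Z]

/-- Pointwise derivatives that are continuous in the sup norm are sup norm derivatives. -/
theorem hasFDerivAt_bcf {F : E → Z →ᵇ ℂ} {F' : E → E →L[ℝ] (Z →ᵇ ℂ)} {p : E}
    (h : ∀ᶠ q in 𝓝 p, ∀ z, HasFDerivAt (fun r => F r z) ((evalCLM ℝ z).comp (F' q)) q)
    (hc : ContinuousAt F' p) : HasFDerivAt F (F' p) p := by
  rw [hasFDerivAt_iff_isLittleO, Asymptotics.isLittleO_iff]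
  intro ε hε
  have h1 : ∀ᶠ q in 𝓝 p, ‖F' q - F' p‖ ≤ ε := by
    filter_upwards [hc.eventually (Metric.closedBall_mem_nhds (F' p) hε)] with q hq
    simpa [dist_eq_norm] using hq
  obtain ⟨δ, hδ, hball⟩ := Metric.eventually_nhds_iff_ball.1 (h.and h1)
  filter_upwards [Metric.ball_mem_nhds p hδ] with q hq
  rw [BoundedContinuousFunction.norm_le (by positivity)]
  intro z
  -- The mean value inequality at each fixed `z` has a constant that does not depend on `z`, so it
  -- passes to the supremum.
  refine Convex.norm_image_sub_le_of_norm_hasFDerivWithin_le' (𝕜 := ℝ) (f := fun r => F r z)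
    (f' := fun r => (evalCLM ℝ z).comp (F' r)) (φ := (evalCLM ℝ z).comp (F' p))
    (fun r hr => ((hball r hr).1 z).hasFDerivWithinAt) (fun r hr => ?_) (convex_ball p δ)
    (Metric.mem_ball_self hδ) hq
  rw [← ContinuousLinearMap.comp_sub]
  refine ContinuousLinearMap.opNorm_le_bound _ hε.le fun v => ?_
  refine ((F' r - F' p) v).norm_coe_le_norm z |>.trans ?_
  exact (ContinuousLinearMap.le_opNorm _ _).trans (by gcongr; exact (hball r hr).2)

/-- A locally bounded derivative gives a Lipschitz estimate uniform in `z`. It starts the bootstrap,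
before the derivative is known to be continuous. -/
theorem continuousAt_bcf {F : E → Z →ᵇ ℂ} {F' : E → E →L[ℝ] (Z →ᵇ ℂ)} {p : E}
    (h : ∀ᶠ q in 𝓝 p, ∀ z, HasFDerivAt (fun r => F r z) ((evalCLM ℝ z).comp (F' q)) q)
    (hb : F' =O[𝓝 p] (fun _ => (1 : ℝ))) : ContinuousAt F p := by
  obtain ⟨C, hC⟩ := hb.bound
  obtain ⟨δ, hδ, hball⟩ := Metric.eventually_nhds_iff_ball.1 (h.and hC)
  have hC0 : 0 ≤ C := by
    have := (hball p (Metric.mem_ball_self hδ)).2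
    simp only [norm_one, mul_one] at this
    exact (norm_nonneg _).trans this
  have hlim : Tendsto (fun q => C * ‖q - p‖) (𝓝 p) (𝓝 0) := by
    have : Continuous fun q => C * ‖q - p‖ := by fun_prop
    simpa using this.tendsto p
  refine tendsto_iff_norm_sub_tendsto_zero.2 (squeeze_zero' (Eventually.of_forall fun _ => norm_nonneg _)
    ?_ hlim)
  filter_upwards [Metric.ball_mem_nhds p hδ] with q hq
  rw [BoundedContinuousFunction.norm_le (by positivity)]
  intro z
  refine Convex.norm_image_sub_le_of_norm_hasFDerivWithin_le (𝕜 := ℝ) (f := fun r => F r z)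
    (f' := fun r => (evalCLM ℝ z).comp (F' r))
    (fun r hr => ((hball r hr).1 z).hasFDerivWithinAt) (fun r hr => ?_) (convex_ball p δ)
    (Metric.mem_ball_self hδ) hq
  refine ContinuousLinearMap.opNorm_le_bound _ hC0 fun v => ?_
  refine (F' r v).norm_coe_le_norm z |>.trans ?_
  refine (ContinuousLinearMap.le_opNorm _ _).trans ?_
  gcongr
  simpa using (hball r hr).2

/-- A family of bounded functions whose parameter derivatives are locally bounded and depend
smoothly on the family itself is smooth in the sup norm. -/
theorem contDiffOn_bcf_family {ι : Type*} {F : ι → E → Z →ᵇ ℂ} {F' : ι → E → E →L[ℝ] (Z →ᵇ ℂ)}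
    {O : Set E} (hO : IsOpen O)
    (hd : ∀ i, ∀ p ∈ O, ∀ z, HasFDerivAt (fun r => F i r z) ((evalCLM ℝ z).comp (F' i p)) p)
    (hb : ∀ i, ∀ p ∈ O, F' i =O[𝓝 p] (fun _ => (1 : ℝ)))
    (hs : ∀ n : ℕ, (∀ i, ContDiffOn ℝ n (F i) O) → ∀ i, ContDiffOn ℝ n (F' i) O) :
    (∀ (n : ℕ) i, ContDiffOn ℝ n (F i) O) ∧ ∀ i, ∀ p ∈ O, HasFDerivAt (F i) (F' i p) p := by
  have hd' : ∀ i, ∀ p ∈ O, ∀ᶠ q in 𝓝 p, ∀ z,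
      HasFDerivAt (fun r => F i r z) ((evalCLM ℝ z).comp (F' i q)) q := fun i p hp => by
    filter_upwards [hO.mem_nhds hp] with q hq using hd i q hq
  have h0 : ∀ i, ContDiffOn ℝ (0 : ℕ) (F i) O := fun i => by
    rw [Nat.cast_zero, contDiffOn_zero]
    exact fun p hp => (continuousAt_bcf (hd' i p hp) (hb i p hp)).continuousWithinAt
  have hder : ∀ i, ∀ p ∈ O, HasFDerivAt (F i) (F' i p) p := fun i p hp =>
    hasFDerivAt_bcf (hd' i p hp) ((hs 0 h0 i).continuousOn.continuousAt (hO.mem_nhds hp))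
  refine ⟨fun n => ?_, hder⟩
  -- The index `i` stays universally quantified: the derivative of one member involves other
  -- members, so the whole family gains one order of smoothness at a time.
  induction n with
  | zero => exact h0
  | succ n ih =>
    intro i
    rw [Nat.cast_succ, contDiffOn_succ_iff_fderiv_of_isOpen hO]
    refine ⟨fun p hp => (hder i p hp).differentiableAt.differentiableWithinAt, by simp, ?_⟩
    exact (hs n ih i).congr fun p hp => (hder i p hp).fderiv

end SupNorm

theorem norm_dxdt_le {V : Type*} [NormedAddCommGroup V] [NormedSpace ℝ V] (A B : V) :
    ‖dxdt A B‖ ≤ ‖A‖ + ‖B‖ := by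
  refine ContinuousLinearMap.opNorm_le_bound _ (by positivity) fun q => ?_
  rw [dxdt_apply, add_mul]
  refine (norm_add_le _ _).trans (add_le_add ?_ ?_)
  · rw [norm_smul, mul_comm]; gcongr; exact norm_fst_le q
  · rw [norm_smul, mul_comm]; gcongr; exact norm_snd_le q

theorem contDiffOn_dxdt {E V : Type*} [NormedAddCommGroup E] [NormedSpace ℝ E]
    [NormedAddCommGroup V] [NormedSpace ℝ V] {n : WithTop ℕ∞} {A B : E → V} {O : Set E}
    (hA : ContDiffOn ℝ n A O) (hB : ContDiffOn ℝ n B O) :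
    ContDiffOn ℝ n (fun q => dxdt (A q) (B q)) O :=
  ((ContinuousLinearMap.smulRightL ℝ (ℝ × ℝ) V
    (ContinuousLinearMap.fst ℝ ℝ ℝ)).contDiff.comp_contDiffOn hA).add
  ((ContinuousLinearMap.smulRightL ℝ (ℝ × ℝ) V
    (ContinuousLinearMap.snd ℝ ℝ ℝ)).contDiff.comp_contDiffOn hB)

theorem isBigO_one_dxdt {E V : Type*} [NormedAddCommGroup V] [NormedSpace ℝ V] {l : Filter E}
    {A B : E → V} (hA : A =O[l] (fun _ => (1 : ℝ))) (hB : B =O[l] (fun _ => (1 : ℝ))) :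
    (fun q => dxdt (A q) (B q)) =O[l] (fun _ => (1 : ℝ)) := by
  refine (Asymptotics.IsBigO.of_bound 1 (Eventually.of_forall fun q => ?_)).trans
    (hA.norm_left.add hB.norm_left)
  rw [one_mul, Real.norm_of_nonneg (by positivity)]
  exact norm_dxdt_le _ _

/-- `L²(ℝ)`. -/
abbrev Ltwo := Lp ℂ 2 (volume : Measure ℝ)

/-- The bilinear pairing `∫ u v`. -/
def pairing : Ltwo →L[ℂ] Ltwo →L[ℂ] ℂ :=
  (ContinuousLinearMap.mul ℂ ℂ).lpPairing volume 2 2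

theorem pairing_apply (u v : Ltwo) : pairing u v = ∫ l, u l * v l := by
  rw [pairing, ContinuousLinearMap.lpPairing_eq_integral]; rfl

theorem pairing_comm (u v : Ltwo) : pairing u v = pairing v u := by
  simp only [pairing_apply, mul_comm]

theorem integrable_mul_Ltwo {f g : ℝ → ℂ} (hf : MemLp f 2) (hg : MemLp g 2) :
    Integrable (fun l => f l * g l) :=
  MemLp.integrable_mul hf hg

theorem pairing_toLp {f g : ℝ → ℂ} (hf : MemLp f 2) (hg : MemLp g 2) :
    pairing (hf.toLp f) (hg.toLp g) = ∫ l, f l * g l := by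
  rw [pairing_apply]
  refine integral_congr_ae ?_
  filter_upwards [hf.coeFn_toLp, hg.coeFn_toLp] with l h1 h2
  rw [h1, h2]

theorem memLp_bcf_mul (h : ℝ →ᵇ ℂ) {f : ℝ → ℂ} (hf : MemLp f 2) :
    MemLp (fun l => h l * f l) 2 :=
  MemLp.of_le_mul (c := ‖h‖) hf (h.continuous.aestronglyMeasurable.mul hf.1)
    (Eventually.of_forall fun l => by
      rw [norm_mul]; gcongr; exact h.norm_coe_le_norm l)

/-- Multiplication by a bounded continuous function. -/
def mulOp : (ℝ →ᵇ ℂ) →L[ℂ] Ltwo →L[ℂ] Ltwo :=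
  LinearMap.mkContinuous₂
    (LinearMap.mk₂ ℂ (fun h f => (memLp_bcf_mul h (Lp.memLp f)).toLp _)
      (fun h₁ h₂ f => by
        rw [← MemLp.toLp_add]
        refine (MemLp.toLp_eq_toLp_iff _ _).2 (Eventually.of_forall fun l => ?_)
        simp [add_mul])
      (fun c h f => by
        rw [← MemLp.toLp_const_smul]
        refine (MemLp.toLp_eq_toLp_iff _ _).2 (Eventually.of_forall fun l => ?_)
        simp [mul_assoc])
      (fun h f₁ f₂ => by
        rw [← MemLp.toLp_add]
        refine (MemLp.toLp_eq_toLp_iff _ _).2 ?_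
        filter_upwards [Lp.coeFn_add f₁ f₂] with l hl
        simp only [Pi.add_apply]
        rw [hl, Pi.add_apply, mul_add])
      (fun c h f => by
        rw [← MemLp.toLp_const_smul]
        refine (MemLp.toLp_eq_toLp_iff _ _).2 ?_
        filter_upwards [Lp.coeFn_smul c f] with l hl
        simp [hl, mul_left_comm])) 1
    (fun h f => by
      rw [one_mul]
      refine Lp.norm_le_mul_norm_of_ae_le_mul ?_
      filter_upwards [(memLp_bcf_mul h (Lp.memLp f)).coeFn_toLp] with l hl
      simp only [LinearMap.mk₂_apply, hl, norm_mul]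
      gcongr
      exact h.norm_coe_le_norm l)

theorem coeFn_mulOp (h : ℝ →ᵇ ℂ) (f : Ltwo) : mulOp h f =ᵐ[volume] fun l => h l * f l :=
  (memLp_bcf_mul h (Lp.memLp f)).coeFn_toLp

theorem mulOp_toLp (h : ℝ →ᵇ ℂ) {f : ℝ → ℂ} (hf : MemLp f 2) :
    mulOp h (hf.toLp f) = (memLp_bcf_mul h hf).toLp _ := by
  refine Lp.ext ?_
  filter_upwards [coeFn_mulOp h (hf.toLp f), hf.coeFn_toLp, (memLp_bcf_mul h hf).coeFn_toLp]
    with l h1 h2 h3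
  rw [h1, h2, h3]

theorem mulOp_mulOp (h₁ h₂ : ℝ →ᵇ ℂ) (f : Ltwo) : mulOp h₁ (mulOp h₂ f) = mulOp (h₁ * h₂) f := by
  refine Lp.ext ?_
  filter_upwards [coeFn_mulOp h₁ (mulOp h₂ f), coeFn_mulOp h₂ f, coeFn_mulOp (h₁ * h₂) f]
    with l a1 a2 a3
  rw [a1, a2, a3]
  simp [mul_assoc]

theorem mulOp_comm (h₁ h₂ : ℝ →ᵇ ℂ) (f : Ltwo) :
    mulOp h₁ (mulOp h₂ f) = mulOp h₂ (mulOp h₁ f) := by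
  rw [mulOp_mulOp, mulOp_mulOp, mul_comm]

theorem pairing_mulOp (h : ℝ →ᵇ ℂ) (u v : Ltwo) : pairing (mulOp h u) v = pairing u (mulOp h v) := by
  rw [pairing_apply, pairing_apply]
  refine integral_congr_ae ?_
  filter_upwards [coeFn_mulOp h u, coeFn_mulOp h v] with l a1 a2
  rw [a1, a2]; ring

/-- The Gaussian `e^{-l²/8}`. -/
def gaussWt (l : ℝ) : ℂ := (Real.exp (-(l ^ 2) / 8) : ℝ)

theorem continuous_gaussWt : Continuous gaussWt := by unfold gaussWt; fun_prop

theorem norm_gaussWt (l : ℝ) : ((‖gaussWt l‖ : ℝ) : ℂ) = gaussWt l := by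
  rw [gaussWt, Complex.norm_real, Real.norm_eq_abs, abs_of_pos (Real.exp_pos _)]

theorem memLp_gaussWt : MemLp gaussWt 2 := by
  rw [memLp_two_iff_integrable_sq_norm continuous_gaussWt.aestronglyMeasurable]
  have h := integrable_exp_neg_mul_sq (b := 1 / 4) (by norm_num)
  refine h.congr (Eventually.of_forall fun l => ?_)
  simp only [gaussWt, Complex.norm_real, Real.norm_eq_abs, abs_of_pos (Real.exp_pos _)]
  rw [← Real.exp_nat_mul]
  congr 1; push_cast; ring

/-- The Gaussian as an element of `L²`. -/
def gaussVec : Ltwo := memLp_gaussWt.toLp _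

/-- `h ↦ e^{-l²/8} h` as a map from bounded functions to `L²`. -/
def vec : (ℝ →ᵇ ℂ) →L[ℂ] Ltwo := mulOp.flip gaussVec

theorem vec_eq (h : ℝ →ᵇ ℂ) : vec h = (memLp_bcf_mul h memLp_gaussWt).toLp _ :=
  mulOp_toLp h memLp_gaussWt

theorem mulOp_vec (h₁ h₂ : ℝ →ᵇ ℂ) : mulOp h₁ (vec h₂) = vec (h₁ * h₂) := mulOp_mulOp _ _ _

/-- The plane without its diagonal. -/
abbrev OffDiag := {p : ℝ × ℝ // p.1 ≠ p.2}

/-- Extension by zero to the diagonal. -/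
def extendZero (h : OffDiag →ᵇ ℂ) (p : ℝ × ℝ) : ℂ := Function.extend Subtype.val h 0 p

theorem extendZero_of_ne (h : OffDiag →ᵇ ℂ) {p : ℝ × ℝ} (hp : p.1 ≠ p.2) :
    extendZero h p = h ⟨p, hp⟩ :=
  Subtype.val_injective.extend_apply h 0 ⟨p, hp⟩

theorem extendZero_of_eq (h : OffDiag →ᵇ ℂ) {p : ℝ × ℝ} (hp : p.1 = p.2) : extendZero h p = 0 := by
  rw [extendZero, Function.extend_apply' _ _ _ (by rintro ⟨a, rfl⟩; exact a.2 hp)]; rfl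

theorem extendZero_smul (c : ℂ) (h : OffDiag →ᵇ ℂ) (p : ℝ × ℝ) :
    extendZero (c • h) p = c * extendZero h p := by
  by_cases hp : p.1 = p.2
  · simp [extendZero_of_eq _ hp]
  · simp [extendZero_of_ne _ hp]

theorem measurable_extendZero (h : OffDiag →ᵇ ℂ) : Measurable (extendZero h) := by
  refine (MeasurableEmbedding.subtype_coe ?_).measurable_extend h.continuous.measurable
    measurable_const
  exact (isOpen_ne_fun continuous_fst continuous_snd).measurableSet

theorem norm_extendZero_le (h : OffDiag →ᵇ ℂ) (p : ℝ × ℝ) : ‖extendZero h p‖ ≤ ‖h‖ := by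
  by_cases hp : p.1 = p.2
  · rw [extendZero_of_eq h hp, norm_zero]; exact norm_nonneg _
  · rw [extendZero_of_ne h hp]; exact h.norm_coe_le_norm _

theorem integrable_gaussWt_mul {f : ℝ → ℂ} (hf : MemLp f 2) :
    Integrable (fun l => gaussWt l * f l) :=
  integrable_mul_Ltwo memLp_gaussWt hf

theorem integrable_extendZero_mul (h : OffDiag →ᵇ ℂ) (l : ℝ) {u : ℝ → ℂ} (hu : Integrable u) :
    Integrable (fun m => extendZero h (l, m) * u m) :=
  hu.bdd_mul ((measurable_extendZero h).comp (by fun_prop)).aestronglyMeasurable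
    (Eventually.of_forall fun _ => norm_extendZero_le h _)

/-- Cauchy–Schwarz for the Gaussian against `|f|`, with the operator norm of the pairing as the
constant. -/
theorem integral_norm_gaussWt_mul_le (f : Ltwo) :
    ∫ l, ‖gaussWt l * f l‖ ≤ ‖pairing gaussVec‖ * ‖f‖ := by
  have h1 : MemLp (fun l => ((‖f l‖ : ℝ) : ℂ)) 2 := (Lp.memLp f).norm.ofReal
  have h2 : ‖h1.toLp _‖ ≤ 1 * ‖f‖ := by
    refine Lp.norm_le_mul_norm_of_ae_le_mul ?_
    filter_upwards [h1.coeFn_toLp] with l hl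
    rw [hl]; simp
  have h3 := (pairing gaussVec).le_opNorm (h1.toLp _)
  rw [gaussVec, pairing_toLp, ← gaussVec] at h3
  have h4 : ∫ l, gaussWt l * ((‖f l‖ : ℝ) : ℂ) = ((∫ l, ‖gaussWt l * f l‖ : ℝ) : ℂ) := by
    rw [← integral_complex_ofReal]
    refine integral_congr_ae (Eventually.of_forall fun l => ?_)
    beta_reduce
    rw [norm_mul, Complex.ofReal_mul, norm_gaussWt]
  rw [h4, Complex.norm_real, Real.norm_of_nonneg (integral_nonneg fun _ => norm_nonneg _)] at h3
  refine h3.trans ?_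
  gcongr
  simpa using h2

/-- The function `l ↦ e^{-l²/8} ∫ h(l,m) e^{-m²/8} f(m) dm`. -/
def kernFun (h : OffDiag →ᵇ ℂ) (f : ℝ → ℂ) (l : ℝ) : ℂ :=
  (∫ m, extendZero h (l, m) * (gaussWt m * f m)) * gaussWt l

theorem norm_kernFun_le (h : OffDiag →ᵇ ℂ) {f : ℝ → ℂ} (hf : MemLp f 2) (l : ℝ) :
    ‖kernFun h f l‖ ≤ (‖h‖ * ∫ m, ‖gaussWt m * f m‖) * ‖gaussWt l‖ := by
  rw [kernFun, norm_mul]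
  gcongr
  refine (norm_integral_le_integral_norm _).trans ?_
  rw [← integral_const_mul]
  refine integral_mono (integrable_extendZero_mul h l (integrable_gaussWt_mul hf)).norm
    ((integrable_gaussWt_mul hf).norm.const_mul _) fun m => ?_
  simp only [norm_mul _ (_ * _)]
  rw [norm_mul]
  gcongr
  exact norm_extendZero_le h _

theorem memLp_kernFun (h : OffDiag →ᵇ ℂ) {f : ℝ → ℂ} (hf : MemLp f 2) :
    MemLp (kernFun h f) 2 := by
  refine MemLp.of_le_mul (c := ‖h‖ * ∫ m, ‖gaussWt m * f m‖) memLp_gaussWt ?_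
    (Eventually.of_forall fun l => norm_kernFun_le h hf l)
  refine AEStronglyMeasurable.mul ?_ continuous_gaussWt.aestronglyMeasurable
  have h1 : AEStronglyMeasurable (fun p : ℝ × ℝ => extendZero h p * (gaussWt p.2 * f p.2))
      (volume.prod volume) :=
    (measurable_extendZero h).aestronglyMeasurable.mul
      ((integrable_gaussWt_mul hf).1.comp_snd)
  exact h1.integral_prod_right'

theorem kernFun_congr (h : OffDiag →ᵇ ℂ) {f g : ℝ → ℂ} (hfg : f =ᵐ[volume] g) :
    kernFun h f = kernFun h g := by
  funext l
  rw [kernFun, kernFun]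
  congr 1
  refine integral_congr_ae ?_
  filter_upwards [hfg] with m hm
  rw [hm]

theorem kernFun_add_left (h₁ h₂ : OffDiag →ᵇ ℂ) {f : ℝ → ℂ} (hf : MemLp f 2) :
    kernFun (h₁ + h₂) f = kernFun h₁ f + kernFun h₂ f := by
  funext l
  simp only [kernFun, Pi.add_apply]
  rw [← add_mul, ← integral_add (integrable_extendZero_mul h₁ l (integrable_gaussWt_mul hf))
    (integrable_extendZero_mul h₂ l (integrable_gaussWt_mul hf))]
  congr 2
  funext m
  rw [← add_mul]
  congr 1
  by_cases hp : l = m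
  · simp [extendZero_of_eq _ (p := (l, m)) hp]
  · simp [extendZero_of_ne _ (p := (l, m)) hp]

theorem kernFun_add_right (h : OffDiag →ᵇ ℂ) {f g : ℝ → ℂ} (hf : MemLp f 2) (hg : MemLp g 2) :
    kernFun h (f + g) = kernFun h f + kernFun h g := by
  funext l
  simp only [kernFun, Pi.add_apply]
  rw [← add_mul, ← integral_add (integrable_extendZero_mul h l (integrable_gaussWt_mul hf))
    (integrable_extendZero_mul h l (integrable_gaussWt_mul hg))]
  congr 2
  funext m
  ring

theorem kernFun_smul_left (c : ℂ) (h : OffDiag →ᵇ ℂ) (f : ℝ → ℂ) :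
    kernFun (c • h) f = c • kernFun h f := by
  funext l
  simp only [kernFun, Pi.smul_apply, smul_eq_mul]
  rw [← mul_assoc, ← integral_const_mul]
  congr 2
  funext m
  rw [extendZero_smul, mul_assoc]

theorem kernFun_smul_right (c : ℂ) (h : OffDiag →ᵇ ℂ) (f : ℝ → ℂ) :
    kernFun h (c • f) = c • kernFun h f := by
  funext l
  simp only [kernFun, Pi.smul_apply, smul_eq_mul]
  rw [← mul_assoc, ← integral_const_mul]
  congr 2
  funext m
  ring

/-- The integral operator with kernel `e^{-l²/8} h(l,m) e^{-m²/8}`. -/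
def kernOp : (OffDiag →ᵇ ℂ) →L[ℂ] Ltwo →L[ℂ] Ltwo :=
  LinearMap.mkContinuous₂
    (LinearMap.mk₂ ℂ (fun h f => (memLp_kernFun h (Lp.memLp f)).toLp _)
      (fun h₁ h₂ f => by
        rw [← MemLp.toLp_add]
        simp only [kernFun_add_left h₁ h₂ (Lp.memLp f)])
      (fun c h f => by
        rw [← MemLp.toLp_const_smul]
        simp only [kernFun_smul_left])
      (fun h f₁ f₂ => by
        rw [← MemLp.toLp_add]
        simp only [kernFun_congr h (Lp.coeFn_add f₁ f₂),
          kernFun_add_right h (Lp.memLp f₁) (Lp.memLp f₂)])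
      (fun c h f => by
        rw [← MemLp.toLp_const_smul]
        simp only [kernFun_congr h (Lp.coeFn_smul c f), kernFun_smul_right]))
    (‖pairing gaussVec‖ * ‖gaussVec‖)
    (fun h f => by
      have h1 : ‖(memLp_kernFun h (Lp.memLp f)).toLp _‖ ≤
          (‖h‖ * ∫ m, ‖gaussWt m * f m‖) * ‖gaussVec‖ := by
        refine Lp.norm_le_mul_norm_of_ae_le_mul ?_
        filter_upwards [(memLp_kernFun h (Lp.memLp f)).coeFn_toLp, memLp_gaussWt.coeFn_toLp]
          with l a1 a2
        rw [a1, gaussVec, a2]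
        exact norm_kernFun_le h (Lp.memLp f) l
      refine h1.trans ?_
      have h2 := integral_norm_gaussWt_mul_le f
      calc (‖h‖ * ∫ m, ‖gaussWt m * f m‖) * ‖gaussVec‖
          ≤ (‖h‖ * (‖pairing gaussVec‖ * ‖f‖)) * ‖gaussVec‖ := by gcongr
        _ = _ := by ring)

theorem coeFn_kernOp (h : OffDiag →ᵇ ℂ) (f : Ltwo) : kernOp h f =ᵐ[volume] kernFun h f :=
  (memLp_kernFun h (Lp.memLp f)).coeFn_toLp

/-- Fubini; the Gaussian factors make the double integral absolutely convergent for a bounded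
kernel. -/
theorem pairing_kernOp {h : OffDiag →ᵇ ℂ}
    (hsymm : ∀ l m, extendZero h (l, m) = extendZero h (m, l)) (u v : Ltwo) :
    pairing (kernOp h u) v = pairing u (kernOp h v) := by
  rw [pairing_apply, pairing_apply]
  have hu := integrable_gaussWt_mul (Lp.memLp u)
  have hv := integrable_gaussWt_mul (Lp.memLp v)
  have h1 : ∫ l, kernOp h u l * v l =
      ∫ l, ∫ m, extendZero h (l, m) * ((gaussWt m * u m) * (gaussWt l * v l)) := by
    refine integral_congr_ae ?_
    filter_upwards [coeFn_kernOp h u] with l hl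
    rw [hl, kernFun, mul_assoc, ← integral_mul_const]
    simp only [mul_assoc]
  have h2 : ∫ l, u l * kernOp h v l =
      ∫ m, ∫ l, extendZero h (l, m) * ((gaussWt m * u m) * (gaussWt l * v l)) := by
    refine integral_congr_ae ?_
    filter_upwards [coeFn_kernOp h v] with l hl
    rw [hl, kernFun, mul_comm, mul_assoc, ← integral_mul_const]
    congr 1
    funext m
    rw [hsymm]
    ring
  rw [h1, h2, integral_integral_swap]
  refine Integrable.bdd_mul (c := ‖h‖) ?_ (measurable_extendZero h).aestronglyMeasurable
    (Eventually.of_forall fun _ => norm_extendZero_le h _)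
  have := hv.mul_prod hu
  exact this.congr (Eventually.of_forall fun p => mul_comm _ _)

/-- The rank one operator `f ↦ (∫ v f) u`. -/
def outer (u v : Ltwo) : Ltwo →L[ℂ] Ltwo := (pairing v).smulRight u

theorem outer_apply (u v f : Ltwo) : outer u v f = pairing v f • u := rfl

/-- The bounded function `h₁(l) h₂(m)`. -/
def tensor (h₁ h₂ : ℝ →ᵇ ℂ) : OffDiag →ᵇ ℂ :=
  h₁.compContinuous ⟨fun p => p.1.1, by fun_prop⟩ * h₂.compContinuous ⟨fun p => p.1.2, by fun_prop⟩

theorem tensor_apply (h₁ h₂ : ℝ →ᵇ ℂ) (p : OffDiag) : tensor h₁ h₂ p = h₁ p.1.1 * h₂ p.1.2 := rfl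

theorem norm_tensor_le (h₁ h₂ : ℝ →ᵇ ℂ) : ‖tensor h₁ h₂‖ ≤ ‖h₁‖ * ‖h₂‖ := by
  rw [BoundedContinuousFunction.norm_le (by positivity)]
  intro p
  rw [tensor_apply, norm_mul]
  gcongr <;> exact BoundedContinuousFunction.norm_coe_le_norm _ _

theorem isBoundedBilinearMap_tensor :
    IsBoundedBilinearMap ℝ (fun p : (ℝ →ᵇ ℂ) × (ℝ →ᵇ ℂ) => tensor p.1 p.2) where
  add_left a b c := by ext p; simp [tensor_apply, add_mul]
  smul_left a b c := by ext p; simp [tensor_apply, mul_assoc]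
  add_right a b c := by ext p; simp [tensor_apply, mul_add]
  smul_right a b c := by ext p; simp [tensor_apply, mul_left_comm]
  bound := ⟨1, one_pos, fun a b => by rw [one_mul]; exact norm_tensor_le a b⟩

/-- A product kernel has rank one; its zero values on the diagonal are harmless because each point
`m = l` is null. -/
theorem kernOp_tensor (h₁ h₂ : ℝ →ᵇ ℂ) : kernOp (tensor h₁ h₂) = outer (vec h₁) (vec h₂) := by
  ext1 f
  refine Lp.ext ?_
  rw [outer_apply, vec_eq, vec_eq]
  filter_upwards [coeFn_kernOp (tensor h₁ h₂) f, Lp.coeFn_smul (pairing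
    ((memLp_bcf_mul h₂ memLp_gaussWt).toLp _) f) ((memLp_bcf_mul h₁ memLp_gaussWt).toLp _),
    (memLp_bcf_mul h₁ memLp_gaussWt).coeFn_toLp] with l a1 a2 a3
  rw [a1, a2, Pi.smul_apply, a3, kernFun, smul_eq_mul, ← mul_assoc]
  congr 1
  rw [pairing_apply, mul_comm, ← integral_const_mul]
  refine integral_congr_ae ?_
  have hne : ∀ᵐ m : ℝ, m ≠ l := by simp [ae_iff, measure_singleton]
  filter_upwards [hne, (memLp_bcf_mul h₂ memLp_gaussWt).coeFn_toLp] with m hm b1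
  rw [extendZero_of_ne _ (p := (l, m)) hm.symm, tensor_apply, b1]
  ring

end AnyonNLS

end

/-! ### Smooth dependence of `e±` on `(x, t)`. -/

noncomputable section

namespace AnyonNLS

open Complex (I)
open BoundedContinuousFunction (evalCLM)
open scoped BoundedContinuousFunction

/-- Combine `|l|ᵏ ≤ k! e^{|l|}` with `|l| - l²/8 ≤ 2`, which is `(|l| - 4)² ≥ 0`. -/
theorem pow_mul_exp_neg_sq_le (k : ℕ) (l : ℝ) :
    |l| ^ k * Real.exp (-(l ^ 2) / 8) ≤ k.factorial * Real.exp 2 := by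
  have h1 : |l| ^ k ≤ k.factorial * Real.exp |l| := by
    have := Real.pow_div_factorial_le_exp |l| (abs_nonneg l) k
    rwa [div_le_iff₀' (by positivity)] at this
  calc |l| ^ k * Real.exp (-(l ^ 2) / 8)
      ≤ (k.factorial * Real.exp |l|) * Real.exp (-(l ^ 2) / 8) := by gcongr
    _ = k.factorial * Real.exp (|l| + -(l ^ 2) / 8) := by rw [Real.exp_add]; ring
    _ ≤ k.factorial * Real.exp 2 := by
        gcongr
        rw [← sq_abs]
        nlinarith [sq_nonneg (|l| - 4)]

/-- `e₊ / √ϑ` (for `true`) and `e₋ / √ϑ` (for `false`). -/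
def bareE (κ : ℝ) (a : Bool) (x t l : ℝ) : ℂ :=
  if a then (1 / Real.pi : ℝ) * Complex.exp (-(I * t * (l : ℂ) ^ 2 + I * l * x)) *
    ((Real.cos (Real.pi * κ / 2) : ℝ) * funJ x t l + (Real.pi * Real.sin (Real.pi * κ / 2) : ℝ))
  else (Real.cos (Real.pi * κ / 2) / Real.pi : ℝ) * Complex.exp (I * t * (l : ℂ) ^ 2 + I * l * x)

theorem eMinus_eq (κ x t β l : ℝ) :
    eMinus κ x t β l = (Real.sqrt (fermi β l) : ℝ) * bareE κ false x t l := by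
  simp only [eMinus, bareE, Bool.false_eq_true, if_false]
  push_cast
  ring

/-- With `τ = tl² + xl`, both summands of `E` carry `e^{-2iτ}`, which turns the `e^{iτ}` of `e₋`
into `e^{-iτ}`. -/
theorem ePlus_eq {t : ℝ} (ht : t ≠ 0) (κ x β l : ℝ) :
    ePlus κ x t β l = (Real.sqrt (fermi β l) : ℝ) * bareE κ true x t l := by
  have h : Complex.exp (-(I * t * (l : ℂ) ^ 2 + I * l * x)) =
      Complex.exp (I * t * (l : ℂ) ^ 2 + I * l * x) * phase x t l := by
    rw [phase, ← Complex.exp_add]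
    congr 1
    ring
  simp only [ePlus, bareE, if_true, pvIntegral_eq ht, h]
  push_cast
  ring

theorem norm_exp_I_tau (t l x : ℝ) : ‖Complex.exp (I * t * (l : ℂ) ^ 2 + I * l * x)‖ = 1 := by
  have : (I * t * (l : ℂ) ^ 2 + I * l * x) = ((t * l ^ 2 + l * x : ℝ) : ℂ) * I := by push_cast; ring
  rw [this, Complex.norm_exp_ofReal_mul_I]

theorem norm_exp_neg_I_tau (t l x : ℝ) :
    ‖Complex.exp (-(I * t * (l : ℂ) ^ 2 + I * l * x))‖ = 1 := by
  rw [Complex.exp_neg, norm_inv, norm_exp_I_tau, inv_one]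

/-- The constant in the bound `|e± / √ϑ| ≤ C (1 + |l|)`. -/
def bareBound (x t : ℝ) : ℝ := 2 * ‖potG 0 t‖ * (|x| + 2 * |t|) + 1

theorem bareBound_pos (x t : ℝ) : 0 < bareBound x t := by unfold bareBound; positivity

theorem norm_cos_div_pi_le (κ : ℝ) : |Real.cos (Real.pi * κ / 2) / Real.pi| ≤ 1 := by
  rw [abs_div, abs_of_pos Real.pi_pos, div_le_one Real.pi_pos]
  linarith [Real.abs_cos_le_one (Real.pi * κ / 2), Real.pi_gt_three]

/-- All exponentials have modulus one and `J` grows at most linearly in `l`, so a Gaussian weight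
absorbs `e± / √ϑ` times any power of `l`. -/
theorem norm_bareE_le (κ : ℝ) (a : Bool) (x t l : ℝ) :
    ‖bareE κ a x t l‖ ≤ bareBound x t * (1 + |l|) := by
  cases a
  · simp only [bareE, Bool.false_eq_true, if_false]
    rw [norm_mul, norm_exp_I_tau, mul_one, Complex.norm_real, Real.norm_eq_abs]
    refine (norm_cos_div_pi_le κ).trans ?_
    rw [← one_mul (1 : ℝ)]
    refine mul_le_mul ?_ ?_ zero_le_one (bareBound_pos x t).le
    · unfold bareBound; linarith [(by positivity : 0 ≤ 2 * ‖potG 0 t‖ * (|x| + 2 * |t|))]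
    · linarith [abs_nonneg l]
  · simp only [bareE, if_true]
    rw [norm_mul, norm_mul, norm_exp_neg_I_tau, mul_one, Complex.norm_real, Real.norm_eq_abs,
      abs_of_pos (by positivity)]
    have hJ := norm_funJ_le x t l
    have h1 : |x + 2 * t * l| ≤ (|x| + 2 * |t|) * (1 + |l|) := by
      calc |x + 2 * t * l| ≤ |x| + |2 * t * l| := abs_add_le _ _
        _ = |x| + 2 * |t| * |l| := by rw [abs_mul, abs_mul, abs_two]
        _ ≤ _ := by nlinarith [abs_nonneg x, abs_nonneg t, abs_nonneg l, mul_nonneg (abs_nonneg x) (abs_nonneg l)]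
    have h2 : ‖((Real.cos (Real.pi * κ / 2) : ℝ) : ℂ) * funJ x t l +
        ((Real.pi * Real.sin (Real.pi * κ / 2) : ℝ) : ℂ)‖ ≤ ‖funJ x t l‖ + Real.pi := by
      refine (norm_add_le _ _).trans (add_le_add ?_ ?_)
      · rw [norm_mul, Complex.norm_real, Real.norm_eq_abs]
        exact mul_le_of_le_one_left (norm_nonneg _) (Real.abs_cos_le_one _)
      · rw [Complex.norm_real, Real.norm_eq_abs, abs_mul, abs_of_pos Real.pi_pos]
        exact mul_le_of_le_one_right Real.pi_pos.le (Real.abs_sin_le_one _)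
    have hpi : 1 / Real.pi ≤ 1 := by
      rw [div_le_one Real.pi_pos]; linarith [Real.pi_gt_three]
    calc 1 / Real.pi * ‖((Real.cos (Real.pi * κ / 2) : ℝ) : ℂ) * funJ x t l +
        ((Real.pi * Real.sin (Real.pi * κ / 2) : ℝ) : ℂ)‖
        ≤ 1 / Real.pi * (‖funJ x t l‖ + Real.pi) := by gcongr
      _ = 1 / Real.pi * ‖funJ x t l‖ + 1 := by field_simp
      _ ≤ 1 * ‖funJ x t l‖ + 1 := by gcongr
      _ ≤ 2 * ‖potG 0 t‖ * ((|x| + 2 * |t|) * (1 + |l|)) + 1 * (1 + |l|) := by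
          rw [one_mul, one_mul]
          refine add_le_add (hJ.trans (by gcongr)) (by linarith [abs_nonneg l])
      _ = _ := by unfold bareBound; ring

theorem continuous_bareE (κ : ℝ) (a : Bool) (x t : ℝ) : Continuous (bareE κ a x t) := by
  have := continuous_funJ x t
  cases a
  · change Continuous fun l => bareE κ false x t l
    simp only [bareE, Bool.false_eq_true, if_false]; fun_prop
  · change Continuous fun l => bareE κ true x t l
    simp only [bareE, if_true]; fun_prop

theorem norm_pow_gaussWt_le (k : ℕ) (l : ℝ) :
    ‖(l : ℂ) ^ k * gaussWt l‖ ≤ k.factorial * Real.exp 2 := by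
  rw [norm_mul, norm_pow, Complex.norm_real, gaussWt, Complex.norm_real, Real.norm_eq_abs,
    Real.norm_eq_abs, abs_of_pos (Real.exp_pos _)]
  exact pow_mul_exp_neg_sq_le k l

theorem norm_pow_gaussWt_bareE_le (κ : ℝ) (a : Bool) (k : ℕ) (x t l : ℝ) :
    ‖(l : ℂ) ^ k * gaussWt l * bareE κ a x t l‖ ≤
      bareBound x t * ((k.factorial + (k + 1).factorial) * Real.exp 2) := by
  rw [norm_mul]
  have h0 := norm_pow_gaussWt_le k l
  have h1 := norm_pow_gaussWt_le (k + 1) l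
  have h2 : ‖(l : ℂ) ^ (k + 1) * gaussWt l‖ = ‖(l : ℂ) ^ k * gaussWt l‖ * |l| := by
    rw [pow_succ, norm_mul, norm_mul, norm_mul, Complex.norm_real, Real.norm_eq_abs]; ring
  calc ‖(l : ℂ) ^ k * gaussWt l‖ * ‖bareE κ a x t l‖
      ≤ ‖(l : ℂ) ^ k * gaussWt l‖ * (bareBound x t * (1 + |l|)) := by
        gcongr; exact norm_bareE_le κ a x t l
    _ = bareBound x t * (‖(l : ℂ) ^ k * gaussWt l‖ + ‖(l : ℂ) ^ (k + 1) * gaussWt l‖) := by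
        rw [h2]; ring
    _ ≤ bareBound x t * (k.factorial * Real.exp 2 + (k + 1).factorial * Real.exp 2) := by
        have := (bareBound_pos x t).le
        gcongr
    _ = _ := by ring

/-- The bounded function `l ↦ lᵏ e^{-l²/8} e± / √ϑ`. -/
def wE (κ : ℝ) (i : Bool × ℕ) (q : ℝ × ℝ) : ℝ →ᵇ ℂ :=
  BoundedContinuousFunction.ofNormedAddCommGroup
    (fun l : ℝ => (l : ℂ) ^ i.2 * gaussWt l * bareE κ i.1 q.1 q.2 l)
    (by have h1 := continuous_gaussWt; have h2 := continuous_bareE κ i.1 q.1 q.2; fun_prop) _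
    (norm_pow_gaussWt_bareE_le κ i.1 i.2 q.1 q.2)

theorem wE_apply (κ : ℝ) (a : Bool) (k : ℕ) (q : ℝ × ℝ) (l : ℝ) :
    wE κ (a, k) q l = (l : ℂ) ^ k * gaussWt l * bareE κ a q.1 q.2 l := rfl

theorem norm_wE_le (κ : ℝ) (i : Bool × ℕ) (q : ℝ × ℝ) :
    ‖wE κ i q‖ ≤ bareBound q.1 q.2 * ((i.2.factorial + (i.2 + 1).factorial) * Real.exp 2) := by
  refine (BoundedContinuousFunction.norm_le ?_).2 (norm_pow_gaussWt_bareE_le κ i.1 i.2 q.1 q.2)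
  have := (bareBound_pos q.1 q.2).le
  positivity

theorem isBigO_wE (κ : ℝ) (i : Bool × ℕ) {q : ℝ × ℝ} (hq : q.2 ≠ 0) :
    wE κ i =O[𝓝 q] (fun _ => (1 : ℝ)) := by
  have h1 : ContinuousAt (fun q : ℝ × ℝ => bareBound q.1 q.2 *
      ((i.2.factorial + (i.2 + 1).factorial) * Real.exp 2)) q := by
    have h2 : ContinuousAt (fun p : ℝ × ℝ => potG 0 p.2) q :=
      (potG_zero_hasDerivAt hq).continuousAt.comp (f := Prod.snd) continuousAt_snd
    unfold bareBound
    fun_prop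
  exact (Asymptotics.isBigO_of_le (𝓝 q) fun p =>
    (norm_wE_le κ i p).trans (Real.le_norm_self _)).trans (h1.isBigO_one ℝ)

theorem hasFDerivAt_exp_tau (l : ℝ) (q : ℝ × ℝ) :
    HasFDerivAt (fun p : ℝ × ℝ => Complex.exp (I * p.2 * (l : ℂ) ^ 2 + I * l * p.1))
      (dxdt (I * l * Complex.exp (I * q.2 * (l : ℂ) ^ 2 + I * l * q.1))
        (I * l ^ 2 * Complex.exp (I * q.2 * (l : ℂ) ^ 2 + I * l * q.1))) q := by
  have c1 : HasFDerivAt (fun p : ℝ × ℝ => (p.1 : ℂ)) _ q :=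
    Complex.ofRealCLM.hasFDerivAt.comp q (hasFDerivAt_fst (𝕜 := ℝ) (p := q))
  have c2 : HasFDerivAt (fun p : ℝ × ℝ => (p.2 : ℂ)) _ q :=
    Complex.ofRealCLM.hasFDerivAt.comp q (hasFDerivAt_snd (𝕜 := ℝ) (p := q))
  refine (((c2.const_mul I).mul_const ((l : ℂ) ^ 2)).add (c1.const_mul (I * l))).cexp.congr_fderiv ?_
  ext
  · simp; ring
  · simp; ring

theorem hasFDerivAt_bareE_false (κ l : ℝ) (q : ℝ × ℝ) :
    HasFDerivAt (fun p : ℝ × ℝ => bareE κ false p.1 p.2 l)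
      (dxdt (I * l * bareE κ false q.1 q.2 l) (I * l ^ 2 * bareE κ false q.1 q.2 l)) q := by
  simp only [bareE, Bool.false_eq_true, if_false]
  refine ((hasFDerivAt_exp_tau l q).const_mul _).congr_fderiv ?_
  ext
  · simp; ring
  · simp; ring

/-- Differentiating `J` produces `G e^{2iτ}`, `τ = tl² + xl`, which converts the prefactor `e^{-iτ}`
into that of `e₋`. The pair `e±` thus satisfies a closed linear system in `(x, t)`. -/
theorem hasFDerivAt_bareE_true (κ l : ℝ) {q : ℝ × ℝ} (hq : q.2 ≠ 0) :
    HasFDerivAt (fun p : ℝ × ℝ => bareE κ true p.1 p.2 l)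
      (dxdt (-I * l * bareE κ true q.1 q.2 l - 2 * I * potG q.1 q.2 * bareE κ false q.1 q.2 l)
        (-I * l ^ 2 * bareE κ true q.1 q.2 l -
          2 * I * potG q.1 q.2 * (l - q.1 / (2 * q.2)) * bareE κ false q.1 q.2 l)) q := by
  have h1 := hasFDerivAt_exp_tau l (-q)
  have h2 : HasFDerivAt (fun p : ℝ × ℝ => Complex.exp (-(I * p.2 * (l : ℂ) ^ 2 + I * l * p.1)))
      (dxdt (-I * l * Complex.exp (-(I * q.2 * (l : ℂ) ^ 2 + I * l * q.1)))
        (-I * l ^ 2 * Complex.exp (-(I * q.2 * (l : ℂ) ^ 2 + I * l * q.1)))) q := by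
    have h3 := h1.comp q (hasFDerivAt_id q).neg
    refine (h3.congr_of_eventuallyEq (Eventually.of_forall fun p => ?_)).congr_fderiv ?_
    · simp only [Function.comp]
      congr 1
      simp
      ring
    · have e : (I * ((-q).2 : ℝ) * (l : ℂ) ^ 2 + I * l * ((-q).1 : ℝ)) =
        -(I * q.2 * (l : ℂ) ^ 2 + I * l * q.1) := by simp; ring
      rw [e]
      ext
      · simp
      · simp
  have hexp : Complex.exp (-(I * q.2 * (l : ℂ) ^ 2 + I * l * q.1)) * phaseInv q.1 q.2 l =
      Complex.exp (I * q.2 * (l : ℂ) ^ 2 + I * l * q.1) := by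
    rw [phaseInv, ← Complex.exp_add]; congr 1; ring
  simp only [bareE, if_true, Bool.false_eq_true, if_false]
  refine ((h2.const_mul _).mul (((hasFDerivAt_funJ hq l).const_mul _).add_const _)).congr_fderiv ?_
  rw [← hexp]
  ext
  · simp
    ring
  · simp
    ring

/-- The derivative of `wE` in `(x, t)`. -/
def wE' (κ : ℝ) (i : Bool × ℕ) (q : ℝ × ℝ) : ℝ × ℝ →L[ℝ] (ℝ →ᵇ ℂ) :=
  if i.1 then
    dxdt (-I • wE κ (true, i.2 + 1) q - (2 * I * potG q.1 q.2) • wE κ (false, i.2) q)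
      (-I • wE κ (true, i.2 + 2) q - (2 * I * potG q.1 q.2) • wE κ (false, i.2 + 1) q
        + (I * (q.1 / q.2 : ℝ) * potG q.1 q.2) • wE κ (false, i.2) q)
  else dxdt (I • wE κ (false, i.2 + 1) q) (I • wE κ (false, i.2 + 2) q)

theorem hasFDerivAt_wE_apply (κ : ℝ) (i : Bool × ℕ) {q : ℝ × ℝ} (hq : q.2 ≠ 0) (l : ℝ) :
    HasFDerivAt (fun p => wE κ i p l) ((evalCLM ℝ l).comp (wE' κ i q)) q := by
  obtain ⟨a, k⟩ := i
  have hqc : (q.2 : ℂ) ≠ 0 := by exact_mod_cast hq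
  cases a
  · simp only [wE_apply]
    refine ((hasFDerivAt_bareE_false κ l q).const_mul ((l : ℂ) ^ k * gaussWt l)).congr_fderiv ?_
    ext
    · simp [wE', wE_apply]
      ring
    · simp [wE', wE_apply]
      ring
  · simp only [wE_apply]
    refine ((hasFDerivAt_bareE_true κ l hq).const_mul ((l : ℂ) ^ k * gaussWt l)).congr_fderiv ?_
    ext
    · simp [wE', wE_apply]
      ring
    · simp [wE', wE_apply]
      field_simp
      ring

theorem isOpen_snd_ne_zero : IsOpen {q : ℝ × ℝ | q.2 ≠ 0} :=
  isOpen_ne_fun continuous_snd continuous_const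

theorem contDiffOn_potG (n : ℕ) :
    ContDiffOn ℝ n (fun q : ℝ × ℝ => potG q.1 q.2) {q | q.2 ≠ 0} := fun _ hq =>
  (contDiffAt_potG hq (n : ℕ∞)).contDiffWithinAt

theorem contDiffOn_div_potG (n : ℕ) :
    ContDiffOn ℝ n (fun q : ℝ × ℝ => I * (q.1 / q.2 : ℝ) * potG q.1 q.2) {q | q.2 ≠ 0} := by
  refine (contDiffOn_const.mul ?_).mul (contDiffOn_potG n)
  exact Complex.ofRealCLM.contDiff.comp_contDiffOn
    (contDiffOn_fst.div contDiffOn_snd fun _ h => h)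

theorem isBigO_one_of_contDiffOn {f : ℝ × ℝ → ℂ} (hf : ∀ n : ℕ, ContDiffOn ℝ n f {q | q.2 ≠ 0})
    {q : ℝ × ℝ} (hq : q.2 ≠ 0) : f =O[𝓝 q] (fun _ => (1 : ℝ)) :=
  ((hf 0).continuousOn.continuousAt (isOpen_snd_ne_zero.mem_nhds hq)).isBigO_one _

theorem isBigO_one_smul {V : Type*} [NormedAddCommGroup V] [NormedSpace ℂ V] {f : ℝ × ℝ → ℂ}
    {A : ℝ × ℝ → V} {l : Filter (ℝ × ℝ)} (hf : f =O[l] (fun _ => (1 : ℝ)))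
    (hA : A =O[l] (fun _ => (1 : ℝ))) : (fun q => f q • A q) =O[l] (fun _ => (1 : ℝ)) := by
  simpa using hf.smul hA

theorem isBigO_wE' (κ : ℝ) (i : Bool × ℕ) {q : ℝ × ℝ} (hq : q.2 ≠ 0) :
    wE' κ i =O[𝓝 q] (fun _ => (1 : ℝ)) := by
  obtain ⟨a, k⟩ := i
  have hG : (fun q : ℝ × ℝ => 2 * I * potG q.1 q.2) =O[𝓝 q] (fun _ => (1 : ℝ)) :=
    isBigO_one_of_contDiffOn (fun n => contDiffOn_const.mul (contDiffOn_potG n)) hq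
  have hG' := isBigO_one_of_contDiffOn contDiffOn_div_potG hq
  have hw : ∀ b j, wE κ (b, j) =O[𝓝 q] (fun _ => (1 : ℝ)) := fun b j => isBigO_wE κ (b, j) hq
  have hc : ∀ (c : ℂ) b j, (fun q => c • wE κ (b, j) q) =O[𝓝 q] (fun _ => (1 : ℝ)) := fun c b j =>
    isBigO_one_smul (Asymptotics.isBigO_const_const c one_ne_zero _) (hw b j)
  have hg : ∀ b j, (fun q : ℝ × ℝ => (2 * I * potG q.1 q.2) • wE κ (b, j) q) =O[𝓝 q]
    (fun _ => (1 : ℝ)) := fun b j => isBigO_one_smul hG (hw b j)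
  have hg' : ∀ b j, (fun q : ℝ × ℝ => (I * (q.1 / q.2 : ℝ) * potG q.1 q.2) • wE κ (b, j) q) =O[𝓝 q]
    (fun _ => (1 : ℝ)) := fun b j => isBigO_one_smul hG' (hw b j)
  cases a
  · exact isBigO_one_dxdt (hc I false (k + 1)) (hc I false (k + 2))
  · exact isBigO_one_dxdt ((hc (-I) true (k + 1)).sub (hg false k))
      (((hc (-I) true (k + 2)).sub (hg false (k + 1))).add (hg' false k))

/-- Differentiation raises the power of `l` by at most two, with coefficients smooth for `t ≠ 0`;
hence the induction runs over all powers at once. -/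
theorem contDiffOn_wE' (κ : ℝ) {n : ℕ} (ih : ∀ i, ContDiffOn ℝ n (wE κ i) {q | q.2 ≠ 0})
    (i : Bool × ℕ) : ContDiffOn ℝ n (wE' κ i) {q | q.2 ≠ 0} := by
  obtain ⟨a, k⟩ := i
  have hG : ContDiffOn ℝ n (fun q : ℝ × ℝ => 2 * I * potG q.1 q.2) {q | q.2 ≠ 0} :=
    contDiffOn_const.mul (contDiffOn_potG n)
  have hc : ∀ (c : ℂ) b j, ContDiffOn ℝ n (fun q => c • wE κ (b, j) q) {q | q.2 ≠ 0} := fun c b j =>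
    (contDiffOn_const (c := c)).smul (ih (b, j))
  have hg : ∀ b j, ContDiffOn ℝ n (fun q : ℝ × ℝ => (2 * I * potG q.1 q.2) • wE κ (b, j) q)
    {q | q.2 ≠ 0} := fun b j => hG.smul (ih (b, j))
  have hg' : ∀ b j, ContDiffOn ℝ n
    (fun q : ℝ × ℝ => (I * (q.1 / q.2 : ℝ) * potG q.1 q.2) • wE κ (b, j) q) {q | q.2 ≠ 0} :=
    fun b j => (contDiffOn_div_potG n).smul (ih (b, j))
  cases a
  · exact contDiffOn_dxdt (hc I false (k + 1)) (hc I false (k + 2))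
  · exact contDiffOn_dxdt ((hc (-I) true (k + 1)).sub (hg false k))
      (((hc (-I) true (k + 2)).sub (hg false (k + 1))).add (hg' false k))

theorem contDiffOn_wE (κ : ℝ) (n : ℕ) (i : Bool × ℕ) :
    ContDiffOn ℝ n (wE κ i) {q | q.2 ≠ 0} :=
  (contDiffOn_bcf_family isOpen_snd_ne_zero (fun i _ hq l => hasFDerivAt_wE_apply κ i hq l)
    (fun i _ hq => isBigO_wE' κ i hq) (fun _ ih => contDiffOn_wE' κ ih)).1 n i

theorem hasFDerivAt_wE (κ : ℝ) (i : Bool × ℕ) {q : ℝ × ℝ} (hq : q.2 ≠ 0) :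
    HasFDerivAt (wE κ i) (wE' κ i q) q :=
  (contDiffOn_bcf_family isOpen_snd_ne_zero (fun i _ hq l => hasFDerivAt_wE_apply κ i hq l)
    (fun i _ hq => isBigO_wE' κ i hq) (fun _ ih => contDiffOn_wE' κ ih)).2 i q hq

end AnyonNLS

end

/-! ### The divided difference kernel and its derivative in `(x, t)`. -/

noncomputable section

namespace AnyonNLS

open Complex (I)
open BoundedContinuousFunction (evalCLM)
open scoped BoundedContinuousFunction

theorem hasDerivAt_gaussWt (l : ℝ) : HasDerivAt gaussWt (-(l : ℂ) / 4 * gaussWt l) l := by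
  have h : HasDerivAt (fun l : ℝ => -(l ^ 2) / 8) (-l / 4) l := by
    refine (((hasDerivAt_id l).pow 2).neg.div_const 8).congr_deriv ?_
    simp
    ring
  refine (h.exp.ofReal_comp).congr_deriv ?_
  rw [gaussWt]
  push_cast
  ring

theorem hasDerivAt_exp_tau (t l x : ℝ) :
    HasDerivAt (fun l : ℝ => I * t * (l : ℂ) ^ 2 + I * l * x) (I * (2 * t * l + x)) l := by
  have h1 : HasDerivAt (fun v : ℝ => (v : ℂ)) 1 l := Complex.ofRealCLM.hasDerivAt
  refine (((h1.fun_pow 2).const_mul (I * t)).add ((h1.const_mul I).mul_const (x : ℂ))).congr_deriv ?_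
  push_cast
  ring

/-- Differentiating the exponential gives the linear factor `2tl + x`; the constant bounds the
contribution of `J'`, whose modulus does not depend on `l`. -/
theorem exists_hasDerivAt_bareE (κ : ℝ) (a : Bool) (x t : ℝ) :
    ∃ C, 0 ≤ C ∧ ∀ l, ∃ d, HasDerivAt (bareE κ a x t) d l ∧
      ‖d‖ ≤ ‖(2 * t * l + x) * bareE κ a x t l‖ + C := by
  cases a
  · refine ⟨0, le_rfl, fun l => ⟨I * (2 * t * l + x) * bareE κ false x t l, ?_, ?_⟩⟩
    · change HasDerivAt (fun l => bareE κ false x t l) _ l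
      simp only [bareE, Bool.false_eq_true, if_false]
      exact ((hasDerivAt_exp_tau t l x).cexp.const_mul _).congr_deriv (by ring)
    · rw [mul_assoc, norm_mul, Complex.norm_I, one_mul, add_zero]
  · refine ⟨‖4 * t * potG 0 t‖, norm_nonneg _, fun l => ?_⟩
    have h1 : HasDerivAt (bareE κ true x t)
      ((1 / Real.pi : ℝ) * (Complex.exp (-(I * t * (l : ℂ) ^ 2 + I * l * x)) * -(I * (2 * t * l + x))) *
        ((Real.cos (Real.pi * κ / 2) : ℝ) * funJ x t l + (Real.pi * Real.sin (Real.pi * κ / 2) : ℝ)) +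
        (1 / Real.pi : ℝ) * Complex.exp (-(I * t * (l : ℂ) ^ 2 + I * l * x)) *
          ((Real.cos (Real.pi * κ / 2) : ℝ) * (-4 * I * t * potG 0 t *
            Complex.exp (I * (x + 2 * t * l : ℝ) ^ 2 / (2 * t))))) l := by
      change HasDerivAt (fun l => bareE κ true x t l) _ l
      simp only [bareE, if_true]
      exact ((hasDerivAt_exp_tau t l x).neg.cexp.const_mul _).mul
        (((hasDerivAt_funJ_l x t l).const_mul _).add_const _)
    refine ⟨_, h1, (norm_add_le _ _).trans (add_le_add (le_of_eq ?_) ?_)⟩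
    · have e : (1 / Real.pi : ℝ) * (Complex.exp (-(I * t * (l : ℂ) ^ 2 + I * l * x)) *
          -(I * (2 * t * l + x))) * ((Real.cos (Real.pi * κ / 2) : ℝ) * funJ x t l +
          (Real.pi * Real.sin (Real.pi * κ / 2) : ℝ)) =
          -(I * ((2 * t * l + x) * bareE κ true x t l)) := by
        simp only [bareE, if_true]
        ring
      rw [e, norm_neg, norm_mul, Complex.norm_I, one_mul]
    · have hb : 1 / Real.pi ≤ 1 := by
        rw [div_le_one Real.pi_pos]; linarith [Real.pi_gt_three]
      have e : ‖-4 * I * t * potG 0 t * Complex.exp (I * (x + 2 * t * l : ℝ) ^ 2 / (2 * t))‖ =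
          ‖4 * t * potG 0 t‖ := by
        rw [norm_mul, norm_exp_I_sq_div, mul_one]
        simp
      rw [norm_mul, norm_mul, norm_exp_neg_I_tau, norm_mul, e, mul_one, Complex.norm_real,
        Complex.norm_real, Real.norm_eq_abs, Real.norm_eq_abs, abs_of_pos (by positivity)]
      calc 1 / Real.pi * (|Real.cos (Real.pi * κ / 2)| * ‖4 * t * potG 0 t‖)
          ≤ 1 * (1 * ‖4 * t * potG 0 t‖) := by
            gcongr
            exact Real.abs_cos_le_one _
        _ = _ := by ring

/-- The Gaussian absorbs the linear growth of the derivative. The Lipschitz bound is what keeps the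
divided difference bounded near the diagonal. -/
theorem exists_lipschitz_wE (κ : ℝ) (a : Bool) (q : ℝ × ℝ) :
    ∃ C, ∀ l m, ‖wE κ (a, 0) q l - wE κ (a, 0) q m‖ ≤ C * |l - m| := by
  obtain ⟨C, hC0, hC⟩ := exists_hasDerivAt_bareE κ a q.1 q.2
  choose d hd hn using hC
  set B₀ := ‖wE κ (a, 0) q‖
  set B₁ := ‖wE κ (a, 1) q‖
  -- `B₁/4` comes from differentiating `e^{-l²/8}`, the middle group from the factor `2tl + x`, and
  -- the last term from the constant `C` with the Gaussian bounded by `e²`.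
  refine ⟨B₁ / 4 + ((2 * |q.2| * B₁ + |q.1| * B₀) + 1 * Real.exp 2 * C), fun l m => ?_⟩
  have hder : ∀ l : ℝ, HasDerivAt (fun l : ℝ => wE κ (a, 0) q l)
      (-(l : ℂ) / 4 * gaussWt l * bareE κ a q.1 q.2 l + gaussWt l * d l) l := by
    intro l
    refine ((hasDerivAt_gaussWt l).mul (hd l)).congr_of_eventuallyEq
      (Eventually.of_forall fun l => ?_)
    simp [wE_apply]
  refine Convex.norm_image_sub_le_of_norm_hasDerivWithin_le (s := Set.univ)
    (fun l _ => (hder l).hasDerivWithinAt) (fun l _ => ?_) convex_univ (Set.mem_univ m)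
    (Set.mem_univ l)
  have b0 := (wE κ (a, 0) q).norm_coe_le_norm l
  have b1 := (wE κ (a, 1) q).norm_coe_le_norm l
  have b2 := norm_pow_gaussWt_le 0 l
  rw [wE_apply, pow_zero, one_mul] at b0
  rw [wE_apply, pow_one] at b1
  rw [pow_zero, one_mul, Nat.factorial_zero, Nat.cast_one] at b2
  refine (norm_add_le _ _).trans (add_le_add ?_ ?_)
  · have : -(l : ℂ) / 4 * gaussWt l * bareE κ a q.1 q.2 l =
      -(1 / 4) * ((l : ℂ) * gaussWt l * bareE κ a q.1 q.2 l) := by ring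
    rw [this, norm_mul]
    have h4 : ‖(-(1 / 4) : ℂ)‖ = 1 / 4 := by simp
    rw [h4]
    linarith
  · rw [norm_mul]
    calc ‖gaussWt l‖ * ‖d l‖
        ≤ ‖gaussWt l‖ * (‖(2 * q.2 * l + q.1) * bareE κ a q.1 q.2 l‖ + C) := by
          gcongr; exact hn l
      _ = ‖2 * q.2 * ((l : ℂ) * gaussWt l * bareE κ a q.1 q.2 l) +
            q.1 * (gaussWt l * bareE κ a q.1 q.2 l)‖ + ‖gaussWt l‖ * C := by
          rw [mul_add, ← norm_mul]
          congr 2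
          ring
      _ ≤ (2 * |q.2| * B₁ + |q.1| * B₀) + 1 * Real.exp 2 * C := by
          refine add_le_add ((norm_add_le _ _).trans (add_le_add ?_ ?_)) (by gcongr)
          · rw [norm_mul, norm_mul, Complex.norm_real, Complex.norm_ofNat, Real.norm_eq_abs]
            gcongr
          · rw [norm_mul, Complex.norm_real, Real.norm_eq_abs]
            gcongr

/-- The divided difference `(e₊(l)e₋(m) - e₋(l)e₊(m)) / (l - m)` with Gaussian weights. -/
def kerFun (κ : ℝ) (q : ℝ × ℝ) (l m : ℝ) : ℂ :=
  (wE κ (true, 0) q l * wE κ (false, 0) q m - wE κ (false, 0) q l * wE κ (true, 0) q m) /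
    ((l : ℂ) - (m : ℂ))

theorem exists_norm_kerFun_le (κ : ℝ) (q : ℝ × ℝ) :
    ∃ C, ∀ p : OffDiag, ‖kerFun κ q p.1.1 p.1.2‖ ≤ C := by
  obtain ⟨C₁, h₁⟩ := exists_lipschitz_wE κ true q
  obtain ⟨C₂, h₂⟩ := exists_lipschitz_wE κ false q
  set φ := wE κ (true, 0) q
  set ψ := wE κ (false, 0) q
  refine ⟨C₁ * ‖ψ‖ + C₂ * ‖φ‖, ?_⟩
  rintro ⟨⟨l, m⟩, hlm⟩
  have hpos : 0 < |l - m| := abs_pos.2 (sub_ne_zero.2 hlm)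
  have hn : ‖(l : ℂ) - (m : ℂ)‖ = |l - m| := by
    rw [← Complex.ofReal_sub, Complex.norm_real, Real.norm_eq_abs]
  rw [kerFun, norm_div, hn, div_le_iff₀ hpos]
  -- Each term now has an increment that cancels the denominator.
  have e : φ l * ψ m - ψ l * φ m = (φ l - φ m) * ψ m - (ψ l - ψ m) * φ m := by ring
  change ‖φ l * ψ m - ψ l * φ m‖ ≤ _
  rw [e]
  refine (norm_sub_le _ _).trans ?_
  rw [norm_mul, norm_mul]
  have a1 := mul_le_mul (h₁ l m) (ψ.norm_coe_le_norm m) (norm_nonneg _) ((norm_nonneg _).trans (h₁ l m))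
  have a2 := mul_le_mul (h₂ l m) (φ.norm_coe_le_norm m) (norm_nonneg _) ((norm_nonneg _).trans (h₂ l m))
  linarith

/-- `kerFun` as a bounded continuous function off the diagonal. -/
def kerH (κ : ℝ) (q : ℝ × ℝ) : OffDiag →ᵇ ℂ :=
  BoundedContinuousFunction.ofNormedAddCommGroup (fun p : OffDiag => kerFun κ q p.1.1 p.1.2)
    (by
      unfold kerFun
      refine Continuous.div (by fun_prop) (by fun_prop) fun p => ?_
      rw [sub_ne_zero]
      exact_mod_cast p.2) _ (exists_norm_kerFun_le κ q).choose_spec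

theorem kerH_apply (κ : ℝ) (q : ℝ × ℝ) (p : OffDiag) : kerH κ q p = kerFun κ q p.1.1 p.1.2 := rfl

/-- On the diagonal both sides are zero, the right one by the convention for division by zero. -/
theorem extendZero_kerH (κ : ℝ) (q : ℝ × ℝ) (l m : ℝ) :
    extendZero (kerH κ q) (l, m) = kerFun κ q l m := by
  by_cases h : l = m
  · rw [extendZero_of_eq _ (p := (l, m)) h, kerFun, h, sub_self, div_zero]
  · rw [extendZero_of_ne _ (p := (l, m)) h, kerH_apply]

theorem kerFun_symm (κ : ℝ) (q : ℝ × ℝ) (l m : ℝ) : kerFun κ q l m = kerFun κ q m l := by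
  rw [kerFun, kerFun, ← neg_sub (m : ℂ), div_neg, ← neg_div]
  congr 1
  ring

/-- The derivative of `kerH` in `(x, t)`. -/
def kerH' (κ : ℝ) (q : ℝ × ℝ) : ℝ × ℝ →L[ℝ] (OffDiag →ᵇ ℂ) :=
  dxdt (-I • (tensor (wE κ (true, 0) q) (wE κ (false, 0) q) +
      tensor (wE κ (false, 0) q) (wE κ (true, 0) q)))
    (-I • (tensor (wE κ (true, 1) q) (wE κ (false, 0) q) +
      tensor (wE κ (true, 0) q) (wE κ (false, 1) q) +
      tensor (wE κ (false, 1) q) (wE κ (true, 0) q) +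
      tensor (wE κ (false, 0) q) (wE κ (true, 1) q)) -
      (2 * I * potG q.1 q.2) • tensor (wE κ (false, 0) q) (wE κ (false, 0) q))

/-- The derivative of the numerator is divisible by `l - m`. In `x` the phases give `l - m` and the
`G` terms cancel by antisymmetry; in `t` they give `l² - m²`, and the `G` terms leave `(l - m) e₋(l)
e₋(m)`. What remains is a finite sum of products. -/
theorem hasFDerivAt_kerH_apply (κ : ℝ) {q : ℝ × ℝ} (hq : q.2 ≠ 0) (p : OffDiag) :
    HasFDerivAt (fun r => kerH κ r p) ((evalCLM ℝ p).comp (kerH' κ q)) q := by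
  obtain ⟨⟨l, m⟩, hlm⟩ := p
  have hne : (l : ℂ) - m ≠ 0 := by rw [sub_ne_zero]; exact_mod_cast hlm
  have hqc : (q.2 : ℂ) ≠ 0 := by exact_mod_cast hq
  have d1 := hasFDerivAt_wE_apply κ (true, 0) hq l
  have d2 := hasFDerivAt_wE_apply κ (true, 0) hq m
  have d3 := hasFDerivAt_wE_apply κ (false, 0) hq l
  have d4 := hasFDerivAt_wE_apply κ (false, 0) hq m
  have hmain := ((d1.mul d4).sub (d3.mul d2)).mul_const ((l : ℂ) - m)⁻¹
  refine (hmain.congr_of_eventuallyEq (Eventually.of_forall fun r => ?_)).congr_fderiv ?_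
  · rw [kerH_apply, kerFun, div_eq_mul_inv]
    rfl
  · have t1 : ∀ f g : ℝ →ᵇ ℂ, tensor f g ⟨(l, m), hlm⟩ = f l * g m := fun _ _ => rfl
    ext
    · simp [wE', kerH', t1, wE_apply]
      field_simp
      ring
    · simp [wE', kerH', t1, wE_apply]
      field_simp
      ring

theorem contDiffOn_kerH' (κ : ℝ) (n : ℕ) : ContDiffOn ℝ n (kerH' κ) {q | q.2 ≠ 0} := by
  have ht : ∀ i j, ContDiffOn ℝ n (fun q => tensor (wE κ i q) (wE κ j q)) {q | q.2 ≠ 0} := by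
    exact fun i j => isBoundedBilinearMap_tensor.contDiff.comp_contDiffOn
      ((contDiffOn_wE κ n i).prodMk (contDiffOn_wE κ n j))
  have hG : ContDiffOn ℝ n (fun q : ℝ × ℝ => 2 * I * potG q.1 q.2) {q | q.2 ≠ 0} :=
    contDiffOn_const.mul (contDiffOn_potG n)
  refine contDiffOn_dxdt ?_ ?_
  · exact (contDiffOn_const (c := -I)).smul ((ht _ _).add (ht _ _))
  · exact ((contDiffOn_const (c := -I)).smul ((((ht _ _).add (ht _ _)).add (ht _ _)).add (ht _ _))).sub
      (hG.smul (ht _ _))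

theorem hasFDerivAt_kerH (κ : ℝ) {q : ℝ × ℝ} (hq : q.2 ≠ 0) :
    HasFDerivAt (kerH κ) (kerH' κ q) q := by
  refine hasFDerivAt_bcf ?_
    ((contDiffOn_kerH' κ 0).continuousOn.continuousAt (isOpen_snd_ne_zero.mem_nhds hq))
  filter_upwards [isOpen_snd_ne_zero.mem_nhds hq] with r hr
  exact hasFDerivAt_kerH_apply κ hr

/-- No induction is needed: the derivative no longer contains the divided difference, only `G` and
the functions `wE`, already known to be smooth. -/
theorem contDiffOn_kerH (κ : ℝ) (n : ℕ) : ContDiffOn ℝ n (kerH κ) {q | q.2 ≠ 0} := by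
  refine ContDiffOn.of_le (n := (n : WithTop ℕ∞) + 1) ?_ le_self_add
  rw [contDiffOn_succ_iff_fderiv_of_isOpen isOpen_snd_ne_zero]
  refine ⟨fun q hq => (hasFDerivAt_kerH κ hq).differentiableAt.differentiableWithinAt, by simp, ?_⟩
  exact (contDiffOn_kerH' κ n).congr fun q hq => (hasFDerivAt_kerH κ hq).fderiv

/-! ### Smooth dependence of the Fermi weight on `β` and on a shift of `l`. -/

theorem fermi_pos (β l : ℝ) : 0 < fermi β l := by unfold fermi; positivity

theorem fermi_le_one (β l : ℝ) : fermi β l ≤ 1 := by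
  rw [fermi, div_le_one (by positivity)]
  linarith [Real.exp_pos (l ^ 2 - β)]

theorem continuous_fermi (β : ℝ) : Continuous (fermi β) := by
  unfold fermi
  exact continuous_const.div (by fun_prop) fun l => by positivity

theorem sqrt_fermi_le (β l : ℝ) : √(fermi β l) ≤ Real.exp ((β - l ^ 2) / 2) := by
  rw [Real.sqrt_le_left (Real.exp_pos _).le, ← Real.exp_nat_mul, fermi,
    div_le_iff₀ (by positivity)]
  have e : ((2 : ℕ) : ℝ) * ((β - l ^ 2) / 2) = -(l ^ 2 - β) := by push_cast; ring
  rw [e, mul_add, ← Real.exp_add, neg_add_cancel, Real.exp_zero, mul_one]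
  linarith [Real.exp_pos (-(l ^ 2 - β))]

/-- `e^{l²/4} yᵏ ϑ(y)ʲ √ϑ(y)` with `y = l + s`. -/
def wtFun (i : ℕ × ℕ) (q : ℝ × ℝ) (l : ℝ) : ℝ :=
  (l + q.2) ^ i.1 * (fermi q.1 (l + q.2) ^ i.2 * √(fermi q.1 (l + q.2))) * Real.exp (l ^ 2 / 4)

/-- A bound for `wtFun`. -/
def wtBound (k : ℕ) (q : ℝ × ℝ) : ℝ :=
  Real.exp (q.1 / 2 + 3 * q.2 ^ 2 / 4) * (k.factorial * Real.exp 2)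

theorem norm_wtFun_le (i : ℕ × ℕ) (q : ℝ × ℝ) (l : ℝ) :
    ‖((wtFun i q l : ℝ) : ℂ)‖ ≤ wtBound i.1 q := by
  obtain ⟨k, j⟩ := i
  obtain ⟨β, s⟩ := q
  set y := l + s with hy
  have h1 : fermi β y ^ j ≤ 1 := pow_le_one₀ (fermi_pos β y).le (fermi_le_one β y)
  have h0 := (fermi_pos β y).le
  rw [Complex.norm_real, Real.norm_eq_abs]
  simp only [wtFun, ← hy]
  rw [abs_mul, abs_mul, abs_pow, abs_of_nonneg (by positivity : 0 ≤ fermi β y ^ j * √(fermi β y)),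
    abs_of_pos (Real.exp_pos _)]
  calc |y| ^ k * (fermi β y ^ j * √(fermi β y)) * Real.exp (l ^ 2 / 4)
      ≤ |y| ^ k * (1 * Real.exp ((β - y ^ 2) / 2)) * Real.exp (l ^ 2 / 4) := by
        gcongr
        exact sqrt_fermi_le β y
    _ = |y| ^ k * Real.exp ((β - y ^ 2) / 2 + l ^ 2 / 4) := by rw [Real.exp_add]; ring
    _ ≤ |y| ^ k * Real.exp ((β / 2 + 3 * s ^ 2 / 4) + -(y ^ 2) / 8) := by
        refine mul_le_mul_of_nonneg_left (Real.exp_le_exp.2 ?_) (by positivity)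
        have : l ^ 2 = (y - s) ^ 2 := by rw [hy]; ring
        -- The two exponents differ by exactly `(y + 2s)²/8`.
        nlinarith [sq_nonneg (y + 2 * s)]
    _ = Real.exp (β / 2 + 3 * s ^ 2 / 4) * (|y| ^ k * Real.exp (-(y ^ 2) / 8)) := by
        rw [Real.exp_add]; ring
    _ ≤ _ := by
        unfold wtBound
        exact mul_le_mul_of_nonneg_left (pow_mul_exp_neg_sq_le k y) (Real.exp_pos _).le

theorem continuous_wtFun (i : ℕ × ℕ) (q : ℝ × ℝ) : Continuous (wtFun i q) := by
  have := continuous_fermi q.1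
  unfold wtFun
  fun_prop

/-- `wtFun` as a bounded continuous function. -/
def wt (i : ℕ × ℕ) (q : ℝ × ℝ) : ℝ →ᵇ ℂ :=
  BoundedContinuousFunction.ofNormedAddCommGroup (fun l => ((wtFun i q l : ℝ) : ℂ))
    (by have := continuous_wtFun i q; fun_prop) _ (norm_wtFun_le i q)

theorem wt_apply (i : ℕ × ℕ) (q : ℝ × ℝ) (l : ℝ) : wt i q l = (wtFun i q l : ℝ) := rfl

/-- The derivative of `wt` in `(β, s)`. -/
def wt' (i : ℕ × ℕ) (q : ℝ × ℝ) : ℝ × ℝ →L[ℝ] (ℝ →ᵇ ℂ) :=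
  dxdt (((i.2 : ℝ) + 1 / 2) • (wt i q - wt (i.1, i.2 + 1) q))
    -- For `i.1 = 0` the truncated exponent does no harm, since its coefficient vanishes.
    ((i.1 : ℝ) • wt (i.1 - 1, i.2) q -
      (2 * (i.2 : ℝ) + 1) • (wt (i.1 + 1, i.2) q - wt (i.1 + 1, i.2 + 1) q))

theorem hasDerivAt_logistic (u : ℝ) :
    HasDerivAt (fun u => 1 / (1 + Real.exp (-u)))
      (1 / (1 + Real.exp (-u)) * (1 - 1 / (1 + Real.exp (-u)))) u := by
  have h0 : 1 + Real.exp (-u) ≠ 0 := by positivity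
  refine ((hasDerivAt_const u (1 : ℝ)).fun_div ((hasDerivAt_neg u).exp.const_add 1) h0).congr_deriv ?_
  field_simp
  ring

/-- The logistic equation `f' = f(1-f)` keeps the powers `f^{j+1/2}` closed under differentiation,
so the weights form a family to which `contDiffOn_bcf_family` applies. -/
theorem hasDerivAt_pow_mul_sqrt {f : ℝ → ℝ} {u : ℝ} (hf : HasDerivAt f (f u * (1 - f u)) u)
    (hpos : 0 < f u) (j : ℕ) :
    HasDerivAt (fun u => f u ^ j * √(f u))
      (((j : ℝ) + 1 / 2) * (f u ^ j * √(f u) - f u ^ (j + 1) * √(f u))) u := by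
  have hs : 0 < √(f u) := Real.sqrt_pos.2 hpos
  have hss : √(f u) * √(f u) = f u := Real.mul_self_sqrt hpos.le
  refine ((hf.fun_pow j).mul (hf.sqrt hpos.ne')).congr_deriv ?_
  have e : f u / √(f u) = √(f u) := by rw [div_eq_iff hs.ne', hss]
  have e2 : f u * (1 - f u) / (2 * √(f u)) = √(f u) * (1 - f u) / 2 := by
    rw [← e]; field_simp; rw [Real.sq_sqrt hpos.le, mul_comm]
  rw [e2]
  cases j with
  | zero => simp; ring
  | succ j => simp; ring

theorem hasFDerivAt_wt_apply (i : ℕ × ℕ) (q : ℝ × ℝ) (l : ℝ) :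
    HasFDerivAt (fun p => wt i p l) ((evalCLM ℝ l).comp (wt' i q)) q := by
  obtain ⟨k, j⟩ := i
  have hu : HasFDerivAt (fun p : ℝ × ℝ => p.1 - (l + p.2) ^ 2) (dxdt 1 (-2 * (l + q.2))) q := by
    refine ((hasFDerivAt_fst (𝕜 := ℝ)).sub ((hasDerivAt_pow 2 (l + q.2)).comp_hasFDerivAt
      q ((hasFDerivAt_snd (𝕜 := ℝ) (p := q)).const_add l))).congr_fderiv ?_
    ext <;> simp
  have hf : ∀ u, HasDerivAt (fun u => 1 / (1 + Real.exp (-u))) _ u := hasDerivAt_logistic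
  have hρ := (hasDerivAt_pow_mul_sqrt (hf (q.1 - (l + q.2) ^ 2)) (by positivity) j).comp_hasFDerivAt
    q hu
  have hy : HasFDerivAt (fun p : ℝ × ℝ => (l + p.2) ^ k) _ q :=
    (hasDerivAt_pow k (l + q.2)).comp_hasFDerivAt q
      ((hasFDerivAt_snd (𝕜 := ℝ) (p := q)).const_add l)
  have hmain := ((hy.mul hρ).mul_const (Real.exp (l ^ 2 / 4)))
  have hc := Complex.ofRealCLM.hasFDerivAt.comp q hmain
  have hfermi : ∀ p : ℝ × ℝ, 1 / (1 + Real.exp (-(p.1 - (l + p.2) ^ 2))) = fermi p.1 (l + p.2) := by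
    intro p; rw [fermi, neg_sub]
  refine (hc.congr_of_eventuallyEq (Eventually.of_forall fun p => ?_)).congr_fderiv ?_
  · simp only [Function.comp, Pi.mul_apply, hfermi]
    rfl
  · simp only [Function.comp, hfermi]
    ext
    · simp [wt', wt_apply, wtFun]
      ring
    · simp [wt', wt_apply, wtFun]
      ring

theorem isBigO_wt (i : ℕ × ℕ) (q : ℝ × ℝ) : wt i =O[𝓝 q] (fun _ => (1 : ℝ)) := by
  have h1 : ContinuousAt (wtBound i.1) q := by
    unfold wtBound
    fun_prop
  refine (Asymptotics.isBigO_of_le (𝓝 q) fun p => ?_).trans (h1.isBigO_one ℝ)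
  refine le_trans ?_ (Real.le_norm_self _)
  exact (BoundedContinuousFunction.norm_le (by unfold wtBound; positivity)).2 (norm_wtFun_le i p)

theorem wt_smooth :
    (∀ (n : ℕ) i, ContDiffOn ℝ n (wt i) Set.univ) ∧
      ∀ i, ∀ q ∈ Set.univ, HasFDerivAt (wt i) (wt' i q) q := by
  refine contDiffOn_bcf_family isOpen_univ (fun i q _ l => hasFDerivAt_wt_apply i q l) ?_ ?_
  · rintro ⟨k, j⟩ q _
    have hw : ∀ i, wt i =O[𝓝 q] (fun _ => (1 : ℝ)) := fun i => isBigO_wt i q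
    have hc : ∀ (c : ℝ) i, (fun q => c • wt i q) =O[𝓝 q] (fun _ => (1 : ℝ)) := fun c i =>
      (hw i).const_smul_left c
    have hd : ∀ (c : ℝ) i j, (fun q => c • (wt i q - wt j q)) =O[𝓝 q] (fun _ => (1 : ℝ)) :=
      fun c i j => ((hw i).sub (hw j)).const_smul_left c
    exact isBigO_one_dxdt (hd _ (k, j) (k, j + 1))
      ((hc _ (k - 1, j)).sub (hd _ (k + 1, j) (k + 1, j + 1)))
  · rintro n ih ⟨k, j⟩
    have hd : ∀ (c : ℝ) i j, ContDiffOn ℝ n (fun q => c • (wt i q - wt j q)) Set.univ :=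
      fun c i j => (contDiffOn_const (c := c)).smul ((ih i).sub (ih j))
    exact contDiffOn_dxdt (hd _ (k, j) (k, j + 1))
      (((contDiffOn_const (c := (k : ℝ))).smul (ih (k - 1, j))).sub (hd _ (k + 1, j) (k + 1, j + 1)))

theorem contDiff_wt (n : ℕ) (i : ℕ × ℕ) : ContDiff ℝ n (wt i) :=
  contDiffOn_univ.1 (wt_smooth.1 n i)

theorem hasFDerivAt_wt (i : ℕ × ℕ) (q : ℝ × ℝ) : HasFDerivAt (wt i) (wt' i q) q :=
  wt_smooth.2 i q (Set.mem_univ q)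

end AnyonNLS

end

/-! ### Calculus of operators on `L²`, the resolvent, and the operator `V`. -/

noncomputable section

namespace AnyonNLS

open Complex (I)
open scoped BoundedContinuousFunction

attribute [local irreducible] pairing mulOp kernOp vec

theorem contDiff_mulOp (n : WithTop ℕ∞) : ContDiff ℝ n (fun h : ℝ →ᵇ ℂ => mulOp h) :=
  (mulOp.contDiff (𝕜 := ℂ) (n := n)).restrict_scalars ℝ

theorem hasDerivAt_mulOp {h : ℝ → ℝ →ᵇ ℂ} {h' : ℝ →ᵇ ℂ} {s : ℝ} (hh : HasDerivAt h h' s) :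
    HasDerivAt (fun s => mulOp (h s)) (mulOp h') s :=
  ((mulOp.hasFDerivAt (𝕜 := ℂ) (x := h s)).restrictScalars ℝ).comp_hasDerivAt s hh

theorem contDiff_vec (n : WithTop ℕ∞) : ContDiff ℝ n (fun h : ℝ →ᵇ ℂ => vec h) :=
  (vec.contDiff (𝕜 := ℂ) (n := n)).restrict_scalars ℝ

theorem hasDerivAt_vec {h : ℝ → ℝ →ᵇ ℂ} {h' : ℝ →ᵇ ℂ} {s : ℝ} (hh : HasDerivAt h h' s) :
    HasDerivAt (fun s => vec (h s)) (vec h') s :=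
  ((vec.hasFDerivAt (𝕜 := ℂ) (x := h s)).restrictScalars ℝ).comp_hasDerivAt s hh

theorem contDiff_kernOp (n : WithTop ℕ∞) : ContDiff ℝ n (fun h : OffDiag →ᵇ ℂ => kernOp h) :=
  (kernOp.contDiff (𝕜 := ℂ) (n := n)).restrict_scalars ℝ

theorem hasDerivAt_kernOp {h : ℝ → OffDiag →ᵇ ℂ} {h' : OffDiag →ᵇ ℂ} {s : ℝ}
    (hh : HasDerivAt h h' s) : HasDerivAt (fun s => kernOp (h s)) (kernOp h') s :=
  ((kernOp.hasFDerivAt (𝕜 := ℂ) (x := h s)).restrictScalars ℝ).comp_hasDerivAt s hh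

theorem contDiff_comp_op (n : WithTop ℕ∞) :
    ContDiff ℝ n (fun p : (Ltwo →L[ℂ] Ltwo) × (Ltwo →L[ℂ] Ltwo) => p.1.comp p.2) :=
  (isBoundedBilinearMap_comp (𝕜 := ℂ) (E := Ltwo) (F := Ltwo) (G := Ltwo)).contDiff.restrict_scalars ℝ

theorem contDiff_apply_op (n : WithTop ℕ∞) :
    ContDiff ℝ n (fun p : (Ltwo →L[ℂ] Ltwo) × Ltwo => p.1 p.2) :=
  (isBoundedBilinearMap_apply (𝕜 := ℂ) (E := Ltwo) (F := Ltwo)).contDiff.restrict_scalars ℝ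

theorem contDiff_pairing (n : WithTop ℕ∞) :
    ContDiff ℝ n (fun p : Ltwo × Ltwo => pairing p.1 p.2) :=
  (pairing.isBoundedBilinearMap).contDiff.restrict_scalars ℝ

theorem contDiffOn_pairing {E : Type*} [NormedAddCommGroup E] [NormedSpace ℝ E] {u v : E → Ltwo}
    {s : Set E} {n : WithTop ℕ∞} (hu : ContDiffOn ℝ n u s) (hv : ContDiffOn ℝ n v s) :
    ContDiffOn ℝ n (fun q => pairing (u q) (v q)) s :=
  (contDiff_pairing n).comp_contDiffOn (hu.prodMk hv)

theorem contDiffOn_apply_op {E : Type*} [NormedAddCommGroup E] [NormedSpace ℝ E]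
    {A : E → Ltwo →L[ℂ] Ltwo} {u : E → Ltwo} {s : Set E} {n : WithTop ℕ∞}
    (hA : ContDiffOn ℝ n A s) (hu : ContDiffOn ℝ n u s) : ContDiffOn ℝ n (fun q => A q (u q)) s :=
  (contDiff_apply_op n).comp_contDiffOn (hA.prodMk hu)

theorem contDiffOn_comp_op {E : Type*} [NormedAddCommGroup E] [NormedSpace ℝ E]
    {A B : E → Ltwo →L[ℂ] Ltwo} {s : Set E} {n : WithTop ℕ∞}
    (hA : ContDiffOn ℝ n A s) (hB : ContDiffOn ℝ n B s) :
    ContDiffOn ℝ n (fun q => (A q).comp (B q)) s :=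
  (contDiff_comp_op n).comp_contDiffOn (hA.prodMk hB)

theorem hasDerivAt_comp_op {A B : ℝ → Ltwo →L[ℂ] Ltwo} {A' B' : Ltwo →L[ℂ] Ltwo} {s : ℝ}
    (hA : HasDerivAt A A' s) (hB : HasDerivAt B B' s) :
    HasDerivAt (fun s => (A s).comp (B s)) (A'.comp (B s) + (A s).comp B') s := by
  have h := ((isBoundedBilinearMap_comp (𝕜 := ℂ) (E := Ltwo) (F := Ltwo) (G := Ltwo)).hasFDerivAt
    (A s, B s)).restrictScalars ℝ |>.comp_hasDerivAt s (hA.prodMk hB)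
  exact h.congr_deriv (add_comm _ _)

theorem hasDerivAt_apply_op {A : ℝ → Ltwo →L[ℂ] Ltwo} {u : ℝ → Ltwo} {A' : Ltwo →L[ℂ] Ltwo}
    {u' : Ltwo} {s : ℝ} (hA : HasDerivAt A A' s) (hu : HasDerivAt u u' s) :
    HasDerivAt (fun s => A s (u s)) (A' (u s) + A s u') s := by
  have h := ((isBoundedBilinearMap_apply (𝕜 := ℂ) (E := Ltwo) (F := Ltwo)).hasFDerivAt
    (A s, u s)).restrictScalars ℝ |>.comp_hasDerivAt s (hA.prodMk hu)
  exact h.congr_deriv (add_comm _ _)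

theorem hasDerivAt_pairing {u v : ℝ → Ltwo} {u' v' : Ltwo} {s : ℝ}
    (hu : HasDerivAt u u' s) (hv : HasDerivAt v v' s) :
    HasDerivAt (fun s => pairing (u s) (v s)) (pairing u' (v s) + pairing (u s) v') s := by
  have h := ((pairing.isBoundedBilinearMap).hasFDerivAt
    (u s, v s)).restrictScalars ℝ |>.comp_hasDerivAt s (hu.prodMk hv)
  exact h.congr_deriv (add_comm _ _)

/-- The resolvent `(1 + A)⁻¹`. -/
def res (A : Ltwo →L[ℂ] Ltwo) : Ltwo →L[ℂ] Ltwo := Ring.inverse (1 + A)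

theorem contDiffAt_res {A : Ltwo →L[ℂ] Ltwo} (hA : IsUnit (1 + A)) (n : WithTop ℕ∞) :
    ContDiffAt ℝ n res A := by
  obtain ⟨w, hw⟩ := hA
  have h1 : ContDiffAt ℝ n (Ring.inverse : (Ltwo →L[ℂ] Ltwo) → _) (1 + A) := by
    rw [← hw]; exact (contDiffAt_ringInverse ℂ w).restrict_scalars ℝ
  have h2 : ContDiffAt ℝ n (fun B : Ltwo →L[ℂ] Ltwo => 1 + B) A := contDiffAt_const.add contDiffAt_id
  exact h1.comp A h2

theorem contDiffWithinAt_res {E : Type*} [NormedAddCommGroup E] [NormedSpace ℝ E]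
    {A : E → Ltwo →L[ℂ] Ltwo} {s : Set E} {q : E} {n : WithTop ℕ∞}
    (hA : ContDiffWithinAt ℝ n A s q) (hu : IsUnit (1 + A q)) :
    ContDiffWithinAt ℝ n (fun q => res (A q)) s q :=
  (contDiffAt_res hu n).comp_contDiffWithinAt q hA

theorem hasDerivAt_ringInverse {R : Type*} [NormedRing R] [NormedAlgebra ℂ R] [CompleteSpace R]
    [NormedSpace ℝ R] [IsScalarTower ℝ ℂ R] {A : ℝ → R} {A' : R} {s : ℝ}
    (hA : HasDerivAt A A' s) (hu : IsUnit (A s)) :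
    HasDerivAt (fun s => Ring.inverse (A s))
      (-(Ring.inverse (A s) * A' * Ring.inverse (A s))) s := by
  obtain ⟨w, hw⟩ := hu
  have h1 := (hasFDerivAt_ringInverse (𝕜 := ℂ) w).restrictScalars ℝ
  rw [hw] at h1
  refine (h1.comp_hasDerivAt s hA).congr_deriv ?_
  rw [← hw, Ring.inverse_unit]
  simp

theorem hasDerivAt_res {A : ℝ → Ltwo →L[ℂ] Ltwo} {A' : Ltwo →L[ℂ] Ltwo} {s : ℝ}
    (hA : HasDerivAt A A' s) (hu : IsUnit (1 + A s)) :
    HasDerivAt (fun s => res (A s)) (-(res (A s) * A' * res (A s))) s :=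
  hasDerivAt_ringInverse (hA.const_add 1) hu

theorem res_apply_add {A : Ltwo →L[ℂ] Ltwo} (hA : IsUnit (1 + A)) (u : Ltwo) :
    res A u + A (res A u) = u := by
  have h := Ring.mul_inverse_cancel _ hA
  have := congrArg (fun B : Ltwo →L[ℂ] Ltwo => B u) h
  simpa [res] using this

theorem res_eq_of_add_eq {A : Ltwo →L[ℂ] Ltwo} (hA : IsUnit (1 + A)) {f u : Ltwo}
    (h : f + A f = u) : res A u = f := by
  have h1 := Ring.inverse_mul_cancel _ hA
  have := congrArg (fun B : Ltwo →L[ℂ] Ltwo => B f) h1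
  rw [← h]
  simpa [res] using this

/-- Write each vector as `(1 + A)` applied to its resolvent; symmetry of `A` then passes to `(1 +
A)⁻¹`. -/
theorem pairing_res {A : Ltwo →L[ℂ] Ltwo} (hA : IsUnit (1 + A))
    (hs : ∀ u v, pairing (A u) v = pairing u (A v)) (u v : Ltwo) :
    pairing (res A u) v = pairing u (res A v) := by
  conv_lhs => rw [← res_apply_add hA v]
  conv_rhs => rw [← res_apply_add hA u]
  rw [map_add, map_add, add_apply, hs]

/-- Symmetry places a resolvent on both sides of `A'`, so a rank one term of `A'` contributes a
product of two scalars. -/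
theorem hasDerivAt_pairing_res {u v : ℝ → Ltwo} {A : ℝ → Ltwo →L[ℂ] Ltwo} {u' v' : Ltwo}
    {A' : Ltwo →L[ℂ] Ltwo} {s : ℝ} (hu : HasDerivAt u u' s) (hv : HasDerivAt v v' s)
    (hA : HasDerivAt A A' s) (hunit : IsUnit (1 + A s))
    (hs : ∀ u v, pairing (A s u) v = pairing u (A s v)) :
    HasDerivAt (fun s => pairing (u s) (res (A s) (v s)))
      (pairing u' (res (A s) (v s)) + pairing (res (A s) (u s)) v' -
        pairing (res (A s) (u s)) (A' (res (A s) (v s)))) s := by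
  refine (hasDerivAt_pairing hu (hasDerivAt_apply_op (hasDerivAt_res hA hunit) hv)).congr_deriv ?_
  simp only [pairing_res hunit hs, map_add, neg_apply, map_neg,
    mul_apply_eq_comp]
  ring

theorem mulOp_comp_outer_comp (w : ℝ →ᵇ ℂ) (u v : Ltwo) :
    (mulOp w).comp ((outer u v).comp (mulOp w)) = outer (mulOp w u) (mulOp w v) := by
  ext1 f
  simp only [ContinuousLinearMap.comp_apply, outer_apply, map_smul, pairing_mulOp]

theorem mulOp_comp_kernOp_comp (w₁ w₂ : ℝ →ᵇ ℂ) (h : OffDiag →ᵇ ℂ) :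
    (mulOp w₁).comp ((kernOp h).comp (mulOp w₂)) = kernOp (h * tensor w₁ w₂) := by
  ext1 f
  refine Lp.ext ?_
  simp only [ContinuousLinearMap.comp_apply]
  filter_upwards [coeFn_mulOp w₁ (kernOp h (mulOp w₂ f)), coeFn_kernOp h (mulOp w₂ f),
    coeFn_kernOp (h * tensor w₁ w₂) f] with l a1 a2 a3
  rw [a1, a2, a3, kernFun_congr h (coeFn_mulOp w₂ f), kernFun, kernFun, ← mul_assoc,
    ← integral_const_mul]
  congr 2
  funext m
  by_cases hp : l = m
  · simp [extendZero_of_eq _ (p := (l, m)) hp]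
  · simp only [extendZero_of_ne _ (p := (l, m)) hp, BoundedContinuousFunction.mul_apply, tensor_apply]
    ring

/-- The operator `V` with the weight `w` in place of `e^{l²/4} √ϑ`. -/
def opK (κ : ℝ) (w : ℝ →ᵇ ℂ) (q : ℝ × ℝ) : Ltwo →L[ℂ] Ltwo :=
  (mulOp w).comp ((kernOp (kerH κ q)).comp (mulOp w))

/-- The vectors `lᵏ e±` with the weight `w` in place of `e^{l²/4} √ϑ`. -/
def vecK (κ : ℝ) (w : ℝ →ᵇ ℂ) (a : Bool) (k : ℕ) (q : ℝ × ℝ) : Ltwo :=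
  mulOp w (vec (wE κ (a, k) q))

/-- The operator `V_T` on `L²`. -/
def opV (κ x t β : ℝ) : Ltwo →L[ℂ] Ltwo := opK κ (wt (0, 0) (β, 0)) (x, t)

/-- The vectors `lᵏ e±`. -/
def eVec (κ : ℝ) (a : Bool) (k : ℕ) (x t β : ℝ) : Ltwo := vecK κ (wt (0, 0) (β, 0)) a k (x, t)

theorem pairing_opK (κ : ℝ) (w : ℝ →ᵇ ℂ) (q : ℝ × ℝ) (u v : Ltwo) :
    pairing (opK κ w q u) v = pairing u (opK κ w q v) := by
  simp only [opK, ContinuousLinearMap.comp_apply]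
  rw [pairing_mulOp, pairing_kernOp, pairing_mulOp]
  intro l m
  rw [extendZero_kerH, extendZero_kerH, kerFun_symm]

section XT

variable {κ : ℝ} {w : ℝ →ᵇ ℂ} {x t : ℝ}

theorem hasDerivAt_vecK {a : Bool} {k : ℕ} {c : ℝ → ℝ × ℝ} {c' : ℝ × ℝ} {s : ℝ}
    (hc : HasDerivAt c c' s) (h : (c s).2 ≠ 0) :
    HasDerivAt (fun s => vecK κ w a k (c s)) (mulOp w (vec (wE' κ (a, k) (c s) c'))) s := by
  have h1 : HasDerivAt (fun s => wE κ (a, k) (c s)) _ s :=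
    (hasFDerivAt_wE κ (a, k) h).comp_hasDerivAt s hc
  exact (hasDerivAt_apply_op (hasDerivAt_const s (mulOp w)) (hasDerivAt_vec h1)).congr_deriv (by simp)

theorem hasDerivAt_opK {c : ℝ → ℝ × ℝ} {c' : ℝ × ℝ} {s : ℝ}
    (hc : HasDerivAt c c' s) (h : (c s).2 ≠ 0) :
    HasDerivAt (fun s => opK κ w (c s))
      ((mulOp w).comp ((kernOp (kerH' κ (c s) c')).comp (mulOp w))) s := by
  have h1 : HasDerivAt (fun s => kerH κ (c s)) _ s :=
    (hasFDerivAt_kerH κ h).comp_hasDerivAt s hc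
  exact (hasDerivAt_comp_op (hasDerivAt_const s (mulOp w))
    (hasDerivAt_comp_op (hasDerivAt_kernOp h1) (hasDerivAt_const s (mulOp w)))).congr_deriv (by simp)

theorem hasDerivAt_line_x (x t : ℝ) : HasDerivAt (fun s : ℝ => (s, t)) ((1 : ℝ), (0 : ℝ)) x :=
  (hasDerivAt_id x).prodMk (hasDerivAt_const x t)

theorem hasDerivAt_line_t (x t : ℝ) : HasDerivAt (fun s : ℝ => (x, s)) ((0 : ℝ), (1 : ℝ)) t :=
  (hasDerivAt_const t x).prodMk (hasDerivAt_id t)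

theorem mulOp_vec_wE'_x (κ : ℝ) (w : ℝ →ᵇ ℂ) (a : Bool) (k : ℕ) (q : ℝ × ℝ) :
    mulOp w (vec (wE' κ (a, k) q (1, 0))) =
      if a then -I • vecK κ w true (k + 1) q - (2 * I * potG q.1 q.2) • vecK κ w false k q
      else I • vecK κ w false (k + 1) q := by
  cases a <;> simp [wE', vecK]

theorem mulOp_vec_wE'_t (κ : ℝ) (w : ℝ →ᵇ ℂ) (a : Bool) (k : ℕ) (q : ℝ × ℝ) :
    mulOp w (vec (wE' κ (a, k) q (0, 1))) =
      if a then -I • vecK κ w true (k + 2) q - (2 * I * potG q.1 q.2) • vecK κ w false (k + 1) q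
        + (I * (q.1 / q.2 : ℝ) * potG q.1 q.2) • vecK κ w false k q
      else I • vecK κ w false (k + 2) q := by
  cases a <;> simp [wE', vecK]

theorem mulOp_kerH'_x (κ : ℝ) (w : ℝ →ᵇ ℂ) (q : ℝ × ℝ) :
    (mulOp w).comp ((kernOp (kerH' κ q (1, 0))).comp (mulOp w)) =
      -I • (outer (vecK κ w true 0 q) (vecK κ w false 0 q) +
        outer (vecK κ w false 0 q) (vecK κ w true 0 q)) := by
  simp only [kerH', dxdt_apply, one_smul, zero_smul, add_zero, map_smul, map_add, kernOp_tensor,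
    vecK, ← mulOp_comp_outer_comp, ContinuousLinearMap.smul_comp, ContinuousLinearMap.comp_smul,
    ContinuousLinearMap.add_comp, ContinuousLinearMap.comp_add]

theorem mulOp_kerH'_t (κ : ℝ) (w : ℝ →ᵇ ℂ) (q : ℝ × ℝ) :
    (mulOp w).comp ((kernOp (kerH' κ q (0, 1))).comp (mulOp w)) =
      -I • (outer (vecK κ w true 1 q) (vecK κ w false 0 q) +
        outer (vecK κ w true 0 q) (vecK κ w false 1 q) +
        outer (vecK κ w false 1 q) (vecK κ w true 0 q) +
        outer (vecK κ w false 0 q) (vecK κ w true 1 q)) -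
      (2 * I * potG q.1 q.2) • outer (vecK κ w false 0 q) (vecK κ w false 0 q) := by
  simp only [kerH', dxdt_apply, one_smul, zero_smul, zero_add, map_smul, map_add, map_sub,
    kernOp_tensor, vecK, ← mulOp_comp_outer_comp, ContinuousLinearMap.smul_comp,
    ContinuousLinearMap.comp_smul, ContinuousLinearMap.add_comp, ContinuousLinearMap.comp_add,
    ContinuousLinearMap.sub_comp, ContinuousLinearMap.comp_sub]

end XT

/-- The bounded function `1 - ϑ`. -/
def coFermi (β : ℝ) : ℝ →ᵇ ℂ :=
  BoundedContinuousFunction.ofNormedAddCommGroup (fun l => ((1 - fermi β l : ℝ) : ℂ))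
    (by have := continuous_fermi β; fun_prop) 1 (fun l => by
      rw [Complex.norm_real, Real.norm_eq_abs, abs_le]
      constructor <;> linarith [fermi_pos β l, fermi_le_one β l])

theorem coFermi_apply (β l : ℝ) : coFermi β l = ((1 - fermi β l : ℝ) : ℂ) := rfl

theorem wt_sub_wt_succ (k j : ℕ) (β : ℝ) :
    wt (k, j) (β, 0) - wt (k, j + 1) (β, 0) = coFermi β * wt (k, j) (β, 0) := by
  ext l
  simp only [BoundedContinuousFunction.sub_apply, BoundedContinuousFunction.mul_apply, wt_apply,
    coFermi_apply, wtFun, add_zero]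
  push_cast
  ring

theorem hasDerivAt_wt_β (β : ℝ) :
    HasDerivAt (fun β => wt (0, 0) (β, 0)) ((1 / 2 : ℝ) • (coFermi β * wt (0, 0) (β, 0))) β := by
  refine ((hasFDerivAt_wt (0, 0) (β, 0)).comp_hasDerivAt β (hasDerivAt_line_x β 0)).congr_deriv ?_
  rw [← wt_sub_wt_succ]
  simp [wt']

theorem hasDerivAt_wt_s (β : ℝ) :
    HasDerivAt (fun s => wt (0, 0) (β, s)) (-(coFermi β * wt (1, 0) (β, 0))) 0 := by
  refine ((hasFDerivAt_wt (0, 0) (β, 0)).comp_hasDerivAt 0 (hasDerivAt_line_t β 0)).congr_deriv ?_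
  rw [← wt_sub_wt_succ]
  simp [wt']

theorem mulOp_half_mul (h w : ℝ →ᵇ ℂ) (g : Ltwo) :
    mulOp ((1 / 2 : ℝ) • (h * w)) g = (1 / 2 : ℂ) • mulOp h (mulOp w g) := by
  have e : ((1 / 2 : ℝ) • (h * w)) = (1 / 2 : ℂ) • (h * w) := by
    ext l
    simp
  rw [mulOp_mulOp, e, map_smul]
  rfl

theorem hasDerivAt_eVec_β (κ : ℝ) (a : Bool) (k : ℕ) (x t β : ℝ) :
    HasDerivAt (fun β => eVec κ a k x t β)
      ((1 / 2 : ℂ) • mulOp (coFermi β) (eVec κ a k x t β)) β := by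
  refine (hasDerivAt_apply_op (hasDerivAt_mulOp (hasDerivAt_wt_β β))
    (hasDerivAt_const β (vec (wE κ (a, k) (x, t))))).congr_deriv ?_
  rw [mulOp_half_mul, map_zero, add_zero]
  rfl

/-- `β` enters `V = w K w` only through the outer weights, and `∂_β w = ½(1-ϑ)w` because `∂_βϑ =
ϑ(1-ϑ)`. -/
theorem hasDerivAt_opV_β (κ x t β : ℝ) :
    HasDerivAt (fun β => opV κ x t β)
      ((1 / 2 : ℂ) • ((mulOp (coFermi β)).comp (opV κ x t β) +
        (opV κ x t β).comp (mulOp (coFermi β)))) β := by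
  have h := hasDerivAt_mulOp (hasDerivAt_wt_β β)
  refine (hasDerivAt_comp_op h (hasDerivAt_comp_op (hasDerivAt_const β (kernOp (kerH κ (x, t)))) h)).congr_deriv ?_
  ext1 f
  simp only [add_apply, ContinuousLinearMap.comp_apply,
    zero_apply, smul_apply, opV, opK, mulOp_half_mul, zero_add, map_smul,
    smul_add]
  rw [mulOp_comm (coFermi β) (wt (0, 0) (β, 0)) f]

/-- The region of parameters with `t ≠ 0`. -/
def tNonzero : Set (ℝ × ℝ × ℝ) := {q | q.2.1 ≠ 0}

theorem isOpen_tNonzero : IsOpen tNonzero :=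
  isOpen_ne_fun (by fun_prop) continuous_const

theorem contDiff_wt_β (n : ℕ) :
    ContDiff ℝ n (fun q : ℝ × ℝ × ℝ => mulOp (wt (0, 0) (q.2.2, 0))) :=
  (contDiff_mulOp n).comp ((contDiff_wt n (0, 0)).comp
    ((contDiff_snd.comp contDiff_snd).prodMk contDiff_const))

theorem contDiffOn_eVec (κ : ℝ) (a : Bool) (k n : ℕ) :
    ContDiffOn ℝ n (fun q : ℝ × ℝ × ℝ => eVec κ a k q.1 q.2.1 q.2.2) tNonzero := by
  have h1 : ContDiffOn ℝ n (fun q : ℝ × ℝ × ℝ => wE κ (a, k) (q.1, q.2.1)) tNonzero :=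
    (contDiffOn_wE κ n (a, k)).comp (contDiff_fst.prodMk (contDiff_fst.comp contDiff_snd)).contDiffOn
      fun q hq => hq
  exact contDiffOn_apply_op (contDiff_wt_β n).contDiffOn ((contDiff_vec n).comp_contDiffOn h1)

theorem contDiffOn_opV (κ : ℝ) (n : ℕ) :
    ContDiffOn ℝ n (fun q : ℝ × ℝ × ℝ => opV κ q.1 q.2.1 q.2.2) tNonzero := by
  have h1 : ContDiffOn ℝ n (fun q : ℝ × ℝ × ℝ => kerH κ (q.1, q.2.1)) tNonzero :=
    (contDiffOn_kerH κ n).comp (contDiff_fst.prodMk (contDiff_fst.comp contDiff_snd)).contDiffOn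
      fun q hq => hq
  exact contDiffOn_comp_op (contDiff_wt_β n).contDiffOn
    (contDiffOn_comp_op ((contDiff_kernOp n).comp_contDiffOn h1) (contDiff_wt_β n).contDiffOn)

/-- The parameters for which `1 + V_T` is an invertible operator. -/
def unitSet (κ : ℝ) : Set (ℝ × ℝ × ℝ) :=
  {q | q.2.1 ≠ 0 ∧ IsUnit (1 + opV κ q.1 q.2.1 q.2.2)}

/-- The units of a Banach algebra are open and `V` depends continuously on the parameters. -/
theorem isOpen_unitSet (κ : ℝ) : IsOpen (unitSet κ) := by
  have h : ContinuousOn (fun q : ℝ × ℝ × ℝ => 1 + opV κ q.1 q.2.1 q.2.2) tNonzero :=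
    continuousOn_const.add (contDiffOn_opV κ 0).continuousOn
  exact h.isOpen_inter_preimage isOpen_tNonzero Units.isOpen

/-- The scalars `∫ lʲ e_a (1 + V)⁻¹ lᵏ e_b`. -/
def scal (κ : ℝ) (a b : Bool) (j k : ℕ) (x t β : ℝ) : ℂ :=
  pairing (eVec κ a j x t β) (res (opV κ x t β) (eVec κ b k x t β))

theorem contDiffOn_res_opV (κ : ℝ) (n : ℕ) :
    ContDiffOn ℝ n (fun q : ℝ × ℝ × ℝ => res (opV κ q.1 q.2.1 q.2.2)) (unitSet κ) := fun q hq =>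
  contDiffWithinAt_res ((contDiffOn_opV κ n).mono (fun _ h => h.1) q hq) hq.2

theorem contDiffOn_res_eVec (κ : ℝ) (b : Bool) (k n : ℕ) :
    ContDiffOn ℝ n (fun q : ℝ × ℝ × ℝ =>
      res (opV κ q.1 q.2.1 q.2.2) (eVec κ b k q.1 q.2.1 q.2.2)) (unitSet κ) :=
  contDiffOn_apply_op (contDiffOn_res_opV κ n) ((contDiffOn_eVec κ b k n).mono fun _ h => h.1)

theorem contDiffOn_scal (κ : ℝ) (a b : Bool) (j k n : ℕ) :
    ContDiffOn ℝ n (fun q : ℝ × ℝ × ℝ => scal κ a b j k q.1 q.2.1 q.2.2) (unitSet κ) :=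
  contDiffOn_pairing ((contDiffOn_eVec κ a j n).mono fun _ h => h.1)
    (contDiffOn_res_eVec κ b k n)

end AnyonNLS

end

/-! ### Identification of the operator formulation with the integral equation. -/

noncomputable section

namespace AnyonNLS

open Complex (I)
open scoped BoundedContinuousFunction

section Concrete

/-- The factor `e^{l²/4}` of the weight undoes two Gaussians `e^{-l²/8}`: one inside `wE`, one
inside `vec` or `kernOp`. -/
theorem wt_mul_gaussWt_sq (β s l : ℝ) :
    wt (0, 0) (β, s) l * gaussWt l * gaussWt l = (√(fermi β (l + s)) : ℝ) := by
  have h : Real.exp (l ^ 2 / 4) * Real.exp (-(l ^ 2) / 8) * Real.exp (-(l ^ 2) / 8) = 1 := by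
    rw [← Real.exp_add, ← Real.exp_add, ← Real.exp_zero]
    congr 1
    ring
  rw [wt_apply, gaussWt, ← Complex.ofReal_mul, ← Complex.ofReal_mul]
  congr 1
  simp only [wtFun, pow_zero, one_mul]
  rw [mul_assoc, mul_assoc, ← mul_assoc (Real.exp _), h, mul_one]

theorem memLp_weighted (κ : ℝ) (w : ℝ →ᵇ ℂ) (a : Bool) (k : ℕ) (q : ℝ × ℝ) :
    MemLp (fun l => w l * (wE κ (a, k) q l * gaussWt l)) 2 :=
  memLp_bcf_mul w (memLp_bcf_mul (wE κ (a, k) q) memLp_gaussWt)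

theorem vecK_eq_toLp (κ : ℝ) (w : ℝ →ᵇ ℂ) (a : Bool) (k : ℕ) (q : ℝ × ℝ) :
    vecK κ w a k q = (memLp_weighted κ w a k q).toLp _ := by
  rw [vecK, vec_eq, mulOp_toLp]

theorem weighted_eq (κ : ℝ) (a : Bool) (β s l : ℝ) (q : ℝ × ℝ) :
    wt (0, 0) (β, s) l * (wE κ (a, 0) q l * gaussWt l) =
      (√(fermi β (l + s)) : ℝ) * bareE κ a q.1 q.2 l := by
  rw [wE_apply, pow_zero, one_mul, ← wt_mul_gaussWt_sq]
  ring

/-- The kernel of `V_T`, with the Fermi weight evaluated at shifted arguments. -/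
def kerShift (κ β s : ℝ) (q : ℝ × ℝ) (l m : ℝ) : ℂ :=
  (√(fermi β (l + s)) : ℝ) * (√(fermi β (m + s)) : ℝ) *
    ((bareE κ true q.1 q.2 l * bareE κ false q.1 q.2 m -
      bareE κ false q.1 q.2 l * bareE κ true q.1 q.2 m) / ((l : ℂ) - (m : ℂ)))

theorem coeFn_opK (κ β s : ℝ) (q : ℝ × ℝ) (f : Ltwo) :
    opK κ (wt (0, 0) (β, s)) q f =ᵐ[volume] fun l => ∫ m, kerShift κ β s q l m * f m := by
  simp only [opK, ContinuousLinearMap.comp_apply]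
  filter_upwards [coeFn_mulOp (wt (0, 0) (β, s)) (kernOp (kerH κ q) (mulOp (wt (0, 0) (β, s)) f)),
    coeFn_kernOp (kerH κ q) (mulOp (wt (0, 0) (β, s)) f)] with l a1 a2
  rw [a1, a2, kernFun_congr _ (coeFn_mulOp (wt (0, 0) (β, s)) f), kernFun, mul_comm, mul_assoc,
    ← integral_mul_const]
  congr 1
  funext m
  rw [extendZero_kerH, kerFun, kerShift, ← wt_mul_gaussWt_sq, ← wt_mul_gaussWt_sq]
  simp only [wE_apply, pow_zero, one_mul]
  ring

theorem kerV_eq {t : ℝ} (ht : t ≠ 0) (κ x β l m : ℝ) :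
    kerV κ x t β l m = kerShift κ β 0 (x, t) l m := by
  rw [kerV, kerShift, ePlus_eq ht, ePlus_eq ht, eMinus_eq, eMinus_eq, add_zero, add_zero]
  ring

theorem eVec_ae (κ x β : ℝ) {t : ℝ} (ht : t ≠ 0) :
    eVec κ true 0 x t β =ᵐ[volume] ePlus κ x t β ∧
      eVec κ false 0 x t β =ᵐ[volume] eMinus κ x t β := by
  constructor
  · rw [eVec, vecK_eq_toLp]
    filter_upwards [(memLp_weighted κ (wt (0, 0) (β, 0)) true 0 (x, t)).coeFn_toLp] with l hl
    rw [hl, weighted_eq, ePlus_eq ht, add_zero]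
  · rw [eVec, vecK_eq_toLp]
    filter_upwards [(memLp_weighted κ (wt (0, 0) (β, 0)) false 0 (x, t)).coeFn_toLp] with l hl
    rw [hl, weighted_eq, eMinus_eq, add_zero]

theorem solves_iff {κ x t β : ℝ} (ht : t ≠ 0) {h f : ℝ → ℂ} (hh : MemLp h 2 volume) :
    Solves κ x t β h f ↔ ∃ hf : MemLp f 2 volume,
      hf.toLp f + opV κ x t β (hf.toLp f) = hh.toLp h := by
  have key : ∀ hf : MemLp f 2 volume, (∀ᵐ l : ℝ, f l + ∫ μ : ℝ, kerV κ x t β l μ * f μ = h l) ↔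
      hf.toLp f + opV κ x t β (hf.toLp f) = hh.toLp h := by
    intro hf
    have e1 : ∀ l, ∫ m, kerShift κ β 0 (x, t) l m * (hf.toLp f) m =
        ∫ μ : ℝ, kerV κ x t β l μ * f μ := by
      intro l
      refine integral_congr_ae ?_
      filter_upwards [hf.coeFn_toLp] with m hm
      rw [hm, kerV_eq ht]
    have e2 := coeFn_opK κ β 0 (x, t) (hf.toLp f)
    simp only [e1] at e2
    constructor
    · intro hae
      refine Lp.ext ?_
      filter_upwards [hae, e2, hf.coeFn_toLp, hh.coeFn_toLp,
        Lp.coeFn_add (hf.toLp f) (opV κ x t β (hf.toLp f))] with l a1 a2 a3 a4 a5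
      rw [a5, a4, Pi.add_apply, a3, opV, a2, a1]
    · intro heq
      have h5 := Lp.coeFn_add (hf.toLp f) (opV κ x t β (hf.toLp f))
      rw [heq] at h5
      filter_upwards [e2, hf.coeFn_toLp, hh.coeFn_toLp, h5] with l a2 a3 a4 a5
      rw [a4, Pi.add_apply, a3, opV, a2] at a5
      exact a5.symm
  constructor
  · rintro ⟨hf, hae⟩
    exact ⟨hf, (key hf).1 hae⟩
  · rintro ⟨hf, heq⟩
    exact ⟨hf, (key hf).2 heq⟩

/-- Existence and uniqueness in `L²` amount to bijectivity, and a bijective bounded operator on a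
Banach space has a bounded inverse. -/
theorem oneAddVInvertible_iff {κ x t β : ℝ} (ht : t ≠ 0) :
    OneAddVInvertible κ x t β ↔ IsUnit (1 + opV κ x t β) := by
  constructor
  · intro hinv
    have happ : ∀ u, (1 + opV κ x t β) u = u + opV κ x t β u := fun u => rfl
    rw [ContinuousLinearMap.isUnit_iff_bijective]
    constructor
    · intro u v huv
      rw [happ, happ] at huv
      have hu := Lp.memLp u
      have hv := Lp.memLp v
      have hh := Lp.memLp (u + opV κ x t β u)
      have su : Solves κ x t β (u + opV κ x t β u : Ltwo) u := by
        rw [solves_iff ht hh]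
        refine ⟨hu, ?_⟩
        simp only [Lp.toLp_coeFn]
      have sv : Solves κ x t β (u + opV κ x t β u : Ltwo) v := by
        rw [solves_iff ht hh]
        refine ⟨hv, ?_⟩
        simp only [Lp.toLp_coeFn, huv]
      exact Lp.ext ((hinv _ hh).2 _ _ su sv)
    · intro h
      obtain ⟨f, hf⟩ := (hinv h (Lp.memLp h)).1
      rw [solves_iff ht (Lp.memLp h)] at hf
      obtain ⟨hf, heq⟩ := hf
      refine ⟨hf.toLp f, ?_⟩
      rw [happ, heq, Lp.toLp_coeFn]
  · intro hu h hh
    constructor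
    · refine ⟨res (opV κ x t β) (hh.toLp h), ?_⟩
      rw [solves_iff ht hh]
      refine ⟨Lp.memLp _, ?_⟩
      rw [Lp.toLp_coeFn, res_apply_add hu]
    · intro f₁ f₂ h₁ h₂
      rw [solves_iff ht hh] at h₁ h₂
      obtain ⟨m₁, e₁⟩ := h₁
      obtain ⟨m₂, e₂⟩ := h₂
      rw [← MemLp.toLp_eq_toLp_iff m₁ m₂, ← res_eq_of_add_eq hu e₁, ← res_eq_of_add_eq hu e₂]

theorem regularSet_eq (κ : ℝ) : regularSet κ = unitSet κ := by
  ext ⟨x, t, β⟩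
  simp only [regularSet, unitSet, Set.mem_ofPred_eq]
  exact and_congr_right fun ht => oneAddVInvertible_iff ht

/-- Whichever solution the choice operator picks, its class in `L²` is the resolvent applied to `e`,
and the integral depends only on that class. -/
theorem integral_mul_epsilon {κ x t β : ℝ} (ht : t ≠ 0) (hu : IsUnit (1 + opV κ x t β)) {e : ℝ → ℂ}
    {v : Ltwo} (he : v =ᵐ[volume] e) :
    ∫ l, e l * Classical.epsilon (fun f : ℝ → ℂ => Solves κ x t β e f) l =
      pairing v (res (opV κ x t β) v) := by
  have hm : MemLp e 2 := (memLp_congr_ae he).1 (Lp.memLp v)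
  have hv : hm.toLp e = v := by
    refine Lp.ext ?_
    filter_upwards [hm.coeFn_toLp, he] with l a1 a2
    rw [a1, a2]
  have hs : Solves κ x t β e (Classical.epsilon (fun f : ℝ → ℂ => Solves κ x t β e f)) :=
    Classical.epsilon_spec (((oneAddVInvertible_iff ht).2 hu) e hm).1
  rw [solves_iff ht hm] at hs
  obtain ⟨hf, heq⟩ := hs
  rw [hv] at heq
  rw [res_eq_of_add_eq hu heq, ← hv, pairing_toLp]

theorem potBpp_eq {κ x t β : ℝ} (h : (x, t, β) ∈ unitSet κ) :
    potBpp κ x t β = scal κ true true 0 0 x t β :=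
  integral_mul_epsilon h.1 h.2 (eVec_ae κ x β h.1).1

theorem potBmm_eq {κ x t β : ℝ} (h : (x, t, β) ∈ unitSet κ) :
    potBmm κ x t β = scal κ false false 0 0 x t β :=
  integral_mul_epsilon h.1 h.2 (eVec_ae κ x β h.1).2

end Concrete

/-! ### Translation covariance in the spectral variable. -/

section Translation

/-- Translation `f ↦ f(· + s)` on `L²`. -/
def translate (s : ℝ) (f : Ltwo) : Ltwo :=
  Lp.compMeasurePreserving (fun l => l + s) (measurePreserving_add_right volume s) f

theorem coeFn_translate (s : ℝ) (f : Ltwo) : translate s f =ᵐ[volume] fun l => f (l + s) :=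
  Lp.coeFn_compMeasurePreserving f (measurePreserving_add_right volume s)

theorem translate_add (s : ℝ) (f g : Ltwo) :
    translate s (f + g) = translate s f + translate s g :=
  map_add _ _ _

theorem pairing_translate (s : ℝ) (u v : Ltwo) :
    pairing (translate s u) (translate s v) = pairing u v := by
  rw [pairing_apply, pairing_apply, ← integral_add_right_eq_self (fun l => u l * v l) s]
  refine integral_congr_ae ?_
  filter_upwards [coeFn_translate s u, coeFn_translate s v] with l a1 a2
  rw [a1, a2]

theorem translate_congr {s : ℝ} {u v : Ltwo} {f : ℝ → ℂ} (hu : u =ᵐ[volume] f)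
    (hv : v =ᵐ[volume] fun l => f (l + s)) : translate s u = v := by
  refine Lp.ext ?_
  have h := (measurePreserving_add_right volume s).quasiMeasurePreserving.ae hu
  filter_upwards [coeFn_translate s u, hv, h] with l a1 a2 a3
  rw [a1, a2, a3]

/-- The phase acquired by `e_a` under translation. -/
def gauge (a : Bool) (x t s : ℝ) : ℂ :=
  Complex.exp ((if a then -1 else 1) * (I * (t * s ^ 2 + x * s)))

/-- A Galilean shift: `J` depends on `l` only through `x + 2tl`, and `t(l+s)² + (l+s)x = tl² +
l(x+2ts) + ts² + xs`. -/
theorem bareE_shift (κ : ℝ) (a : Bool) (x t s l : ℝ) :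
    bareE κ a x t (l + s) = gauge a x t s * bareE κ a (x + 2 * t * s) t l := by
  cases a
  · simp only [bareE, gauge, Bool.false_eq_true, if_false]
    rw [mul_left_comm, ← Complex.exp_add]
    congr 2
    push_cast
    ring
  · simp only [bareE, gauge, if_true]
    have hJ : funJ x t (l + s) = funJ (x + 2 * t * s) t l := by
      rw [funJ, funJ]
      congr 3
      ring
    rw [hJ, ← mul_assoc, mul_left_comm, ← Complex.exp_add]
    congr 3
    push_cast
    ring

theorem gauge_mul_gauge (x t s : ℝ) : gauge true x t s * gauge false x t s = 1 := by
  rw [gauge, gauge, ← Complex.exp_add]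
  simp

/-- Each term of the kernel contains one `e₊` and one `e₋`, whose phases are inverse to each other.
-/
theorem kerShift_shift (κ β x t s l m : ℝ) :
    kerShift κ β 0 (x, t) (l + s) (m + s) = kerShift κ β s (x + 2 * t * s, t) l m := by
  have h := gauge_mul_gauge x t s
  simp only [kerShift, bareE_shift, add_zero]
  have e : ((l + s : ℝ) : ℂ) - ((m + s : ℝ) : ℂ) = (l : ℂ) - m := by push_cast; ring
  rw [e]
  congr 2
  linear_combination (bareE κ true (x + 2 * t * s) t l * bareE κ false (x + 2 * t * s) t m -
    bareE κ false (x + 2 * t * s) t l * bareE κ true (x + 2 * t * s) t m) * h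

theorem translate_eVec (κ : ℝ) (a : Bool) (x t β s : ℝ) :
    translate s (eVec κ a 0 x t β) =
      gauge a x t s • vecK κ (wt (0, 0) (β, s)) a 0 (x + 2 * t * s, t) := by
  rw [eVec, vecK_eq_toLp, vecK_eq_toLp]
  refine translate_congr (MemLp.coeFn_toLp _) ?_
  filter_upwards [Lp.coeFn_smul (gauge a x t s) ((memLp_weighted κ (wt (0, 0) (β, s)) a 0
    (x + 2 * t * s, t)).toLp _), (memLp_weighted κ (wt (0, 0) (β, s)) a 0
    (x + 2 * t * s, t)).coeFn_toLp] with l a1 a2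
  rw [a1, Pi.smul_apply, a2, weighted_eq, weighted_eq, bareE_shift, add_zero, smul_eq_mul]
  ring

theorem translate_opV (κ x t β s : ℝ) (f : Ltwo) :
    translate s (opV κ x t β f) =
      opK κ (wt (0, 0) (β, s)) (x + 2 * t * s, t) (translate s f) := by
  refine translate_congr (coeFn_opK κ β 0 (x, t) f) ?_
  filter_upwards [coeFn_opK κ β s (x + 2 * t * s, t) (translate s f)] with l hl
  rw [hl, ← integral_add_right_eq_self (fun m => kerShift κ β 0 (x, t) (l + s) m * f m) s]
  refine integral_congr_ae ?_
  filter_upwards [coeFn_translate s f] with m hm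
  rw [hm, kerShift_shift]

/-- The left side does not depend on `s`, while the right side moves both the weight and `x`. Its
derivative at `s = 0` relates these two variations. -/
theorem scal_eq_translate {κ x t β s : ℝ} (hu : IsUnit (1 + opV κ x t β))
    (hs : IsUnit (1 + opK κ (wt (0, 0) (β, s)) (x + 2 * t * s, t))) (a b : Bool) :
    scal κ a b 0 0 x t β = gauge a x t s * gauge b x t s *
      pairing (vecK κ (wt (0, 0) (β, s)) a 0 (x + 2 * t * s, t))
        (res (opK κ (wt (0, 0) (β, s)) (x + 2 * t * s, t))
          (vecK κ (wt (0, 0) (β, s)) b 0 (x + 2 * t * s, t))) := by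
  set f := res (opV κ x t β) (eVec κ b 0 x t β) with hf
  have h1 : f + opV κ x t β f = eVec κ b 0 x t β := res_apply_add hu _
  have h2 := congrArg (translate s) h1
  rw [translate_add, translate_opV] at h2
  have h3 := res_eq_of_add_eq hs h2
  rw [scal, ← hf, ← pairing_translate s, ← h3, translate_eVec, translate_eVec]
  simp only [map_smul, smul_apply, smul_eq_mul]
  ring

end Translation

end AnyonNLS

end

/-! ### Resolvent identities and derivatives of the scalars. -/

noncomputable section

namespace AnyonNLS

open Complex (I)
open scoped BoundedContinuousFunction

attribute [local irreducible] pairing mulOp kernOp vec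

section Resolvent

/-- The solution `f_a` of `(1 + V) f_a = e_a`. -/
def fVec (κ : ℝ) (a : Bool) (x t β : ℝ) : Ltwo := res (opV κ x t β) (eVec κ a 0 x t β)

/-- The factor `y_a` in `f_a = e^{l²/4} √ϑ y_a`. -/
def yVec (κ : ℝ) (a : Bool) (x t β : ℝ) : Ltwo :=
  vec (wE κ (a, 0) (x, t)) - kernOp (kerH κ (x, t)) (mulOp (wt (0, 0) (β, 0)) (fVec κ a x t β))

/-- The vector `l f_a`. -/
def lfVec (κ : ℝ) (a : Bool) (x t β : ℝ) : Ltwo := mulOp (wt (1, 0) (β, 0)) (yVec κ a x t β)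

variable {κ x t β : ℝ}

theorem pairing_opV (u v : Ltwo) :
    pairing (opV κ x t β u) v = pairing u (opV κ x t β v) := pairing_opK _ _ _ _ _

/-- The equation `f = e - Vf` exhibits `f` as a rapidly decaying weight times an `L²` function. This
gives meaning to `l f` in `L²` without an unbounded operator. -/
theorem fVec_eq (h : (x, t, β) ∈ unitSet κ) (a : Bool) :
    fVec κ a x t β = mulOp (wt (0, 0) (β, 0)) (yVec κ a x t β) := by
  rw [yVec, map_sub, eq_sub_iff_add_eq]
  exact res_apply_add h.2 _

theorem scal_symm (h : (x, t, β) ∈ unitSet κ) (a b : Bool) (j k : ℕ) :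
    scal κ a b j k x t β = scal κ b a k j x t β := by
  rw [scal, scal, pairing_comm, pairing_res h.2 pairing_opV]

theorem wt_mul_wE_succ (κ β : ℝ) (a : Bool) (k : ℕ) (q : ℝ × ℝ) :
    wt (0, 0) (β, 0) * wE κ (a, k + 1) q = wt (1, 0) (β, 0) * wE κ (a, k) q := by
  ext l
  simp only [BoundedContinuousFunction.mul_apply, wt_apply, wE_apply, wtFun]
  push_cast
  ring

theorem eVec_succ (κ : ℝ) (a : Bool) (k : ℕ) (x t β : ℝ) :
    eVec κ a (k + 1) x t β = mulOp (wt (1, 0) (β, 0)) (vec (wE κ (a, k) (x, t))) := by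
  rw [eVec, vecK, mulOp_vec, mulOp_vec, wt_mul_wE_succ]

theorem pairing_eVec_lfVec (h : (x, t, β) ∈ unitSet κ) (a b : Bool) (j : ℕ) :
    pairing (eVec κ a j x t β) (lfVec κ b x t β) = scal κ a b (j + 1) 0 x t β := by
  rw [scal, ← fVec, fVec_eq h, eVec_succ, lfVec, eVec, vecK, pairing_mulOp, pairing_mulOp,
    mulOp_comm]

/-- The factor `l - m` from the commutator with multiplication by `l` cancels the denominator of the
kernel and leaves a rank two operator. -/
theorem commutator (κ x t β : ℝ) (f : Ltwo) :
    mulOp (wt (1, 0) (β, 0)) (kernOp (kerH κ (x, t)) (mulOp (wt (0, 0) (β, 0)) f)) -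
      mulOp (wt (0, 0) (β, 0)) (kernOp (kerH κ (x, t)) (mulOp (wt (1, 0) (β, 0)) f)) =
    pairing (eVec κ false 0 x t β) f • eVec κ true 0 x t β -
      pairing (eVec κ true 0 x t β) f • eVec κ false 0 x t β := by
  have e : kerH κ (x, t) * tensor (wt (1, 0) (β, 0)) (wt (0, 0) (β, 0)) -
      kerH κ (x, t) * tensor (wt (0, 0) (β, 0)) (wt (1, 0) (β, 0)) =
      tensor (wt (0, 0) (β, 0) * wE κ (true, 0) (x, t)) (wt (0, 0) (β, 0) * wE κ (false, 0) (x, t)) -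
      tensor (wt (0, 0) (β, 0) * wE κ (false, 0) (x, t))
        (wt (0, 0) (β, 0) * wE κ (true, 0) (x, t)) := by
    ext p
    have hp : ((p.1.1 : ℂ) - (p.1.2 : ℂ)) ≠ 0 := by
      rw [sub_ne_zero]
      exact_mod_cast p.2
    simp only [BoundedContinuousFunction.sub_apply, BoundedContinuousFunction.mul_apply,
      tensor_apply, kerH_apply, kerFun, wt_apply, wtFun]
    push_cast
    field_simp
    ring
  have h := congrArg (fun k => kernOp k f) e
  simp only [map_sub, ← mulOp_comp_kernOp_comp, kernOp_tensor, sub_apply,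
    ContinuousLinearMap.comp_apply, outer_apply] at h
  rw [h]
  simp only [eVec, vecK, mulOp_vec]

/-- Apply `1 + V` to `l f_a`: by the commutator the result is `l e_a` plus a combination of `e₊` and
`e₋`; then invert. -/
theorem res_eVec_one (h : (x, t, β) ∈ unitSet κ) (a : Bool) :
    res (opV κ x t β) (eVec κ a 1 x t β) = lfVec κ a x t β +
      scal κ false a 0 0 x t β • fVec κ true x t β - scal κ true a 0 0 x t β • fVec κ false x t β := by
  have h1 := commutator κ x t β (fVec κ a x t β)
  have h2 : mulOp (wt (1, 0) (β, 0)) (fVec κ a x t β) =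
      mulOp (wt (0, 0) (β, 0)) (lfVec κ a x t β) := by
    rw [fVec_eq h, lfVec, mulOp_comm]
  have h3 : lfVec κ a x t β = eVec κ a 1 x t β - mulOp (wt (1, 0) (β, 0))
      (kernOp (kerH κ (x, t)) (mulOp (wt (0, 0) (β, 0)) (fVec κ a x t β))) := by
    rw [lfVec, yVec, map_sub, eVec_succ]
  have h4 : lfVec κ a x t β + opV κ x t β (lfVec κ a x t β) = eVec κ a 1 x t β -
      scal κ false a 0 0 x t β • eVec κ true 0 x t β +
      scal κ true a 0 0 x t β • eVec κ false 0 x t β := by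
    have h5 : opV κ x t β (lfVec κ a x t β) = mulOp (wt (0, 0) (β, 0))
        (kernOp (kerH κ (x, t)) (mulOp (wt (0, 0) (β, 0)) (lfVec κ a x t β))) := rfl
    rw [h5, ← h2]
    conv_lhs => rw [h3]
    rw [sub_eq_iff_eq_add] at h1
    rw [h1]
    simp only [scal, fVec]
    abel
  have h6 := res_eq_of_add_eq h.2 h4
  rw [← h6]
  simp only [map_add, map_sub, map_smul, fVec]
  abel

/-- Moves one power of `l` across the resolvent at the cost of products of lower scalars. Every
nonlinear term in the equations is produced here or by the finite rank derivatives of `V`. -/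
theorem scal_shift (h : (x, t, β) ∈ unitSet κ) (a b : Bool) (j : ℕ) :
    scal κ a b (j + 1) 0 x t β = scal κ a b j 1 x t β -
      scal κ false b 0 0 x t β * scal κ a true j 0 x t β +
      scal κ true b 0 0 x t β * scal κ a false j 0 x t β := by
  have h1 : scal κ a b j 1 x t β = pairing (eVec κ a j x t β) (res (opV κ x t β) (eVec κ b 1 x t β)) :=
    rfl
  rw [h1, res_eVec_one h, map_sub, map_add, map_smul, map_smul, pairing_eVec_lfVec h]
  simp only [scal, fVec, smul_eq_mul]
  ring

/-- The derivative of `lʲ e_a` in `x`. -/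
def eVecX (κ : ℝ) (a : Bool) (k : ℕ) (x t β : ℝ) : Ltwo :=
  if a then -I • eVec κ true (k + 1) x t β - (2 * I * potG x t) • eVec κ false k x t β
  else I • eVec κ false (k + 1) x t β

/-- The derivative of `e_a` in `t`. -/
def eVecT (κ : ℝ) (a : Bool) (x t β : ℝ) : Ltwo :=
  if a then -I • eVec κ true 2 x t β - (2 * I * potG x t) • eVec κ false 1 x t β
    + (I * (x / t : ℝ) * potG x t) • eVec κ false 0 x t β
  else I • eVec κ false 2 x t β

theorem hasDerivAt_eVec_x (ht : t ≠ 0) (a : Bool) (k : ℕ) :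
    HasDerivAt (fun s => eVec κ a k s t β) (eVecX κ a k x t β) x :=
  (hasDerivAt_vecK (hasDerivAt_line_x x t) ht).congr_deriv (mulOp_vec_wE'_x _ _ _ _ _)

theorem hasDerivAt_eVec_t (ht : t ≠ 0) (a : Bool) :
    HasDerivAt (fun s => eVec κ a 0 x s β) (eVecT κ a x t β) t :=
  (hasDerivAt_vecK (hasDerivAt_line_t x t) ht).congr_deriv (mulOp_vec_wE'_t _ _ _ _ _)

theorem hasDerivAt_scal_x (h : (x, t, β) ∈ unitSet κ) (a b : Bool) (j k : ℕ) :
    HasDerivAt (fun s => scal κ a b j k s t β)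
      (pairing (eVecX κ a j x t β) (res (opV κ x t β) (eVec κ b k x t β)) +
        pairing (res (opV κ x t β) (eVec κ a j x t β)) (eVecX κ b k x t β) +
        I * (scal κ a true j 0 x t β * scal κ false b 0 k x t β +
          scal κ a false j 0 x t β * scal κ true b 0 k x t β)) x := by
  have hA : HasDerivAt (fun s => opV κ s t β) _ x :=
    (hasDerivAt_opK (hasDerivAt_line_x x t) h.1).congr_deriv (mulOp_kerH'_x _ _ _)
  refine (hasDerivAt_pairing_res (hasDerivAt_eVec_x h.1 a j) (hasDerivAt_eVec_x h.1 b k) hA h.2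
    pairing_opV).congr_deriv ?_
  simp only [smul_apply, add_apply, outer_apply, map_smul, map_add, smul_eq_mul,
    pairing_res h.2 pairing_opV, eVec, scal]
  ring

theorem hasDerivAt_scal_t (h : (x, t, β) ∈ unitSet κ) (a b : Bool) :
    HasDerivAt (fun s => scal κ a b 0 0 x s β)
      (pairing (eVecT κ a x t β) (res (opV κ x t β) (eVec κ b 0 x t β)) +
        pairing (res (opV κ x t β) (eVec κ a 0 x t β)) (eVecT κ b x t β) +
        I * (scal κ a true 0 1 x t β * scal κ false b 0 0 x t β +
          scal κ a true 0 0 x t β * scal κ false b 1 0 x t β +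
          scal κ a false 0 1 x t β * scal κ true b 0 0 x t β +
          scal κ a false 0 0 x t β * scal κ true b 1 0 x t β) +
        2 * I * potG x t * (scal κ a false 0 0 x t β * scal κ false b 0 0 x t β)) t := by
  have hA : HasDerivAt (fun s => opV κ x s β) _ t :=
    (hasDerivAt_opK (hasDerivAt_line_t x t) h.1).congr_deriv (mulOp_kerH'_t _ _ _)
  refine (hasDerivAt_pairing_res (hasDerivAt_eVec_t h.1 a) (hasDerivAt_eVec_t h.1 b) hA h.2
    pairing_opV).congr_deriv ?_
  simp only [smul_apply, add_apply, sub_apply, outer_apply, map_smul, map_add, map_sub, smul_eq_mul,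
    pairing_res h.2 pairing_opV, eVec, scal]
  ring

/-- Insert `e = f + Vf` on both sides. The terms containing `V` cancel against `-½((1-ϑ)V +
V(1-ϑ))`, and the two halves add up to `∫ f (1-ϑ) g`, with `f` and `g` the two resolvent vectors. -/
theorem hasDerivAt_scal_β (h : (x, t, β) ∈ unitSet κ) (a b : Bool) (j k : ℕ) :
    HasDerivAt (fun s => scal κ a b j k x t s)
      (pairing (res (opV κ x t β) (eVec κ a j x t β))
        (mulOp (coFermi β) (res (opV κ x t β) (eVec κ b k x t β)))) β := by
  refine (hasDerivAt_pairing_res (hasDerivAt_eVec_β κ a j x t β) (hasDerivAt_eVec_β κ b k x t β)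
    (hasDerivAt_opV_β κ x t β) h.2 pairing_opV).congr_deriv ?_
  have ha := res_apply_add h.2 (eVec κ a j x t β)
  have hb := res_apply_add h.2 (eVec κ b k x t β)
  set f := res (opV κ x t β) (eVec κ a j x t β)
  set g := res (opV κ x t β) (eVec κ b k x t β)
  rw [← ha, ← hb]
  simp only [smul_apply, add_apply, ContinuousLinearMap.comp_apply, map_smul, map_add, smul_eq_mul,
    pairing_mulOp, pairing_opV]
  ring

end Resolvent

/-! ### The translation identity for the Fermi weight. -/

section Fermi

variable {κ x t β : ℝ}

/-- The derivative in `x` of `∫ e_a f_b`. -/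
def scalX (κ : ℝ) (a b : Bool) (x t β : ℝ) : ℂ :=
  pairing (eVecX κ a 0 x t β) (fVec κ b x t β) + pairing (fVec κ a x t β) (eVecX κ b 0 x t β) +
    I * (scal κ a true 0 0 x t β * scal κ false b 0 0 x t β +
      scal κ a false 0 0 x t β * scal κ true b 0 0 x t β)

theorem hasDerivAt_gauge (a : Bool) (x t : ℝ) :
    HasDerivAt (fun s => gauge a x t s) ((if a then -1 else 1) * (I * x)) 0 := by
  have h1 : HasDerivAt (fun s : ℝ => (s : ℂ)) 1 0 := by
    simpa using (hasDerivAt_id (0 : ℝ)).ofReal_comp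
  have h2 := ((((h1.pow 2).const_mul (t : ℂ)).add (h1.const_mul (x : ℂ))).const_mul I).const_mul
    (if a then (-1 : ℂ) else 1)
  refine h2.cexp.congr_deriv ?_
  simp

theorem gauge_zero (a : Bool) (x t : ℝ) : gauge a x t 0 = 1 := by
  simp [gauge]

/-- The effect of the Fermi weight: invariance of `L²` under translations expresses
`∫ l f_a (1 - ϑ) f_a` through `∫ e_a f_a` and its derivative in `x`. -/
theorem pairing_lfVec_coFermi (h : (x, t, β) ∈ unitSet κ) (a : Bool) :
    pairing (lfVec κ a x t β) (mulOp (coFermi β) (fVec κ a x t β)) =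
      (if a then -1 else 1) * (I * x) * scal κ a a 0 0 x t β + t * scalX κ a a x t β := by
  have hc : HasDerivAt (fun s : ℝ => (x + 2 * t * s, t)) ((2 * t, 0) : ℝ × ℝ) 0 := by
    have h1 : HasDerivAt (fun s : ℝ => x + 2 * t * s) (2 * t) 0 := by
      simpa using ((hasDerivAt_id (0 : ℝ)).const_mul (2 * t)).const_add x
    exact h1.prodMk (hasDerivAt_const 0 t)
  have hc0 : (x, t) = (fun s : ℝ => (x + 2 * t * s, t)) 0 := by simp
  have hdir : ((2 * t, 0) : ℝ × ℝ) = (2 * t) • ((1, 0) : ℝ × ℝ) := by simp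
  have hw := hasDerivAt_mulOp (hasDerivAt_wt_s β)
  have hE : HasDerivAt (fun s : ℝ => vec (wE κ (a, 0) (x + 2 * t * s, t)))
      (((2 * t : ℝ) : ℂ) • vec (wE' κ (a, 0) (x, t) (1, 0))) 0 := by
    refine (hasDerivAt_vec ((hasFDerivAt_wE κ (a, 0) (q := (x, t)) h.1).comp_hasDerivAt_of_eq 0
      hc hc0)).congr_deriv ?_
    rw [hdir, map_smul, ContinuousLinearMap.map_smul_of_tower, Complex.coe_smul]
    rfl
  have hK : HasDerivAt (fun s : ℝ => kernOp (kerH κ (x + 2 * t * s, t)))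
      (((2 * t : ℝ) : ℂ) • kernOp (kerH' κ (x, t) (1, 0))) 0 := by
    refine (hasDerivAt_kernOp ((hasFDerivAt_kerH κ (q := (x, t)) h.1).comp_hasDerivAt_of_eq 0
      hc hc0)).congr_deriv ?_
    rw [hdir, map_smul, ContinuousLinearMap.map_smul_of_tower, Complex.coe_smul]
    rfl
  obtain ⟨u', hu, hu'⟩ : ∃ u', HasDerivAt
      (fun s => vecK κ (wt (0, 0) (β, s)) a 0 (x + 2 * t * s, t)) u' 0 ∧
      u' = -mulOp (coFermi β) (mulOp (wt (1, 0) (β, 0)) (vec (wE κ (a, 0) (x, t)))) +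
        ((2 * t : ℝ) : ℂ) • eVecX κ a 0 x t β := by
    refine ⟨_, hasDerivAt_apply_op hw hE, ?_⟩
    rw [map_neg, neg_apply, map_smul, mulOp_vec_wE'_x, mulOp_mulOp, mul_zero, add_zero]
    rfl
  obtain ⟨A', hA, hA'⟩ : ∃ A', HasDerivAt
      (fun s => opK κ (wt (0, 0) (β, s)) (x + 2 * t * s, t)) A' 0 ∧
      ∀ f, A' f = -mulOp (coFermi β) (mulOp (wt (1, 0) (β, 0)) (kernOp (kerH κ (x, t))
          (mulOp (wt (0, 0) (β, 0)) f))) -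
        mulOp (wt (0, 0) (β, 0)) (kernOp (kerH κ (x, t))
          (mulOp (coFermi β) (mulOp (wt (1, 0) (β, 0)) f))) +
        ((2 * t : ℝ) : ℂ) • -I • (pairing (eVec κ false 0 x t β) f • eVec κ true 0 x t β +
          pairing (eVec κ true 0 x t β) f • eVec κ false 0 x t β) := by
    refine ⟨_, hasDerivAt_comp_op hw (hasDerivAt_comp_op hK hw), fun f => ?_⟩
    have e := congrArg (fun B : Ltwo →L[ℂ] Ltwo => B f) (mulOp_kerH'_x κ (wt (0, 0) (β, 0)) (x, t))
    simp only [ContinuousLinearMap.comp_apply, smul_apply, add_apply, outer_apply] at e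
    simp only [mul_zero, add_zero, map_neg, neg_apply, add_apply, ContinuousLinearMap.comp_apply,
      map_add, smul_apply, map_smul, e, mulOp_mulOp, eVec]
    abel
  have hev : ∀ᶠ s : ℝ in 𝓝 0, IsUnit (1 + opK κ (wt (0, 0) (β, s)) (x + 2 * t * s, t)) := by
    refine (hA.const_add 1).continuousAt.eventually (Units.isOpen.mem_nhds ?_)
    change IsUnit (1 + opK κ (wt (0, 0) (β, 0)) (x + 2 * t * 0, t))
    rw [mul_zero, add_zero]
    exact h.2
  have hunit := hev.self_of_nhds
  have hd := ((hasDerivAt_gauge a x t).mul (hasDerivAt_gauge a x t)).mul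
    (hasDerivAt_pairing_res hu hu hA hunit (pairing_opK κ _ _))
  -- `1 + V` with the shifted weight stays invertible for small `s`, so the translated expression is
  -- constant near `0` and its derivative there vanishes.
  have hd0 := (hasDerivAt_const (0 : ℝ) (scal κ a a 0 0 x t β)).congr_of_eventuallyEq
    (hev.mono fun s hs => (scal_eq_translate h.2 hs a a).symm)
  have key := hd.unique hd0
  have e1 : opK κ (wt (0, 0) (β, 0)) (x + 2 * t * 0, t) = opV κ x t β := by
    rw [mul_zero, add_zero]
    rfl
  have e2 : vecK κ (wt (0, 0) (β, 0)) a 0 (x + 2 * t * 0, t) = eVec κ a 0 x t β := by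
    rw [mul_zero, add_zero]
    rfl
  have e3 : res (opV κ x t β) (eVec κ a 0 x t β) = fVec κ a x t β := rfl
  have hKs : ∀ u v, pairing (kernOp (kerH κ (x, t)) u) v =
      pairing u (kernOp (kerH κ (x, t)) v) := fun u v => pairing_kernOp
        (fun l m => by rw [extendZero_kerH, extendZero_kerH, kerFun_symm]) u v
  simp only [Pi.mul_apply, e1, e2, e3, gauge_zero, hu', hA'] at key
  have e4 : pairing (lfVec κ a x t β) (mulOp (coFermi β) (fVec κ a x t β)) =
      pairing (mulOp (coFermi β) (mulOp (wt (1, 0) (β, 0)) (vec (wE κ (a, 0) (x, t)))))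
        (fVec κ a x t β) - pairing (mulOp (coFermi β) (mulOp (wt (1, 0) (β, 0))
          (kernOp (kerH κ (x, t)) (mulOp (wt (0, 0) (β, 0)) (fVec κ a x t β))))) (fVec κ a x t β) := by
    rw [lfVec, yVec, ← pairing_mulOp, map_sub, map_sub, map_sub, sub_apply]
  -- By symmetry of the kernel, the variations of the left and the right weight in `w K w`
  -- contribute equally.
  have e5 : pairing (fVec κ a x t β) (mulOp (wt (0, 0) (β, 0)) (kernOp (kerH κ (x, t))
      (mulOp (coFermi β) (mulOp (wt (1, 0) (β, 0)) (fVec κ a x t β))))) =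
      pairing (mulOp (coFermi β) (mulOp (wt (1, 0) (β, 0))
          (kernOp (kerH κ (x, t)) (mulOp (wt (0, 0) (β, 0)) (fVec κ a x t β))))) (fVec κ a x t β) := by
    rw [← pairing_mulOp, ← hKs, ← pairing_mulOp, ← pairing_mulOp, mulOp_comm]
  have e6 := fun u => pairing_comm u (fVec κ a x t β)
  have e7 : ∀ b, pairing (fVec κ a x t β) (eVec κ b 0 x t β) = scal κ b a 0 0 x t β :=
    fun b => pairing_comm _ _
  have e8 : ∀ b, pairing (eVec κ b 0 x t β) (fVec κ a x t β) = scal κ b a 0 0 x t β :=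
    fun b => rfl
  rw [e4, scalX, scal_symm h a true, scal_symm h a false]
  simp only [map_add, map_sub, map_neg, map_smul, add_apply, neg_apply, smul_apply, smul_eq_mul,
    e5, e7, e8, ← e6 (mulOp _ _)] at key
  push_cast at key
  -- The factor `1/2`: phase, weight and `x`-shift each enter `key` doubled, from the two equal
  -- vectors or from the speed `2t`.
  linear_combination (-1 / 2 : ℂ) * key

end Fermi

end AnyonNLS

end

/-! ### Differential equations for `B₋₋`, `b₊₊` and `B₊₋`. -/

noncomputable section

namespace AnyonNLS

open Complex (I)
open scoped BoundedContinuousFunction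

attribute [local irreducible] pairing mulOp kernOp vec

section Potentials

theorem I_pow_three : I ^ 3 = -I := by
  rw [pow_succ, Complex.I_sq, neg_one_mul]

/-- The potential `B₋₋`, as a function on the regular set. -/
def fieldM (κ x t β : ℝ) : ℂ := scal κ false false 0 0 x t β

/-- The potential `b₊₊`, as a function on the regular set. -/
def fieldB (κ x t β : ℝ) : ℂ := scal κ true true 0 0 x t β - potG x t

/-- The potential `B₊₋`. -/
def fieldR (κ x t β : ℝ) : ℂ := scal κ true false 0 0 x t β

/-- The derivative of `B₋₋` in `x`. -/
def fieldMX (κ x t β : ℝ) : ℂ :=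
  2 * I * scal κ false false 1 0 x t β + 2 * I * fieldR κ x t β * fieldM κ x t β

/-- The derivative of `b₊₊` in `x`. -/
def fieldBX (κ x t β : ℝ) : ℂ :=
  -2 * I * scal κ true true 1 0 x t β - 2 * I * potG x t * fieldR κ x t β +
    2 * I * fieldB κ x t β * fieldR κ x t β - I * x / t * potG x t

/-- The derivative of `B₊₋` in `β`. -/
def fieldRB (κ x t β : ℝ) : ℂ :=
  pairing (fVec κ true x t β) (mulOp (coFermi β) (fVec κ false x t β))

variable {κ x t β : ℝ}

theorem pairing_eVecX_true (j b k) :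
    pairing (eVecX κ true j x t β) (res (opV κ x t β) (eVec κ b k x t β)) =
      -I * scal κ true b (j + 1) k x t β - 2 * I * potG x t * scal κ false b j k x t β := by
  simp only [eVecX, if_true, map_sub, map_smul, sub_apply, smul_apply, smul_eq_mul, scal]

theorem pairing_eVecX_false (j b k) :
    pairing (eVecX κ false j x t β) (res (opV κ x t β) (eVec κ b k x t β)) =
      I * scal κ false b (j + 1) k x t β := by
  simp only [eVecX, Bool.false_eq_true, if_false, map_smul, smul_apply, smul_eq_mul, scal]

theorem pairing_eVecT_true (b) :
    pairing (eVecT κ true x t β) (res (opV κ x t β) (eVec κ b 0 x t β)) =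
      -I * scal κ true b 2 0 x t β - 2 * I * potG x t * scal κ false b 1 0 x t β +
        I * (x / t) * potG x t * scal κ false b 0 0 x t β := by
  simp only [eVecT, if_true, map_sub, map_add, map_smul, sub_apply, add_apply, smul_apply,
    smul_eq_mul, scal, Complex.ofReal_div]

theorem pairing_eVecT_false (b) :
    pairing (eVecT κ false x t β) (res (opV κ x t β) (eVec κ b 0 x t β)) =
      I * scal κ false b 2 0 x t β := by
  simp only [eVecT, Bool.false_eq_true, if_false, map_smul, smul_apply, smul_eq_mul, scal]

/-- The scalars with one power of `l` enter only through a difference that `scal_shift` evaluates;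
the squares of `B₊₋` cancel, and the `G` term from `∂ₓe₊` completes `B₊₊` to `b₊₊`. -/
theorem hasDerivAt_fieldR_x (h : (x, t, β) ∈ unitSet κ) :
    HasDerivAt (fun s => fieldR κ s t β) (2 * I * fieldM κ x t β * fieldB κ x t β) x := by
  refine (hasDerivAt_scal_x h true false 0 0).congr_deriv ?_
  rw [pairing_comm (res _ _), pairing_eVecX_true, pairing_eVecX_false]
  have h1 := scal_shift h true false 0
  simp only [scal_symm h true false 0 1, zero_add, fieldM, fieldB] at *
  linear_combination (-I) * h1

theorem hasDerivAt_fieldM_x (h : (x, t, β) ∈ unitSet κ) :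
    HasDerivAt (fun s => fieldM κ s t β) (fieldMX κ x t β) x := by
  refine (hasDerivAt_scal_x h false false 0 0).congr_deriv ?_
  rw [pairing_comm (res _ _), pairing_eVecX_false, scal_symm h false true 0 0, fieldMX, fieldM, fieldR]
  ring

theorem hasDerivAt_fieldB_x (h : (x, t, β) ∈ unitSet κ) :
    HasDerivAt (fun s => fieldB κ s t β) (fieldBX κ x t β) x := by
  refine ((hasDerivAt_scal_x h true true 0 0).sub (hasDerivAt_potG_x (t := t) h.1 x)).congr_deriv ?_
  rw [pairing_comm (res _ _), pairing_eVecX_true, scal_symm h false true 0 0, fieldBX, fieldB, fieldR]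
  ring

theorem hasDerivAt_fieldR_t (h : (x, t, β) ∈ unitSet κ) :
    HasDerivAt (fun s => fieldR κ x s β)
      (fieldB κ x t β * fieldMX κ x t β - fieldM κ x t β * fieldBX κ x t β) t := by
  refine (hasDerivAt_scal_t h true false).congr_deriv ?_
  rw [pairing_comm (res _ _), pairing_eVecT_true, pairing_eVecT_false]
  have h2 := scal_shift h true false 1
  have h3 := scal_shift h false true 1
  simp only [scal_symm h true false 0 1, scal_symm h true true 0 1, scal_symm h false true 1 1,
    scal_symm h false true 0 0, one_add_one_eq_two, fieldM, fieldB, fieldMX, fieldBX, fieldR] at *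
  linear_combination (-I) * h2 + I * h3

/-- `∂ₜ` involves scalars with `l²` on one side, `∂ₓ²` also those with `l` on both sides. Two
instances of `scal_shift` reconcile them and leave the cubic term. -/
theorem exists_hasDerivAt_fieldMX_x (h : (x, t, β) ∈ unitSet κ) :
    ∃ D, HasDerivAt (fun s => fieldMX κ s t β) D x ∧ HasDerivAt (fun s => fieldM κ x s β)
      (-I * (1 / 2 * D + 4 * fieldM κ x t β ^ 2 * fieldB κ x t β)) t := by
  have d1 := (hasDerivAt_scal_x h false false 1 0)
  refine ⟨_, (d1.const_mul (2 * I)).add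
    (((hasDerivAt_fieldR_x h).const_mul (2 * I)).mul (hasDerivAt_fieldM_x h)), ?_⟩
  refine (hasDerivAt_scal_t h false false).congr_deriv ?_
  rw [pairing_comm (res _ _), pairing_comm (res _ _), pairing_eVecT_false, pairing_eVecX_false,
    pairing_eVecX_false]
  have h1 := scal_shift h true false 0
  have h2 := scal_shift h false false 1
  simp only [scal_symm h false false 0 1, scal_symm h false true 0 0,
    scal_symm h false true 0 1, zero_add, one_add_one_eq_two, fieldM, fieldB, fieldMX, fieldR]
  simp only [scal_symm h true false 0 1, zero_add, one_add_one_eq_two] at h1 h2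
  linear_combination (norm := (ring_nf; simp only [I_pow_three]; ring)) I * h2 +
    2 * I * scal κ false false 0 0 x t β * h1

/-- As for `B₋₋`, with additional terms from `-2iG e₋` in the derivatives of `e₊`. Subtracting `G`,
which solves the free equation `∂ₜG = (i/2) ∂ₓ²G`, is what absorbs them. -/
theorem exists_hasDerivAt_fieldBX_x (h : (x, t, β) ∈ unitSet κ) :
    ∃ D, HasDerivAt (fun s => fieldBX κ s t β) D x ∧ HasDerivAt (fun s => fieldB κ x s β)
      (I * (1 / 2 * D + 4 * fieldB κ x t β ^ 2 * fieldM κ x t β)) t := by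
  have d1 := (hasDerivAt_scal_x h true true 1 0)
  have d2 := hasDerivAt_potG_x (t := t) h.1 x
  have d3 : HasDerivAt (fun s : ℝ => I * s / t) (I / t) x := by
    simpa using ((hasDerivAt_id x).ofReal_comp.const_mul I).div_const (t : ℂ)
  refine ⟨_, (((d1.const_mul (-2 * I)).sub ((d2.const_mul (2 * I)).mul (hasDerivAt_fieldR_x h))).add
    (((hasDerivAt_fieldB_x h).const_mul (2 * I)).mul (hasDerivAt_fieldR_x h))).sub (d3.mul d2), ?_⟩
  refine ((hasDerivAt_scal_t h true true).sub (hasDerivAt_potG_t (t := t) h.1 x)).congr_deriv ?_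
  rw [pairing_comm (res _ _), pairing_comm (res _ _), pairing_eVecT_true, pairing_eVecX_true,
    pairing_eVecX_true]
  have h1 := scal_shift h true false 0
  have h2 := scal_shift h true true 1
  simp only [scal_symm h true false 0 1, scal_symm h true true 0 1, scal_symm h false true 0 0,
    scal_symm h false true 0 1, zero_add, one_add_one_eq_two, fieldM, fieldB, fieldBX, fieldR]
  simp only [scal_symm h true false 0 1, scal_symm h false true 0 0, zero_add, one_add_one_eq_two] at h1 h2
  linear_combination (norm := (ring_nf; simp only [I_pow_three, Complex.I_sq]; ring)) (-I) * h2 +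
    2 * I * (potG x t - scal κ true true 0 0 x t β) * h1

theorem hasDerivAt_fieldR_β (h : (x, t, β) ∈ unitSet κ) :
    HasDerivAt (fun s => fieldR κ x t s) (fieldRB κ x t β) β :=
  hasDerivAt_scal_β h true false 0 0

theorem scalX_false (h : (x, t, β) ∈ unitSet κ) : scalX κ false false x t β = fieldMX κ x t β :=
  (hasDerivAt_scal_x h false false 0 0).unique (hasDerivAt_fieldM_x h)

theorem scalX_true (h : (x, t, β) ∈ unitSet κ) :
    scalX κ true true x t β = fieldBX κ x t β + I * x / t * potG x t :=
  (hasDerivAt_scal_x h true true 0 0).unique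
    (((hasDerivAt_fieldB_x h).add (hasDerivAt_potG_x (t := t) h.1 x)).congr_of_eventuallyEq
      (Eventually.of_forall fun s => by simp [fieldB]))

theorem pairing_fVec_coFermi_comm (a b : Bool) :
    pairing (fVec κ a x t β) (mulOp (coFermi β) (fVec κ b x t β)) =
      pairing (fVec κ b x t β) (mulOp (coFermi β) (fVec κ a x t β)) := by
  rw [pairing_comm, pairing_mulOp]

/-- `res_eVec_one` splits off `∫ l f_a (1-ϑ) f_a`, the one integral that the resolvent algebra
cannot reduce; `pairing_lfVec_coFermi` evaluates it. -/
theorem hasDerivAt_scal_one_β (h : (x, t, β) ∈ unitSet κ) (a : Bool) :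
    HasDerivAt (fun s => scal κ a a 1 0 x t s)
      ((if a then -1 else 1) * (I * x) * scal κ a a 0 0 x t β + t * scalX κ a a x t β +
        scal κ false a 0 0 x t β *
          pairing (fVec κ true x t β) (mulOp (coFermi β) (fVec κ a x t β)) -
        scal κ true a 0 0 x t β *
          pairing (fVec κ false x t β) (mulOp (coFermi β) (fVec κ a x t β))) β := by
  refine (hasDerivAt_scal_β h a a 1 0).congr_deriv ?_
  rw [← pairing_lfVec_coFermi h, res_eVec_one h]
  simp only [map_sub, map_add, map_smul, sub_apply, add_apply, smul_apply, smul_eq_mul, fVec]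

/-- The `β`-derivative of `B₋₋` cancels between the two summands of `fieldMX`. The surviving
multiple of `∂ₓB₋₋` is later removed by the factor `e^{-2itβ}`. -/
theorem hasDerivAt_fieldMX_β (h : (x, t, β) ∈ unitSet κ) :
    HasDerivAt (fun s => fieldMX κ x t s)
      ((-2 * x + 4 * I * fieldRB κ x t β) * fieldM κ x t β + 2 * I * t * fieldMX κ x t β) β := by
  refine (((hasDerivAt_scal_one_β h false).const_mul (2 * I)).add
    (((hasDerivAt_fieldR_β h).const_mul (2 * I)).mul
      (hasDerivAt_scal_β h false false 0 0))).congr_deriv ?_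
  rw [scalX_false h]
  simp only [fieldM, fieldR, fieldRB, fVec, Bool.false_eq_true, if_false]
  linear_combination 2 * x * scal κ false false 0 0 x t β * Complex.I_sq

theorem hasDerivAt_fieldBX_β (h : (x, t, β) ∈ unitSet κ) :
    HasDerivAt (fun s => fieldBX κ x t s)
      ((-2 * x + 4 * I * fieldRB κ x t β) * fieldB κ x t β - 2 * I * t * fieldBX κ x t β) β := by
  have ht : (t : ℂ) ≠ 0 := by exact_mod_cast h.1
  have hB : HasDerivAt (fun s => fieldB κ x t s)
      (pairing (fVec κ true x t β) (mulOp (coFermi β) (fVec κ true x t β))) β :=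
    (hasDerivAt_scal_β h true true 0 0).sub_const (potG x t)
  have hR := hasDerivAt_fieldR_β h
  refine (((((hasDerivAt_scal_one_β h true).const_mul (-2 * I)).sub
    (hR.const_mul (2 * I * potG x t))).add ((hB.const_mul (2 * I)).mul hR)).sub_const
      (I * x / t * potG x t)).congr_deriv ?_
  rw [scalX_true h, pairing_fVec_coFermi_comm false true, scal_symm h false true 0 0]
  simp only [fieldB, fieldR, fieldRB, if_true]
  have e : (t : ℂ) * (I * x / t * potG x t) = I * x * potG x t := by field_simp
  linear_combination (-2 * I) * e + 2 * x * (scal κ true true 0 0 x t β - potG x t) * Complex.I_sq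

end Potentials

end AnyonNLS

end

/-! ### Partial derivatives of functions of three variables. -/

noncomputable section

namespace AnyonNLS

open Complex (I)

section Partial

variable {F F' : ℝ → ℝ → ℝ → ℂ} {U : Set (ℝ × ℝ × ℝ)} {x t β : ℝ}

theorem eventually_line_x (hU : IsOpen U) (h : (x, t, β) ∈ U) : ∀ᶠ s in 𝓝 x, (s, t, β) ∈ U :=
  (show Continuous fun s : ℝ => (s, t, β) by fun_prop).continuousAt.eventually (hU.mem_nhds h)

theorem eventually_line_t (hU : IsOpen U) (h : (x, t, β) ∈ U) : ∀ᶠ s in 𝓝 t, (x, s, β) ∈ U :=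
  (show Continuous fun s : ℝ => (x, s, β) by fun_prop).continuousAt.eventually (hU.mem_nhds h)

theorem eventually_line_β (hU : IsOpen U) (h : (x, t, β) ∈ U) : ∀ᶠ s in 𝓝 β, (x, t, s) ∈ U :=
  (show Continuous fun s : ℝ => (x, t, s) by fun_prop).continuousAt.eventually (hU.mem_nhds h)

theorem dX_congr (hU : IsOpen U) (hF : ∀ x t β, (x, t, β) ∈ U → F x t β = F' x t β)
    (h : (x, t, β) ∈ U) : dX F x t β = dX F' x t β :=
  EventuallyEq.deriv_eq ((eventually_line_x hU h).mono fun _ hs => hF _ _ _ hs)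

theorem dT_congr (hU : IsOpen U) (hF : ∀ x t β, (x, t, β) ∈ U → F x t β = F' x t β)
    (h : (x, t, β) ∈ U) : dT F x t β = dT F' x t β :=
  EventuallyEq.deriv_eq ((eventually_line_t hU h).mono fun _ hs => hF _ _ _ hs)

theorem dB_congr (hU : IsOpen U) (hF : ∀ x t β, (x, t, β) ∈ U → F x t β = F' x t β)
    (h : (x, t, β) ∈ U) : dB F x t β = dB F' x t β :=
  EventuallyEq.deriv_eq ((eventually_line_β hU h).mono fun _ hs => hF _ _ _ hs)

theorem hasDerivAt_line₃_x (x t β : ℝ) :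
    HasDerivAt (fun s : ℝ => (s, t, β)) ((1 : ℝ), (0 : ℝ), (0 : ℝ)) x :=
  (hasDerivAt_id x).prodMk (hasDerivAt_const x (t, β))

theorem hasDerivAt_line₃_t (x t β : ℝ) :
    HasDerivAt (fun s : ℝ => (x, s, β)) ((0 : ℝ), (1 : ℝ), (0 : ℝ)) t :=
  (hasDerivAt_const t x).prodMk ((hasDerivAt_id t).prodMk (hasDerivAt_const t β))

theorem hasDerivAt_line₃_β (x t β : ℝ) :
    HasDerivAt (fun s : ℝ => (x, t, s)) ((0 : ℝ), (0 : ℝ), (1 : ℝ)) β :=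
  (hasDerivAt_const β x).prodMk ((hasDerivAt_const β t).prodMk (hasDerivAt_id β))

theorem hasFDerivAt_triple (hU : IsOpen U)
    (hF : ContDiffOn ℝ 2 (fun q : ℝ × ℝ × ℝ => F q.1 q.2.1 q.2.2) U) (h : (x, t, β) ∈ U) :
    HasFDerivAt (fun q : ℝ × ℝ × ℝ => F q.1 q.2.1 q.2.2)
      (fderiv ℝ (fun q : ℝ × ℝ × ℝ => F q.1 q.2.1 q.2.2) (x, t, β)) (x, t, β) :=
  ((hF.contDiffAt (hU.mem_nhds h)).differentiableAt (by norm_num)).hasFDerivAt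

theorem dX_eq_fderiv (hU : IsOpen U)
    (hF : ContDiffOn ℝ 2 (fun q : ℝ × ℝ × ℝ => F q.1 q.2.1 q.2.2) U) (h : (x, t, β) ∈ U) :
    dX F x t β = fderiv ℝ (fun q : ℝ × ℝ × ℝ => F q.1 q.2.1 q.2.2) (x, t, β) (1, 0, 0) :=
  ((hasFDerivAt_triple hU hF h).comp_hasDerivAt x (hasDerivAt_line₃_x x t β) :)|>.deriv

theorem dT_eq_fderiv (hU : IsOpen U)
    (hF : ContDiffOn ℝ 2 (fun q : ℝ × ℝ × ℝ => F q.1 q.2.1 q.2.2) U) (h : (x, t, β) ∈ U) :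
    dT F x t β = fderiv ℝ (fun q : ℝ × ℝ × ℝ => F q.1 q.2.1 q.2.2) (x, t, β) (0, 1, 0) :=
  ((hasFDerivAt_triple hU hF h).comp_hasDerivAt t (hasDerivAt_line₃_t x t β) :)|>.deriv

theorem dB_eq_fderiv (hU : IsOpen U)
    (hF : ContDiffOn ℝ 2 (fun q : ℝ × ℝ × ℝ => F q.1 q.2.1 q.2.2) U) (h : (x, t, β) ∈ U) :
    dB F x t β = fderiv ℝ (fun q : ℝ × ℝ × ℝ => F q.1 q.2.1 q.2.2) (x, t, β) (0, 0, 1) :=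
  ((hasFDerivAt_triple hU hF h).comp_hasDerivAt β (hasDerivAt_line₃_β x t β) :)|>.deriv

theorem differentiableOn_fderiv_apply {f : ℝ × ℝ × ℝ → ℂ} (hU : IsOpen U)
    (hf : ContDiffOn ℝ 2 f U) (v : ℝ × ℝ × ℝ) : DifferentiableOn ℝ (fun q => fderiv ℝ f q v) U :=
  ((hf.fderiv_of_isOpen hU (m := 1) (by norm_num)).differentiableOn (by norm_num)).clm_apply
    (differentiableOn_const v)

theorem diffOn_dX (hU : IsOpen U)
    (hF : ContDiffOn ℝ 2 (fun q : ℝ × ℝ × ℝ => F q.1 q.2.1 q.2.2) U) : DiffOn (dX F) U :=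
  (differentiableOn_fderiv_apply hU hF (1, 0, 0)).congr fun _ hq => dX_eq_fderiv hU hF hq

theorem diffOn_dB (hU : IsOpen U)
    (hF : ContDiffOn ℝ 2 (fun q : ℝ × ℝ × ℝ => F q.1 q.2.1 q.2.2) U) : DiffOn (dB F) U :=
  (differentiableOn_fderiv_apply hU hF (0, 0, 1)).congr fun _ hq => dB_eq_fderiv hU hF hq

/-- Mixed partial derivatives of a `C²` function agree. -/
theorem exists_hasDerivAt_mixed (hU : IsOpen U)
    (hF : ContDiffOn ℝ 2 (fun q : ℝ × ℝ × ℝ => F q.1 q.2.1 q.2.2) U) (h : (x, t, β) ∈ U) :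
    ∃ a b c,
      HasDerivAt (fun s => dX F x s β) a t ∧ HasDerivAt (fun s => dT F s t β) a x ∧
      HasDerivAt (fun s => dB F s t β) b x ∧ HasDerivAt (fun s => dX F x t s) b β ∧
      HasDerivAt (fun s => dB F x s β) c t ∧ HasDerivAt (fun s => dT F x t s) c β := by
  set f : ℝ × ℝ × ℝ → ℂ := fun q => F q.1 q.2.1 q.2.2 with hf
  have h2 : HasFDerivAt (fderiv ℝ f) (fderiv ℝ (fderiv ℝ f) (x, t, β)) (x, t, β) :=
    (((hF.fderiv_of_isOpen hU (m := 1) (by norm_num)).differentiableOn (by norm_num)).differentiableAt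
      (hU.mem_nhds h)).hasFDerivAt
  have hv : ∀ v, HasFDerivAt (fun q => fderiv ℝ f q v)
      ((fderiv ℝ (fderiv ℝ f) (x, t, β)).flip v) (x, t, β) := fun v =>
    (h2.clm_apply (hasFDerivAt_const v _)).congr_fderiv (by ext <;> simp)
  have hs : ∀ v w, fderiv ℝ (fderiv ℝ f) (x, t, β) v w = fderiv ℝ (fderiv ℝ f) (x, t, β) w v :=
    (hF.contDiffAt (hU.mem_nhds h)).isSymmSndFDerivAt (by simp)
  refine ⟨fderiv ℝ (fderiv ℝ f) (x, t, β) (0, 1, 0) (1, 0, 0),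
    fderiv ℝ (fderiv ℝ f) (x, t, β) (1, 0, 0) (0, 0, 1),
    fderiv ℝ (fderiv ℝ f) (x, t, β) (0, 1, 0) (0, 0, 1), ?_, ?_, ?_, ?_, ?_, ?_⟩
  · exact ((hv (1, 0, 0)).comp_hasDerivAt t (hasDerivAt_line₃_t x t β)).congr_of_eventuallyEq
      ((eventually_line_t hU h).mono fun s hs => dX_eq_fderiv hU hF hs)
  · rw [hs]
    exact ((hv (0, 1, 0)).comp_hasDerivAt x (hasDerivAt_line₃_x x t β)).congr_of_eventuallyEq
      ((eventually_line_x hU h).mono fun s hs => dT_eq_fderiv hU hF hs)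
  · exact ((hv (0, 0, 1)).comp_hasDerivAt x (hasDerivAt_line₃_x x t β)).congr_of_eventuallyEq
      ((eventually_line_x hU h).mono fun s hs => dB_eq_fderiv hU hF hs)
  · rw [hs]
    exact ((hv (1, 0, 0)).comp_hasDerivAt β (hasDerivAt_line₃_β x t β)).congr_of_eventuallyEq
      ((eventually_line_β hU h).mono fun s hs => dX_eq_fderiv hU hF hs)
  · exact ((hv (0, 0, 1)).comp_hasDerivAt t (hasDerivAt_line₃_t x t β)).congr_of_eventuallyEq
      ((eventually_line_t hU h).mono fun s hs => dB_eq_fderiv hU hF hs)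
  · rw [hs]
    exact ((hv (0, 1, 0)).comp_hasDerivAt β (hasDerivAt_line₃_β x t β)).congr_of_eventuallyEq
      ((eventually_line_β hU h).mono fun s hs => dT_eq_fderiv hU hF hs)

end Partial

/-! ### The equations for `g±`, `n`, `p` and `φ`. -/

section Main

variable {κ x t β : ℝ}

theorem contDiffOn_fieldM (κ : ℝ) :
    ContDiffOn ℝ 2 (fun q : ℝ × ℝ × ℝ => fieldM κ q.1 q.2.1 q.2.2) (unitSet κ) :=
  contDiffOn_scal κ false false 0 0 2

theorem contDiffOn_fieldR (κ : ℝ) :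
    ContDiffOn ℝ 2 (fun q : ℝ × ℝ × ℝ => fieldR κ q.1 q.2.1 q.2.2) (unitSet κ) :=
  contDiffOn_scal κ true false 0 0 2

theorem contDiffOn_potG_triple (κ : ℝ) :
    ContDiffOn ℝ 2 (fun q : ℝ × ℝ × ℝ => potG q.1 q.2.1) (unitSet κ) := by
  have h1 : ContDiffOn ℝ 2 (fun q : ℝ × ℝ × ℝ => (q.1, q.2.1)) (unitSet κ) := by
    fun_prop
  have h2 : ContDiffOn ℝ 2 (fun q : ℝ × ℝ => potG q.1 q.2) {q | q.2 ≠ 0} := by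
    exact_mod_cast contDiffOn_potG 2
  have h3 : Set.MapsTo (fun q : ℝ × ℝ × ℝ => (q.1, q.2.1)) (unitSet κ) {q | q.2 ≠ 0} :=
    fun q hq => by exact hq.1
  have h := h2.comp h1 h3
  rwa [Function.comp_def] at h

theorem contDiffOn_fieldB (κ : ℝ) :
    ContDiffOn ℝ 2 (fun q : ℝ × ℝ × ℝ => fieldB κ q.1 q.2.1 q.2.2) (unitSet κ) :=
  ContDiffOn.sub (f := fun q : ℝ × ℝ × ℝ => scal κ true true 0 0 q.1 q.2.1 q.2.2)
    (contDiffOn_scal κ true true 0 0 2) (contDiffOn_potG_triple κ)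

theorem contDiff_exp (z : ℂ) :
    ContDiff ℝ 2 (fun q : ℝ × ℝ × ℝ => Complex.exp (z * q.2.1 * q.2.2)) := by
  have h1 : ContDiff ℝ 2 (fun q : ℝ × ℝ × ℝ => (q.2.1 : ℂ)) :=
    Complex.ofRealCLM.contDiff.comp (contDiff_fst.comp contDiff_snd)
  have h2 : ContDiff ℝ 2 (fun q : ℝ × ℝ × ℝ => (q.2.2 : ℂ)) :=
    Complex.ofRealCLM.contDiff.comp (contDiff_snd.comp contDiff_snd)
  exact ((contDiff_const.mul h1).mul h2).cexp

theorem hasDerivAt_exp_t (z : ℂ) (t β : ℝ) : HasDerivAt (fun s : ℝ => Complex.exp (z * s * β))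
    (z * β * Complex.exp (z * t * β)) t := by
  have h := (((Complex.ofRealCLM.hasDerivAt (x := t)).const_mul z).mul_const (β : ℂ)).cexp
  refine h.congr_deriv ?_
  simp
  ring

theorem hasDerivAt_exp_β (z : ℂ) (t β : ℝ) : HasDerivAt (fun s : ℝ => Complex.exp (z * t * s))
    (z * t * Complex.exp (z * t * β)) β := by
  have h := ((Complex.ofRealCLM.hasDerivAt (x := β)).const_mul (z * t)).cexp
  refine h.congr_deriv ?_
  simp
  ring

theorem gMinus_eq (h : (x, t, β) ∈ unitSet κ) :
    gMinus κ x t β = Complex.exp (-2 * I * t * β) * fieldM κ x t β := by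
  rw [gMinus, potBmm_eq h, fieldM]

theorem gPlus_eq (h : (x, t, β) ∈ unitSet κ) :
    gPlus κ x t β = Complex.exp (2 * I * t * β) * fieldB κ x t β := by
  rw [gPlus, potbpp, potBpp_eq h, fieldB]

theorem dX_gMinus_eq (h : (x, t, β) ∈ unitSet κ) :
    dX (gMinus κ) x t β = Complex.exp (-2 * I * t * β) * fieldMX κ x t β :=
  (dX_congr (isOpen_unitSet κ) (fun _ _ _ => gMinus_eq) h).trans
    ((hasDerivAt_fieldM_x h).const_mul _).deriv

theorem dX_gPlus_eq (h : (x, t, β) ∈ unitSet κ) :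
    dX (gPlus κ) x t β = Complex.exp (2 * I * t * β) * fieldBX κ x t β :=
  (dX_congr (isOpen_unitSet κ) (fun _ _ _ => gPlus_eq) h).trans
    ((hasDerivAt_fieldB_x h).const_mul _).deriv

theorem exp_mul_exp (t β : ℝ) :
    Complex.exp (-2 * I * t * β) * Complex.exp (2 * I * t * β) = 1 := by
  rw [← Complex.exp_add, ← Complex.exp_zero]
  congr 1
  ring

/-- The exponentials in `g₋g₊` cancel. Together with `potP_eq` this makes `n` and `p` derivatives of
the single potential `B₊₋`. -/
theorem potN_eq (h : (x, t, β) ∈ unitSet κ) :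
    potN κ x t β = -(I / 2) * dX (fieldR κ) x t β := by
  have e : dX (fieldR κ) x t β = _ := (hasDerivAt_fieldR_x h).deriv
  rw [potN, gMinus_eq h, gPlus_eq h, e]
  linear_combination fieldM κ x t β * fieldB κ x t β * (exp_mul_exp t β + Complex.I_sq)

theorem potP_eq (h : (x, t, β) ∈ unitSet κ) : potP κ x t β = -1 * dT (fieldR κ) x t β := by
  have e : dT (fieldR κ) x t β = _ := (hasDerivAt_fieldR_t h).deriv
  rw [potP, gMinus_eq h, gPlus_eq h, dX_gMinus_eq h, dX_gPlus_eq h, e]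
  linear_combination (fieldM κ x t β * fieldBX κ x t β - fieldB κ x t β * fieldMX κ x t β) *
    exp_mul_exp t β

/-- Differentiating `e^{2itβ}` in `t` gives the linear term `2βg₊`; the cubic term keeps its form
because the exponentials of `g₊` and `g₋` are inverse. -/
theorem nls_gPlus (h : (x, t, β) ∈ unitSet κ) :
    -I * dT (gPlus κ) x t β = 2 * β * gPlus κ x t β + 1 / 2 * dX (dX (gPlus κ)) x t β +
      4 * gPlus κ x t β ^ 2 * gMinus κ x t β := by
  obtain ⟨D, hD, hT⟩ := exists_hasDerivAt_fieldBX_x h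
  have e1 : dX (dX (gPlus κ)) x t β = Complex.exp (2 * I * t * β) * D :=
    (dX_congr (isOpen_unitSet κ) (fun _ _ _ => dX_gPlus_eq) h).trans (hD.const_mul _).deriv
  have e2 : dT (gPlus κ) x t β = _ :=
    (dT_congr (isOpen_unitSet κ) (fun _ _ _ => gPlus_eq) h).trans
      ((hasDerivAt_exp_t (2 * I) t β).mul hT).deriv
  rw [e1, e2, gPlus_eq h, gMinus_eq h]
  linear_combination
    (-Complex.exp (2 * I * t * β) * (2 * β * fieldB κ x t β + 1 / 2 * D +
      4 * fieldB κ x t β ^ 2 * fieldM κ x t β)) * Complex.I_sq -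
    (4 * Complex.exp (2 * I * t * β) * fieldB κ x t β ^ 2 * fieldM κ x t β) * exp_mul_exp t β

theorem nls_gMinus (h : (x, t, β) ∈ unitSet κ) :
    I * dT (gMinus κ) x t β = 2 * β * gMinus κ x t β + 1 / 2 * dX (dX (gMinus κ)) x t β +
      4 * gMinus κ x t β ^ 2 * gPlus κ x t β := by
  obtain ⟨D, hD, hT⟩ := exists_hasDerivAt_fieldMX_x h
  have e1 : dX (dX (gMinus κ)) x t β = Complex.exp (-2 * I * t * β) * D :=
    (dX_congr (isOpen_unitSet κ) (fun _ _ _ => dX_gMinus_eq) h).trans (hD.const_mul _).deriv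
  have e2 : dT (gMinus κ) x t β = _ :=
    (dT_congr (isOpen_unitSet κ) (fun _ _ _ => gMinus_eq) h).trans
      ((hasDerivAt_exp_t (-2 * I) t β).mul hT).deriv
  rw [e1, e2, gPlus_eq h, gMinus_eq h]
  linear_combination
    (-Complex.exp (-2 * I * t * β) * (2 * β * fieldM κ x t β + 1 / 2 * D +
      4 * fieldM κ x t β ^ 2 * fieldB κ x t β)) * Complex.I_sq -
    (4 * Complex.exp (-2 * I * t * β) * fieldM κ x t β ^ 2 * fieldB κ x t β) * exp_mul_exp t β

/-- The function `φ` of the theorem. -/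
def fieldPhi (κ x t β : ℝ) : ℂ := -2 * x + 4 * I * dB (fieldR κ) x t β

/-- The term `2it ∂ₓb₊₊` from the exponential cancels the one in `hasDerivAt_fieldBX_β`. What
remains is a multiple of `g₊`, with the same factor as for `g₋`. -/
theorem dB_dX_gPlus (h : (x, t, β) ∈ unitSet κ) :
    dB (dX (gPlus κ)) x t β = fieldPhi κ x t β * gPlus κ x t β := by
  have e1 : dB (fieldR κ) x t β = _ := (hasDerivAt_fieldR_β h).deriv
  have e2 : dB (dX (gPlus κ)) x t β = _ :=
    (dB_congr (isOpen_unitSet κ) (fun _ _ _ => dX_gPlus_eq) h).trans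
      ((hasDerivAt_exp_β (2 * I) t β).mul (hasDerivAt_fieldBX_β h)).deriv
  rw [e2, fieldPhi, e1, gPlus_eq h]
  ring

theorem dB_dX_gMinus (h : (x, t, β) ∈ unitSet κ) :
    dB (dX (gMinus κ)) x t β = fieldPhi κ x t β * gMinus κ x t β := by
  have e1 : dB (fieldR κ) x t β = _ := (hasDerivAt_fieldR_β h).deriv
  have e2 : dB (dX (gMinus κ)) x t β = _ :=
    (dB_congr (isOpen_unitSet κ) (fun _ _ _ => dX_gMinus_eq) h).trans
      ((hasDerivAt_exp_β (-2 * I) t β).mul (hasDerivAt_fieldMX_β h)).deriv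
  rw [e2, fieldPhi, e1, gMinus_eq h]
  ring

/-- All three are equalities of mixed second derivatives of `B₊₋`, in `(x,t)`, `(t,β)` and `(x,β)`;
the constant `2` offsets the derivative of `-2x` in `φ`. -/
theorem conservation_laws (h : (x, t, β) ∈ unitSet κ) :
    -2 * I * dT (potN κ) x t β = dX (potP κ) x t β ∧
      -I * dT (fieldPhi κ) x t β + 4 * dB (potP κ) x t β = 0 ∧
      dX (fieldPhi κ) x t β + 8 * dB (potN κ) x t β + 2 = 0 := by
  obtain ⟨a, b, c, a1, a2, b1, b2, c1, c2⟩ :=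
    exists_hasDerivAt_mixed (isOpen_unitSet κ) (contDiffOn_fieldR κ) h
  have hU := isOpen_unitSet κ
  have e1 : dT (potN κ) x t β = _ :=
    (dT_congr hU (fun _ _ _ => potN_eq) h).trans (a1.const_mul (-(I / 2))).deriv
  have e2 : dX (potP κ) x t β = _ :=
    (dX_congr hU (fun _ _ _ => potP_eq) h).trans (a2.const_mul (-1)).deriv
  have e3 : dT (fieldPhi κ) x t β = _ := ((c1.const_mul (4 * I)).const_add (-2 * (x : ℂ))).deriv
  have e4 : dB (potP κ) x t β = _ :=
    (dB_congr hU (fun _ _ _ => potP_eq) h).trans (c2.const_mul (-1)).deriv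
  have e5 : dX (fieldPhi κ) x t β = _ :=
    (((Complex.ofRealCLM.hasDerivAt (x := x)).const_mul (-2 : ℂ)).add (b1.const_mul (4 * I))).deriv
  have e6 : dB (potN κ) x t β = _ :=
    (dB_congr hU (fun _ _ _ => potN_eq) h).trans (b2.const_mul (-(I / 2))).deriv
  rw [e1, e2, e3, e4, e5, e6]
  refine ⟨?_, ?_, ?_⟩
  · linear_combination a * Complex.I_sq
  · linear_combination (-4 * c) * Complex.I_sq
  · simp only [Complex.ofRealCLM_apply, Complex.ofReal_one]
    ring

theorem diffOn_fieldPhi (κ : ℝ) : DiffOn (fieldPhi κ) (unitSet κ) := by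
  have h1 : Differentiable ℝ (fun q : ℝ × ℝ × ℝ => (-2 : ℂ) * (q.1 : ℂ)) :=
    (Complex.ofRealCLM.differentiable.comp differentiable_fst).const_mul _
  exact h1.differentiableOn.add
    ((diffOn_dB (isOpen_unitSet κ) (contDiffOn_fieldR κ)).const_mul (4 * I))

theorem contDiffOn_gPlus (κ : ℝ) :
    ContDiffOn ℝ 2 (fun q : ℝ × ℝ × ℝ => gPlus κ q.1 q.2.1 q.2.2) (unitSet κ) :=
  ((contDiff_exp (2 * I)).contDiffOn.mul (contDiffOn_fieldB κ)).congr fun _ hq => gPlus_eq hq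

theorem contDiffOn_gMinus (κ : ℝ) :
    ContDiffOn ℝ 2 (fun q : ℝ × ℝ × ℝ => gMinus κ q.1 q.2.1 q.2.2) (unitSet κ) :=
  ((contDiff_exp (-2 * I)).contDiffOn.mul (contDiffOn_fieldM κ)).congr fun _ hq => gMinus_eq hq

end Main

end AnyonNLS

end

theorem mainTheorem2 (κ : ℝ) (hκ : κ ∈ Set.Icc (0 : ℝ) 1) :
    IsOpen (AnyonNLS.regularSet κ) ∧
    AnyonNLS.DiffOn (AnyonNLS.gPlus κ) (AnyonNLS.regularSet κ) ∧
    AnyonNLS.DiffOn (AnyonNLS.gMinus κ) (AnyonNLS.regularSet κ) ∧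
    AnyonNLS.DiffOn (AnyonNLS.dX (AnyonNLS.gPlus κ)) (AnyonNLS.regularSet κ) ∧
    AnyonNLS.DiffOn (AnyonNLS.dX (AnyonNLS.gMinus κ)) (AnyonNLS.regularSet κ) ∧
    (∀ x t β : ℝ, (x, t, β) ∈ AnyonNLS.regularSet κ →
      -Complex.I * AnyonNLS.dT (AnyonNLS.gPlus κ) x t β =
          2 * β * AnyonNLS.gPlus κ x t β
            + 1 / 2 * AnyonNLS.dX (AnyonNLS.dX (AnyonNLS.gPlus κ)) x t β
            + 4 * AnyonNLS.gPlus κ x t β ^ 2 * AnyonNLS.gMinus κ x t β ∧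
      Complex.I * AnyonNLS.dT (AnyonNLS.gMinus κ) x t β =
          2 * β * AnyonNLS.gMinus κ x t β
            + 1 / 2 * AnyonNLS.dX (AnyonNLS.dX (AnyonNLS.gMinus κ)) x t β
            + 4 * AnyonNLS.gMinus κ x t β ^ 2 * AnyonNLS.gPlus κ x t β ∧
      -2 * Complex.I * AnyonNLS.dT (AnyonNLS.potN κ) x t β =
          AnyonNLS.dX (AnyonNLS.potP κ) x t β) ∧
    ∃ φ : ℝ → ℝ → ℝ → ℂ,
      AnyonNLS.DiffOn φ (AnyonNLS.regularSet κ) ∧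
      ∀ x t β : ℝ, (x, t, β) ∈ AnyonNLS.regularSet κ →
        AnyonNLS.dB (AnyonNLS.dX (AnyonNLS.gPlus κ)) x t β
            = φ x t β * AnyonNLS.gPlus κ x t β ∧
        AnyonNLS.dB (AnyonNLS.dX (AnyonNLS.gMinus κ)) x t β
            = φ x t β * AnyonNLS.gMinus κ x t β ∧
        -Complex.I * AnyonNLS.dT φ x t β + 4 * AnyonNLS.dB (AnyonNLS.potP κ) x t β = 0 ∧
        AnyonNLS.dX φ x t β + 8 * AnyonNLS.dB (AnyonNLS.potN κ) x t β + 2 = 0 := by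
  rw [AnyonNLS.regularSet_eq]
  have hU := AnyonNLS.isOpen_unitSet κ
  have hp := AnyonNLS.contDiffOn_gPlus κ
  have hm := AnyonNLS.contDiffOn_gMinus κ
  refine ⟨hU, hp.differentiableOn (by norm_num), hm.differentiableOn (by norm_num),
    AnyonNLS.diffOn_dX hU hp, AnyonNLS.diffOn_dX hU hm, fun x t β h => ⟨AnyonNLS.nls_gPlus h,
      AnyonNLS.nls_gMinus h, (AnyonNLS.conservation_laws h).1⟩, AnyonNLS.fieldPhi κ,
    AnyonNLS.diffOn_fieldPhi κ, fun x t β h => ⟨AnyonNLS.dB_dX_gPlus h, AnyonNLS.dB_dX_gMinus h,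
      (AnyonNLS.conservation_laws h).2⟩⟩
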